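/- **Notation.** On the hyperbolic plane $\mathbb H$ (curvature $-1$, measure $dx\,dy/y^2$) put $a(y)=\begin{pmatrix} e^{y}&0\\0&1\end{pmatrix}$, $A=\{a(y):y\in\mathbb R\}$, $w=\begin{pmatrix}0&1\\-1&0\end{pmatrix}$, and $k(\theta)=\begin{pmatrix}\cos\frac\theta2&\sin\frac\theta2\\-\sin\frac\theta2&\cos\frac\theta2\end{pmatrix}$ in $PSL_2(\mathbb R)$. Let $d_G$ be the left-invariant Riemannian distance on $PSL_2(\mathbb R)$ given by the norm $\sqrt{X_1^2+X_2^2+X_3^2}$ of $\begin{pmatrix}X_1&X_2\\X_3&-X_1\end{pmatrix}$ on its Lie algebra. Let $\ell_0(x)=ie^{x}$, so that $\ell_0([0,1])$ is the upward unit geodesic segment based at $i$. A unit geodesic segment with its arc length parametrisation is $\ell=g\ell_0$ with $g\in PSL_2(\mathbb R)$. For $\ell_1=g_1\ell_0$, $\ell_2=g_2\ell_0$ define $$d(\ell_1,\ell_2)=\inf\{d(p,q):p\in\ell_1([0,1]),\,q\in\ell_2([0,1])\},$$ $$n(\ell_1,\ell_2)=\inf_{a\in A}d_G(g_1^{-1}g_2,a),\qquad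 n_{\pm}(\ell_1,\ell_2)=\inf_{a\in A\cup wA}d_G(g_1^{-1}g_2,a).$$ So $n$ measures how far the complete geodesics containing $\ell_1,\ell_2$ are from coinciding with the same orientation, and $n_\pm$ how far they are from coinciding up to orientation. Let $\varphi_s(z)=\frac1{2\pi}\int_0^{2\pi}\operatorname{Im}(k(\theta)z)^{1/2+is}\,d\theta$ be the spherical function, and let the Harish-Chandra transform of a compactly supported function of the form $f(z)=\kappa(d(i,z))$ on $\mathbb H$ be $\int_{\mathbb H}f(z)\varphi_{-s}(z)\,d\mu(z)$. Fix $b\in C_0^\infty(\mathbb R)$ with $\operatorname{supp} b\subset[0,1]$, and a real, nonnegative, even Schwartz function $h$ with compactly supported Fourier transform and with $h\ge1$ on $[-1,1]$. For $t>0$ let $h_t(s)=h(s-t)+h(-s-t)$, and let $k_t(z)=\kappa_t(d(i,z))$ be the continuous compactly supported rotation-invariant function on $\mathbb H$ with Harish-Chandra transform $h_t^2$. Assume that every $k_t$ is supported in the ball of radius $1$ about $i$. Put $K_t(x,y)=\kappa_t(d(x,y))$ and $$I(t,\lambda,\ell_1,\ell_2)=\iint_{\mathbb R^2} b(x_1)b(x_2)e^{i\lambda(x_1-x_2)}K_t(\ell_1(x_1),\ell_2(x_2))\,dx_1\,dx_2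 .$$ **Proposition.** (i) For every $\delta\in(0,1/2)$ there is a constant $C=C(\delta,b,h)>0$ such that for all $t>0$, all $\lambda$ with $\lambda/t\in[\delta,1-\delta]$, and all unit geodesic segments with $d(\ell_1,\ell_2)\le1$, $$|I(t,\lambda,\ell_1,\ell_2)|\le C\,(1+t\,n(\ell_1,\ell_2))^{-1/2}\quad\text{if } n(\ell_1,\ell_2)\le t^{-1/3},$$ $$|I(t,\lambda,\ell_1,\ell_2)|\le C\,t^{-1/3}\quad\text{if } n(\ell_1,\ell_2)\ge t^{-1/3}.$$ (ii) There is a constant $C=C(b,h)>0$ such that for all $t>0$ and all unit geodesic segments with $d(\ell_1,\ell_2)\le1$, $$|I(t,0,\ell_1,\ell_2)|\le C\,(1+t\,n_\pm(\ell_1,\ell_2))^{-1/2}.$$ -/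

import Mathlib

open MeasureTheory UpperHalfPlane
open scoped ContDiff FourierTransform SchwartzMap MatrixGroups

noncomputable section

namespace GeodesicPeriod

/-- The diagonal element `a(y)`, normalised to have determinant one. -/
def aElt (y : ℝ) : SL(2, ℝ) :=
  ⟨!![Real.exp (y / 2), 0; 0, Real.exp (-(y / 2))], by
    rw [Matrix.det_fin_two_of, ← Real.exp_add]; simp⟩

/-- The rotation `k(θ)` by the angle `θ` about the point `i`. -/
def kElt (θ : ℝ) : SL(2, ℝ) :=
  ⟨!![Real.cos (θ / 2), Real.sin (θ / 2); -Real.sin (θ / 2), Real.cos (θ / 2)], by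
    rw [Matrix.det_fin_two_of]; nlinarith [Real.sin_sq_add_cos_sq (θ / 2)]⟩

/-- The element `w = ((0, 1), (-1, 0))`. -/
def wElt : SL(2, ℝ) := ⟨!![0, 1; -1, 0], by simp⟩

/-- The subgroup `A`, as a set. -/
def setA : Set SL(2, ℝ) := Set.range aElt

/-- The set `A ∪ wA`; as a subset of `PSL₂(ℝ)` it is the stabiliser of the vertical geodesic
through `i` regarded as an unoriented curve. -/
def setAw : Set SL(2, ℝ) := setA ∪ (fun a => wElt * a) '' setA

/-- The point `i e^x` of the vertical geodesic through `i`; `x` is arc length. -/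
def vert (x : ℝ) : ℍ := ⟨⟨0, Real.exp x⟩, Real.exp_pos x⟩

/-- The geodesic `x ↦ g ⬝ (i e^x)`, parametrised by arc length. Its restriction to `[0, 1]` is
the unit segment `g ℓ₀`. -/
def geod (g : SL(2, ℝ)) (x : ℝ) : ℍ := g • vert x

/-- The distance `d(ℓ₁, ℓ₂)` between the segments `ℓ₁ = g₁ ℓ₀` and `ℓ₂ = g₂ ℓ₀`. -/
def segDist (g₁ g₂ : SL(2, ℝ)) : ℝ :=
  sInf {r | ∃ x ∈ Set.Icc (0 : ℝ) 1, ∃ y ∈ Set.Icc (0 : ℝ) 1, r = dist (geod g₁ x) (geod g₂ y)}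

/-- The norm `√(X₁² + X₂² + X₃²)` of `((X₁, X₂), (X₃, -X₁))`. -/
def lieNorm (X : Matrix (Fin 2) (Fin 2) ℝ) : ℝ :=
  Real.sqrt (X 0 0 ^ 2 + X 0 1 ^ 2 + X 1 0 ^ 2)

/-- The velocity `γ'(s)` of a curve in `SL₂(ℝ)`, as a matrix. -/
def velocity (γ : ℝ → SL(2, ℝ)) (s : ℝ) : Matrix (Fin 2) (Fin 2) ℝ :=
  Matrix.of fun i j => deriv (fun u => (γ u).1 i j) s

/-- The length of a curve on `[0, 1]` for the left-invariant Riemannian metric which `lieNorm`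
defines. -/
def curveLength (γ : ℝ → SL(2, ℝ)) : ℝ :=
  ∫ s in (0 : ℝ)..1, lieNorm ((γ s)⁻¹.1 * velocity γ s)

/-- The left-invariant Riemannian distance on `PSL₂(ℝ)`, between the classes of `g` and `h`:
curves in `PSL₂(ℝ)` are lifted to `SL₂(ℝ)`, where they may end at `h` or at `-h`. -/
def distG (g h : SL(2, ℝ)) : ℝ :=
  sInf {L | ∃ γ : ℝ → SL(2, ℝ), (∀ i j, ContDiff ℝ 1 fun s => (γ s).1 i j) ∧
    γ 0 = g ∧ ((γ 1).1 = h.1 ∨ (γ 1).1 = -h.1) ∧ L = curveLength γ}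

/-- `inf {d_G(g₁⁻¹ g₂, a) | a ∈ S}`. -/
def nDist (S : Set SL(2, ℝ)) (g₁ g₂ : SL(2, ℝ)) : ℝ :=
  sInf {r | ∃ a ∈ S, r = distG (g₁⁻¹ * g₂) a}

/-- The function `n(ℓ₁, ℓ₂)` of the pair of oriented segments `ℓ₁ = g₁ ℓ₀`, `ℓ₂ = g₂ ℓ₀`. -/
def nOr (g₁ g₂ : SL(2, ℝ)) : ℝ := nDist setA g₁ g₂

/-- The variant of `n(ℓ₁, ℓ₂)` for unoriented geodesics. -/
def nUn (g₁ g₂ : SL(2, ℝ)) : ℝ := nDist setAw g₁ g₂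

/-- The spherical function with spectral parameter `s` on `ℍ`. -/
def spherical (s : ℝ) (z : ℍ) : ℂ :=
  (2 * Real.pi : ℂ)⁻¹ *
    ∫ θ in (0 : ℝ)..(2 * Real.pi), (((kElt θ • z).im : ℝ) : ℂ) ^ ((1 / 2 : ℂ) + Complex.I * s)

/-- The Harish-Chandra transform at `s` of the rotation-invariant function `z ↦ κ (d(i, z))`. -/
def hcTransform (κ : ℝ → ℝ) (s : ℝ) : ℂ :=
  ∫ z : ℍ, (κ (dist UpperHalfPlane.I z) : ℂ) * spherical (-s) z

/-- `z ↦ κ (d(i, z))` is continuous, is supported in the unit ball about `i`, and its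
Harish-Chandra transform is `H`. -/
structure IsKernelOf (κ : ℝ → ℝ) (H : ℝ → ℝ) : Prop where
  cont : Continuous fun z : ℍ => κ (dist UpperHalfPlane.I z)
  supp : ∀ r, 1 < r → κ r = 0
  transform : ∀ s : ℝ, hcTransform κ s = (H s : ℂ)

/-- `h_t(s) = h(s - t) + h(-s - t)`. -/
def hShift (h : ℝ → ℝ) (t s : ℝ) : ℝ := h (s - t) + h (-s - t)

/-- The integral `I(t, λ, ℓ₁, ℓ₂)` for `ℓ₁ = g₁ ℓ₀`, `ℓ₂ = g₂ ℓ₀` and for the point-pair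
invariant `(x, y) ↦ κ (d(x, y))`. -/
def kernelIntegral (b : ℝ → ℂ) (κ : ℝ → ℝ) (lam : ℝ) (g₁ g₂ : SL(2, ℝ)) : ℂ :=
  ∫ x₁ : ℝ, ∫ x₂ : ℝ, b x₁ * b x₂ * Complex.exp (Complex.I * lam * (x₁ - x₂)) *
    (κ (dist (geod g₁ x₁) (geod g₂ x₂)) : ℂ)

end GeodesicPeriod

end

noncomputable section

/-! The kernel is expanded over the boundary of the hyperbolic plane, and the integral is then
estimated by two successive applications of stationary phase: one along each geodesic, one over the
boundary.

Spectral expansion. The Harish-Chandra transform of a radial kernel is the Fourier transform of its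
Abel transform (`hcTransform_eq_fourier`). Applying the Abel transform twice amounts to integrating
(`double_abel`), so `abel_inversion` recovers the kernel as a superposition of the functions sin(s
r)/sinh r. Up to the factor s these are the spherical functions of hyperbolic 3-space, where the
product formula `integral_prodPow` is elementary: they are boundary integrals of P₁^(1+is) P₂^(1-is)
for Poisson kernels P₁, P₂. Integrating out the extra dimension (`integral_triple`, `integral_sph3`)
gives `kernel_formula`: the planar kernel is an integral over s > 0 of H(s) s² `bFactor s` `bFactor
(-s)` times the pairing of P₁^(1/2+is) with P₂^(1/2-is) on the boundary line. Since each `bFactor`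
is O(s^(-1/2)), the weight is O(|H(s)| s).

Unfolding. By `kernelIntegral_eq` the double integral becomes the s-integral of this weight against
`periodPairing`, the integral over boundary points ξ of a product of two twisted periods, one for
each segment. If the entries of g₁⁻¹g₂ are A, B, C, D, these periods depend on (ξ, 1) and on the
linear forms (Dξ - B, -Cξ + A).

First stationary phase. With τ = log|p/q|, a period is an explicit size and phase times `betaInt` at
τ, whose phase has derivative λ - s tanh u. It is O(s^(-1/2)) for bounded τ (`norm_betaInt_le`) and
O(1/s) for large τ when |λ| ≤ (1-δ)s (`norm_betaInt_le_of_large`). As τ enters only through b, the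
τ-derivative satisfies the same bound for bounded τ, so the leading amplitude varies slowly in ξ
(`coefAmp_bounds`, `coef_remainder`).

Second stationary phase. In the ξ-integral the derivative of the phase, cleared of denominators, is
the quadratic polynomial N(x) = (s+λ)ac x² + 2λec x - (s-λ)ed, where a, e, c, d are the coefficients
of the linear forms. The regularised van der Corput inequality `norm_integral_le_of_phase` reduces
the bound to the integral of μ²/(N²+μ²), with μ free (`norm_main_integral_le`). If m = |e|+|c| is
small, N and N' are not simultaneously small and the pairing is O(s⁻¹(1+sm)^(-1/2)). If m is bounded
below, some coefficient of N has size at least a multiple of s, and the worst case of a double zero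
gives s⁻¹ s^(-1/3). At λ = 0 the middle coefficient vanishes, and |ed|+|ac| takes the place of m
throughout.

Conclusion. The weight concentrates at s = t (`norm_kernelIntegral_le`), and explicit paths in the
group bound n and n± by these combinations of matrix entries (`nOr_le`, `nUn_le`). -/

namespace GeodesicPeriod

/-! ### Radial kernels and the Harish-Chandra transform -/

/-- The profile `w ↦ κ (arcosh w)`, extended to the left of `1` by a constant. -/
def profile (κ : ℝ → ℝ) (w : ℝ) : ℝ := κ |Real.arcosh (max w 1)|

lemma profile_cosh (κ : ℝ → ℝ) {r : ℝ} (hr : 0 ≤ r) : profile κ (Real.cosh r) = κ r := by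
  rw [profile, max_eq_left (Real.one_le_cosh r), Real.arcosh_cosh hr, abs_of_nonneg hr]

lemma dist_I_vert (x : ℝ) : dist UpperHalfPlane.I (vert x) = |x| := by
  rw [UpperHalfPlane.dist_of_re_eq]
  · simp [vert, Real.dist_eq, UpperHalfPlane.im]
  · simp [vert, UpperHalfPlane.re]

lemma continuous_vert : Continuous vert := by
  rw [UpperHalfPlane.isOpenEmbedding_coe.continuous_iff]
  have : (UpperHalfPlane.coe ∘ vert) = fun x : ℝ => (Real.exp x : ℂ) * Complex.I := by
    ext x
    simp [vert, Complex.ext_iff, -Complex.ofReal_exp]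
  rw [this]
  fun_prop

/-- The hypothesis sees κ only at distances, that is, at nonnegative arguments. Restriction to the
vertical geodesic gives continuity of x ↦ κ |x|, which is why `profile` contains an absolute value.
-/
lemma continuous_profile {κ : ℝ → ℝ}
    (hκ : Continuous fun z : ℍ => κ (dist UpperHalfPlane.I z)) : Continuous (profile κ) := by
  have h1 : Continuous fun x : ℝ => κ |x| := by
    have := hκ.comp continuous_vert
    simpa [Function.comp_def, dist_I_vert] using this
  have h2 : Continuous fun w : ℝ => Real.arcosh (max w 1) :=
    Real.continuousOn_arcosh.comp_continuous (by fun_prop) (fun w => le_max_right w 1)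
  exact h1.comp h2

lemma profile_eq_zero {κ : ℝ → ℝ} (hκ : ∀ r, 1 < r → κ r = 0) {w : ℝ} (hw : Real.cosh 1 < w) :
    profile κ w = 0 := by
  have h1 : 1 ≤ w := (Real.one_le_cosh 1).trans hw.le
  rw [profile, max_eq_left h1, abs_of_nonneg (Real.arcosh_nonneg h1)]
  apply hκ
  rw [← Real.arcosh_cosh (zero_le_one), Real.arcosh_lt_arcosh (Real.cosh_pos _) (by linarith)]
  exact hw

instance : SMulInvariantMeasure SL(2, ℝ) ℍ volume where
  measure_preimage_smul g s hs := by
    exact measure_preimage_smul (μ := (volume : Measure ℍ)) (g : GL (Fin 2) ℝ) s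

lemma kElt_smul_I (θ : ℝ) : kElt θ • UpperHalfPlane.I = UpperHalfPlane.I := by
  ext
  rw [UpperHalfPlane.specialLinearGroup_apply]
  obtain ⟨S, hS⟩ : ∃ S, S = Real.sin (θ / 2) := ⟨_, rfl⟩
  obtain ⟨C, hC⟩ : ∃ C, C = Real.cos (θ / 2) := ⟨_, rfl⟩
  have h : (((-S : ℝ) : ℂ) * Complex.I + C) ≠ 0 := by
    intro h0
    have h1 := congrArg Complex.re h0
    have h2 := congrArg Complex.im h0
    simp at h1 h2
    have := Real.sin_sq_add_cos_sq (θ / 2)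
    rw [← hS, ← hC, h1, h2] at this
    norm_num at this
  simp only [kElt, Algebra.algebraMap_self, RingHom.id_apply, UpperHalfPlane.coe_I]
  simp only [Matrix.of_apply, Matrix.cons_val', Matrix.cons_val_zero, Matrix.cons_val_one,
    Matrix.cons_val_fin_one, ← hS, ← hC]
  rw [div_eq_iff h]
  simp [Complex.ext_iff]

lemma dist_I_kElt_smul (θ : ℝ) (z : ℍ) :
    dist UpperHalfPlane.I (kElt θ • z) = dist UpperHalfPlane.I z := by
  conv_lhs => rw [← kElt_smul_I θ]
  exact dist_smul (kElt θ) _ _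

lemma continuous_kElt : Continuous kElt := by
  refine Continuous.subtype_mk ?_ _
  refine continuous_matrix fun i j => ?_
  fin_cases i <;> fin_cases j <;> simp <;> fun_prop

/-- The function `y ^ (1/2 + i s)` on the upper half plane is continuous. -/
lemma continuous_im_cpow (c : ℂ) : Continuous fun z : ℍ => ((z.im : ℝ) : ℂ) ^ c := by
  refine Continuous.cpow (by fun_prop) continuous_const fun z => ?_
  exact Or.inl (by simpa using z.im_pos)

lemma integrable_radial_mul {κ : ℝ → ℝ}
    (hκ : Continuous fun z : ℍ => κ (dist UpperHalfPlane.I z)) (h1 : ∀ r, 1 < r → κ r = 0)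
    {f : ℍ → ℂ} (hf : Continuous f) :
    Integrable (fun z : ℍ => (κ (dist UpperHalfPlane.I z) : ℂ) * f z) := by
  refine Continuous.integrable_of_hasCompactSupport
    ((Complex.continuous_ofReal.comp hκ).mul hf) ?_
  refine HasCompactSupport.of_support_subset_isCompact
    (isCompact_closedBall UpperHalfPlane.I 1) fun z hz => ?_
  rw [Function.mem_support] at hz
  by_contra hcon
  rw [Metric.mem_closedBall, not_le, dist_comm] at hcon
  exact hz (by simp [h1 _ hcon])

/-- Both the kernel and the measure are invariant under rotations about i, so each angle contributes
the same integral. The average defining the spherical function can therefore be replaced by the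
single power of Im z. -/
lemma hcTransform_eq {κ : ℝ → ℝ}
    (hκ : Continuous fun z : ℍ => κ (dist UpperHalfPlane.I z)) (h1 : ∀ r, 1 < r → κ r = 0)
    (s : ℝ) :
    hcTransform κ s =
      ∫ z : ℍ, (κ (dist UpperHalfPlane.I z) : ℂ) * ((z.im : ℝ) : ℂ) ^ ((1 / 2 : ℂ) - Complex.I * s) := by
  set c : ℂ := (1 / 2 : ℂ) - Complex.I * s with hc
  have hpi : (0 : ℝ) ≤ 2 * Real.pi := by positivity
  have hcont : Continuous fun p : ℍ × ℝ =>
      (κ (dist UpperHalfPlane.I p.1) : ℂ) * (((kElt p.2 • p.1).im : ℝ) : ℂ) ^ c := by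
    refine ((Complex.continuous_ofReal.comp hκ).comp continuous_fst).mul ?_
    exact (continuous_im_cpow c).comp ((continuous_kElt.comp continuous_snd).smul continuous_fst)
  have hfub : Integrable (Function.uncurry fun (z : ℍ) (θ : ℝ) =>
      (κ (dist UpperHalfPlane.I z) : ℂ) * (((kElt θ • z).im : ℝ) : ℂ) ^ c)
      (volume.prod (volume.restrict (Set.Ioc 0 (2 * Real.pi)))) := by
    have hK : IsCompact (Metric.closedBall UpperHalfPlane.I 1 ×ˢ Set.Icc (0 : ℝ) (2 * Real.pi)) :=
      (isCompact_closedBall _ _).prod isCompact_Icc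
    have h2 := hcont.continuousOn.integrableOn_compact (μ := volume.prod volume) hK
    -- The integrand vanishes when z leaves the closed unit ball, so integrability over the compact
    -- product extends to all z.
    have h3 : IntegrableOn (fun p : ℍ × ℝ =>
      (κ (dist UpperHalfPlane.I p.1) : ℂ) * (((kElt p.2 • p.1).im : ℝ) : ℂ) ^ c)
        (Set.univ ×ˢ Set.Icc (0 : ℝ) (2 * Real.pi)) (volume.prod volume) := by
      refine h2.of_forall_sdiff_eq_zero (MeasurableSet.univ.prod measurableSet_Icc) ?_
      rintro ⟨z, θ⟩ ⟨⟨-, hθ⟩, hz⟩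
      have : 1 < dist UpperHalfPlane.I z := by
        by_contra hcon
        refine hz ⟨?_, hθ⟩
        rw [Metric.mem_closedBall, dist_comm]
        exact not_lt.mp hcon
      simp [h1 _ this]
    have h4 := h3.mono_set (Set.prod_mono (le_refl Set.univ) Set.Ioc_subset_Icc_self)
    rw [IntegrableOn, ← Measure.prod_restrict, Measure.restrict_univ] at h4
    exact h4
  have hstep : ∀ θ : ℝ, ∫ z : ℍ, (κ (dist UpperHalfPlane.I z) : ℂ) *
      (((kElt θ • z).im : ℝ) : ℂ) ^ c =
      ∫ z : ℍ, (κ (dist UpperHalfPlane.I z) : ℂ) * ((z.im : ℝ) : ℂ) ^ c := by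
    intro θ
    rw [← integral_smul_eq_self (μ := (volume : Measure ℍ)) (fun z : ℍ =>
      (κ (dist UpperHalfPlane.I z) : ℂ) * ((z.im : ℝ) : ℂ) ^ c) (g := kElt θ)]
    simp only [dist_I_kElt_smul]
  have hexp : (1 / 2 : ℂ) + Complex.I * ((-s : ℝ) : ℂ) = c := by
    rw [hc]; push_cast; ring
  simp only [hcTransform, spherical, hexp]
  calc ∫ z : ℍ, (κ (dist UpperHalfPlane.I z) : ℂ) * ((2 * Real.pi : ℂ)⁻¹ *
        ∫ θ in (0 : ℝ)..(2 * Real.pi), (((kElt θ • z).im : ℝ) : ℂ) ^ c)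
      = ∫ z : ℍ, (2 * Real.pi : ℂ)⁻¹ * ∫ θ in Set.Ioc 0 (2 * Real.pi),
          (κ (dist UpperHalfPlane.I z) : ℂ) * (((kElt θ • z).im : ℝ) : ℂ) ^ c := by
        congr 1; ext z
        rw [intervalIntegral.integral_of_le hpi, integral_const_mul]; ring
    _ = (2 * Real.pi : ℂ)⁻¹ * ∫ θ in Set.Ioc 0 (2 * Real.pi), ∫ z : ℍ,
          (κ (dist UpperHalfPlane.I z) : ℂ) * (((kElt θ • z).im : ℝ) : ℂ) ^ c := by
        rw [integral_const_mul, integral_integral_swap hfub]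
    _ = _ := by
        simp only [hstep]
        rw [setIntegral_const, Real.volume_real_Ioc_of_le hpi, sub_zero, Complex.real_smul,
          ← mul_assoc]
        push_cast
        rw [inv_mul_cancel₀ (by exact_mod_cast Real.two_pi_pos.ne'), one_mul]

lemma range_coe_upperHalfPlane : Set.range UpperHalfPlane.coe = {z : ℂ | 0 < z.im} := by
  ext z
  constructor
  · rintro ⟨w, rfl⟩; exact w.im_pos
  · intro hz; exact ⟨⟨z, hz⟩, rfl⟩

/-- Integration over the upper half plane in the coordinates `x`, `y`. -/
lemma integral_upperHalfPlane (F : ℝ → ℝ → ℂ)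
    (hF : Integrable fun z : ℍ => F z.re z.im) :
    ∫ z : ℍ, F z.re z.im = ∫ y in Set.Ioi (0 : ℝ), ∫ x : ℝ, ((y ^ 2)⁻¹ : ℝ) • F x y := by
  have hdens : Measurable fun z : ℍ => (1 / NNReal.mk z.im z.im_pos.le) ^ 2 := by
    apply Continuous.measurable
    refine .pow (.div₀ continuous_const ?_ ?_) _
    · exact continuous_im.subtype_mk _
    · exact fun x ↦ NNReal.ne_iff.mp x.im_ne_zero
  have hsm : ∀ z : ℍ, ((1 / NNReal.mk z.im z.im_pos.le) ^ 2 : NNReal) • F z.re z.im =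
      ((z.im ^ 2)⁻¹ : ℝ) • F z.re z.im := by
    intro z
    rw [NNReal.smul_def]
    congr 1
    push_cast
    simp
  set G : ℂ → ℂ := fun z => ((z.im ^ 2)⁻¹ : ℝ) • F z.re z.im with hG
  rw [volume_def] at hF ⊢
  rw [integrable_withDensity_iff_integrable_smul hdens] at hF
  rw [integral_withDensity_eq_integral_smul hdens]
  simp only [hsm] at hF ⊢
  have hmap : ((volume : Measure ℂ).comap UpperHalfPlane.coe).map UpperHalfPlane.coe =
      volume.restrict {z : ℂ | 0 < z.im} := by
    rw [measurableEmbedding_coe.map_comap, range_coe_upperHalfPlane]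
  have e1 : ∫ z : ℍ, ((z.im ^ 2)⁻¹ : ℝ) • F z.re z.im ∂((volume : Measure ℂ).comap
      UpperHalfPlane.coe) = ∫ z in {z : ℂ | 0 < z.im}, G z := by
    rw [← hmap, measurableEmbedding_coe.integral_map]
    rfl
  have i1 : IntegrableOn G {z : ℂ | 0 < z.im} := by
    rw [IntegrableOn, ← hmap, measurableEmbedding_coe.integrable_map_iff]
    exact hF
  have hset : {z : ℂ | 0 < z.im} =
      Complex.measurableEquivRealProd ⁻¹' (Set.univ ×ˢ Set.Ioi (0 : ℝ)) := by
    ext z; simp [Complex.measurableEquivRealProd_apply]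
  set G' : ℝ × ℝ → ℂ := fun p => ((p.2 ^ 2)⁻¹ : ℝ) • F p.1 p.2 with hG'
  have hGG : G = G' ∘ Complex.measurableEquivRealProd := by
    ext z; simp [hG, hG', Complex.measurableEquivRealProd_apply]
  have hmp := Complex.volume_preserving_equiv_real_prod
  rw [e1, hset, hGG]
  rw [hset, hGG, hmp.integrableOn_comp_preimage
    Complex.measurableEquivRealProd.measurableEmbedding] at i1
  have e2 := hmp.setIntegral_preimage_emb Complex.measurableEquivRealProd.measurableEmbedding G'
    (Set.univ ×ˢ Set.Ioi (0 : ℝ))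
  simp only [Function.comp_def]
  rw [e2]
  have hvol : (volume : Measure (ℝ × ℝ)).restrict (Set.univ ×ˢ Set.Ioi (0 : ℝ)) =
      (volume : Measure ℝ).prod (volume.restrict (Set.Ioi 0)) := by
    rw [Measure.volume_eq_prod, ← Measure.prod_restrict, Measure.restrict_univ]
  rw [IntegrableOn, hvol] at i1
  rw [hvol, integral_prod_symm _ i1]

/-! ### The Abel transform and its inversion -/

/-- The Abel transform `u ↦ ∫ F(cosh u + v²/2) dv` of a profile. -/
def abelTransform (F : ℝ → ℝ) (u : ℝ) : ℝ := ∫ v : ℝ, F (Real.cosh u + v ^ 2 / 2)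

lemma dist_I_eq_profile (κ : ℝ → ℝ) (z : ℍ) :
    κ (dist UpperHalfPlane.I z) = profile κ ((z.re ^ 2 + z.im ^ 2 + 1) / (2 * z.im)) := by
  rw [← profile_cosh κ dist_nonneg, UpperHalfPlane.cosh_dist]
  congr 1
  have := z.im_pos
  rw [Complex.dist_eq, ← Complex.normSq_eq_norm_sq, Complex.normSq_apply]
  simp only [UpperHalfPlane.coe_I, Complex.sub_re, Complex.I_re, Complex.sub_im, Complex.I_im,
    UpperHalfPlane.coe_re, UpperHalfPlane.coe_im, UpperHalfPlane.I_im]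
  field_simp
  ring

lemma integral_Ioi_comp_exp (f : ℝ → ℂ) :
    ∫ y in Set.Ioi (0 : ℝ), f y = ∫ u : ℝ, (Real.exp u) • f (Real.exp u) := by
  have h := integral_image_eq_integral_abs_deriv_smul (s := Set.univ) (f := Real.exp)
    (f' := Real.exp) MeasurableSet.univ (fun x _ => (Real.hasDerivAt_exp x).hasDerivWithinAt)
    Real.exp_injective.injOn f
  rw [Set.image_univ, Real.range_exp] at h
  rw [h, setIntegral_univ]
  simp only [abs_of_pos (Real.exp_pos _)]

/-- The Harish-Chandra transform is the Fourier transform of the Abel transform. -/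
lemma hcTransform_eq_fourier {κ : ℝ → ℝ}
    (hκ : Continuous fun z : ℍ => κ (dist UpperHalfPlane.I z)) (h1 : ∀ r, 1 < r → κ r = 0)
    (s : ℝ) :
    hcTransform κ s =
      ∫ u : ℝ, (abelTransform (profile κ) u : ℂ) * Complex.exp (-(Complex.I * s * u)) := by
  set c : ℂ := (1 / 2 : ℂ) - Complex.I * s with hc
  have hint := integrable_radial_mul hκ h1 (continuous_im_cpow c)
  rw [hcTransform_eq hκ h1]
  simp only [dist_I_eq_profile] at hint ⊢
  rw [integral_upperHalfPlane (fun x y => (profile κ ((x ^ 2 + y ^ 2 + 1) / (2 * y)) : ℂ) *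
    ((y : ℝ) : ℂ) ^ c) hint, integral_Ioi_comp_exp]
  congr 1
  ext u
  -- The substitution x = e^(u/2) v turns (x² + e^(2u) + 1)/(2e^u) into cosh u + v²/2.
  have hsub : ∫ x : ℝ, profile κ ((x ^ 2 + Real.exp u ^ 2 + 1) / (2 * Real.exp u)) =
      Real.exp (u / 2) * abelTransform (profile κ) u := by
    have := Measure.integral_comp_mul_left
      (fun x => profile κ ((x ^ 2 + Real.exp u ^ 2 + 1) / (2 * Real.exp u))) (Real.exp (u / 2))
    rw [abs_of_pos (by positivity), smul_eq_mul, eq_comm, inv_mul_eq_iff_eq_mul₀ (by positivity)]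
      at this
    rw [this, abelTransform]
    congr 2
    ext v
    congr 1
    have he : Real.exp u = Real.exp (u / 2) ^ 2 := by rw [← Real.exp_nat_mul]; congr 1; push_cast; ring
    have hpos := Real.exp_pos (u / 2)
    rw [Real.cosh_eq, Real.exp_neg, he]
    field_simp
    ring
  have hpow : ((Real.exp u : ℝ) : ℂ) ^ c = Complex.exp (u / 2) * Complex.exp (-(Complex.I * s * u)) := by
    rw [Complex.cpow_def_of_ne_zero (by exact_mod_cast (Real.exp_pos u).ne'),
      ← Complex.ofReal_log (Real.exp_pos u).le, Real.log_exp, ← Complex.exp_add, hc]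
    congr 1; ring
  rw [integral_smul, integral_mul_const, integral_complex_ofReal, hsub, hpow, smul_smul, Complex.real_smul]
  -- The Jacobian e^u, the density e^(-2u), the scaling factor e^(u/2) and the factor y^(1/2) =
  -- e^(u/2) cancel exactly.
  have he : Complex.exp u * (Complex.exp u ^ 2)⁻¹ * (Complex.exp (u / 2) * Complex.exp (u / 2)) = 1 := by
    rw [← Complex.exp_nat_mul, ← Complex.exp_neg, ← Complex.exp_add, ← Complex.exp_add,
      ← Complex.exp_add]
    convert Complex.exp_zero using 2
    push_cast; ring
  push_cast
  linear_combination (abelTransform (profile κ) u : ℂ) * Complex.exp (-(Complex.I * s * u)) * he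

lemma integrable_const_mul_inv (K : ℝ) : Integrable fun v : ℝ => K * (1 + v ^ 2)⁻¹ :=
  integrable_inv_one_add_sq.const_mul K

/-- Where the left side is nonzero, v² ≤ 2W, so 1 + v² is at most 1 + 2W. The majorant is integrable
in v and independent of x ≥ 0. -/
lemma abs_comp_le_of_vanish {F : ℝ → ℝ} {M W : ℝ} (hM : ∀ w, |F w| ≤ M)
    (hW : ∀ w, W < w → F w = 0) (h1 : 1 ≤ W) {x : ℝ} (hx : 0 ≤ x) (v : ℝ) :
    |F (x + v ^ 2 / 2)| ≤ M * (1 + 2 * W) * (1 + v ^ 2)⁻¹ := by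
  have hM0 : 0 ≤ M := (abs_nonneg _).trans (hM 0)
  have hpos : 0 < 1 + v ^ 2 := by positivity
  by_cases hc : W < x + v ^ 2 / 2
  · rw [hW _ hc, abs_zero]; positivity
  · refine (hM _).trans ?_
    rw [← div_eq_mul_inv, le_div_iff₀ hpos]
    exact mul_le_mul_of_nonneg_left (by linarith) hM0

lemma abelTransform_eq_zero {F : ℝ → ℝ} {W : ℝ} (hW : ∀ w, W < w → F w = 0) {u : ℝ}
    (hu : W < Real.cosh u) : abelTransform F u = 0 := by
  rw [abelTransform]
  convert integral_zero ℝ ℝ with v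
  exact hW _ (by nlinarith [sq_nonneg v])

lemma continuous_abelTransform {F : ℝ → ℝ} {M W : ℝ} (hF : Continuous F) (hM : ∀ w, |F w| ≤ M)
    (hW : ∀ w, W < w → F w = 0) (h1 : 1 ≤ W) : Continuous (abelTransform F) := by
  refine continuous_of_dominated (bound := fun v => M * (1 + 2 * W) * (1 + v ^ 2)⁻¹) ?_ ?_
    (integrable_const_mul_inv _) ?_
  · intro u; exact (hF.comp (by fun_prop)).aestronglyMeasurable
  · intro u
    exact .of_forall fun v => abs_comp_le_of_vanish hM hW h1 (Real.cosh_pos u).le v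
  · exact .of_forall fun v => hF.comp ((Real.continuous_cosh).add continuous_const)

lemma abs_le_of_cosh_le {u W : ℝ} (h : Real.cosh u ≤ W) : |u| ≤ 2 * W := by
  have h2 := Real.add_one_le_exp |u|
  have h3 := Real.exp_pos (-|u|)
  rw [← Real.cosh_abs, Real.cosh_eq] at h
  linarith

lemma hasCompactSupport_abelTransform {F : ℝ → ℝ} {W : ℝ} (hW : ∀ w, W < w → F w = 0) :
    HasCompactSupport (abelTransform F) := by
  refine HasCompactSupport.of_support_subset_isCompact
    (isCompact_closedBall (0 : ℝ) (2 * W)) fun u hu => ?_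
  rw [Metric.mem_closedBall, dist_zero_right, Real.norm_eq_abs]
  refine abs_le_of_cosh_le (not_lt.mp fun hc => hu (abelTransform_eq_zero hW hc))

/-- Fourier inversion for a real function with real Fourier transform. -/
lemma eq_integral_cos_of_fourier {A H : ℝ → ℝ} (hA : Continuous A) (hAc : HasCompactSupport A)
    (hH : Integrable H)
    (hAH : ∀ s : ℝ, ∫ u : ℝ, (A u : ℂ) * Complex.exp (-(Complex.I * s * u)) = (H s : ℂ)) (u : ℝ) :
    A u = (2 * Real.pi)⁻¹ * ∫ s : ℝ, H s * Real.cos (s * u) := by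
  have hpi := Real.two_pi_pos
  have hF : 𝓕 (fun u : ℝ => (A u : ℂ)) = fun w => ((H (2 * Real.pi * w) : ℝ) : ℂ) := by
    ext w
    rw [Real.fourier_eq', ← hAH]
    congr 1; ext v
    rw [smul_eq_mul, mul_comm]
    congr 2
    simp only [RCLike.inner_apply, conj_trivial]
    push_cast; ring
  have hcont : Continuous fun u : ℝ => (A u : ℂ) := Complex.continuous_ofReal.comp hA
  have hint : Integrable fun u : ℝ => (A u : ℂ) := (hA.integrable_of_hasCompactSupport hAc).ofReal
  have hintF : Integrable (𝓕 (fun u : ℝ => (A u : ℂ))) := by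
    rw [hF]
    exact (hH.comp_mul_left' hpi.ne').ofReal
  have key := congrFun (hcont.fourierInv_fourier_eq hint hintF) u
  rw [hF, Real.fourierInv_eq'] at key
  have hsub := Measure.integral_comp_mul_left
    (fun s : ℝ => Complex.exp (Complex.I * (s * u)) * (H s : ℂ)) (2 * Real.pi)
  have hkey : (A u : ℂ) = ((2 * Real.pi)⁻¹ : ℝ) •
      ∫ s : ℝ, Complex.exp (Complex.I * (s * u)) * (H s : ℂ) := by
    rw [← key]
    rw [abs_of_pos (by positivity)] at hsub
    rw [← hsub]
    congr 1; ext w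
    rw [smul_eq_mul]
    congr 2
    simp only [RCLike.inner_apply, conj_trivial]
    push_cast; ring
  have hre := congrArg Complex.re hkey
  rw [Complex.ofReal_re, Complex.smul_re, smul_eq_mul] at hre
  rw [hre]
  congr 1
  have hi : Integrable fun s : ℝ => Complex.exp (Complex.I * (s * u)) * (H s : ℂ) := by
    refine hH.ofReal.bdd_mul (c := 1) (by fun_prop) (.of_forall fun s => ?_)
    rw [mul_comm, ← Complex.ofReal_mul, Complex.norm_exp_ofReal_mul_I]
  have h3 := integral_re hi
  simp only [RCLike.re_eq_complex_re] at h3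
  rw [← h3]
  congr 1; ext s
  rw [mul_comm Complex.I, ← Complex.ofReal_mul, Complex.re_mul_ofReal,
    Complex.exp_ofReal_mul_I_re, mul_comm]

/-- Integrability of functions bounded by a multiple of `(1 + s²)⁻¹`. -/
lemma integrable_of_abs_le_inv {E : Type*} [NormedAddCommGroup E] {f : ℝ → E} {K : ℝ}
    (hf : AEStronglyMeasurable f) (hK : ∀ s, ‖f s‖ ≤ K * (1 + s ^ 2)⁻¹) : Integrable f :=
  (integrable_const_mul_inv K).mono' hf (.of_forall hK)

lemma inv_sq_le_inv (s : ℝ) : ((1 + s ^ 2) ^ 2)⁻¹ ≤ (1 + s ^ 2)⁻¹ := by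
  apply inv_anti₀ (by positivity)
  nlinarith [sq_nonneg s]

lemma sq_mul_inv_sq_le_inv (s : ℝ) : s ^ 2 * ((1 + s ^ 2) ^ 2)⁻¹ ≤ (1 + s ^ 2)⁻¹ := by
  rw [← div_eq_mul_inv, div_le_iff₀ (by positivity)]
  field_simp
  nlinarith [sq_nonneg s]

lemma abs_mul_inv_sq_le_inv (s : ℝ) : |s| * ((1 + s ^ 2) ^ 2)⁻¹ ≤ (1 + s ^ 2)⁻¹ := by
  rw [← div_eq_mul_inv, div_le_iff₀ (by positivity)]
  field_simp
  nlinarith [sq_nonneg (|s| - 1), sq_abs s]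

lemma abs_sin_mul_le (s : ℝ) {u : ℝ} (hu : 0 ≤ u) : |Real.sin (s * u)| ≤ |s| * Real.sinh u := by
  refine Real.abs_sin_le_abs.trans ?_
  rw [abs_mul, abs_of_nonneg hu]
  exact mul_le_mul_of_nonneg_left (Real.self_le_sinh_iff.mpr hu) (abs_nonneg s)

/-- The sine transform. -/
def sineTransform (H : ℝ → ℝ) (u : ℝ) : ℝ := ∫ s : ℝ, H s * (s * Real.sin (s * u))

section

variable {H : ℝ → ℝ} {K : ℝ}

lemma integrable_of_decay (hc : Continuous H) (hK : ∀ s, |H s| ≤ K * ((1 + s ^ 2) ^ 2)⁻¹) :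
    Integrable H := by
  have hK0 : 0 ≤ K := by have := (abs_nonneg _).trans (hK 0); simpa using this
  exact integrable_of_abs_le_inv (K := K) hc.aestronglyMeasurable fun s =>
    (hK s).trans (mul_le_mul_of_nonneg_left (inv_sq_le_inv s) hK0)

lemma abs_mul_self_le (hK : ∀ s, |H s| ≤ K * ((1 + s ^ 2) ^ 2)⁻¹) (s : ℝ) :
    |H s| * |s| ≤ K * (1 + s ^ 2)⁻¹ := by
  have hK0 : 0 ≤ K := by have := (abs_nonneg _).trans (hK 0); simpa using this
  calc |H s| * |s| ≤ K * ((1 + s ^ 2) ^ 2)⁻¹ * |s| :=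
        mul_le_mul_of_nonneg_right (hK s) (abs_nonneg _)
    _ = K * (|s| * ((1 + s ^ 2) ^ 2)⁻¹) := by ring
    _ ≤ _ := mul_le_mul_of_nonneg_left (abs_mul_inv_sq_le_inv s) hK0

lemma abs_mul_sq_le (hK : ∀ s, |H s| ≤ K * ((1 + s ^ 2) ^ 2)⁻¹) (s : ℝ) :
    |H s| * s ^ 2 ≤ K * (1 + s ^ 2)⁻¹ := by
  have hK0 : 0 ≤ K := by have := (abs_nonneg _).trans (hK 0); simpa using this
  calc |H s| * s ^ 2 ≤ K * ((1 + s ^ 2) ^ 2)⁻¹ * s ^ 2 :=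
        mul_le_mul_of_nonneg_right (hK s) (sq_nonneg _)
    _ = K * (s ^ 2 * ((1 + s ^ 2) ^ 2)⁻¹) := by ring
    _ ≤ _ := mul_le_mul_of_nonneg_left (sq_mul_inv_sq_le_inv s) hK0

lemma norm_sine_integrand_le (hK : ∀ s, |H s| ≤ K * ((1 + s ^ 2) ^ 2)⁻¹) (s u : ℝ) :
    ‖H s * (s * Real.sin (s * u))‖ ≤ K * (1 + s ^ 2)⁻¹ := by
  rw [norm_mul, norm_mul, Real.norm_eq_abs, Real.norm_eq_abs, Real.norm_eq_abs]
  refine le_trans ?_ (abs_mul_self_le hK s)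
  refine mul_le_mul_of_nonneg_left ?_ (abs_nonneg _)
  exact mul_le_of_le_one_right (abs_nonneg _) (Real.abs_sin_le_one _)

lemma continuous_sineTransform (hc : Continuous H)
    (hK : ∀ s, |H s| ≤ K * ((1 + s ^ 2) ^ 2)⁻¹) : Continuous (sineTransform H) := by
  refine continuous_of_dominated (bound := fun s => K * (1 + s ^ 2)⁻¹) ?_ ?_
    (integrable_const_mul_inv _) ?_
  · intro u; exact Continuous.aestronglyMeasurable (by fun_prop)
  · intro u; exact .of_forall fun s => norm_sine_integrand_le hK s u
  · exact .of_forall fun s => by fun_prop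

/-- The inequality |sin(su)| ≤ |s| sinh u produces a factor sinh u. With u = arcosh w it cancels the
singularity of 1/√(w²-1) at w = 1 in the inversion formula. -/
lemma abs_sineTransform_le (hK : ∀ s, |H s| ≤ K * ((1 + s ^ 2) ^ 2)⁻¹) {u : ℝ} (hu : 0 ≤ u) :
    |sineTransform H u| ≤ K * Real.pi * Real.sinh u := by
  have : ‖sineTransform H u‖ ≤ ∫ s : ℝ, (K * Real.sinh u) * (1 + s ^ 2)⁻¹ := by
    refine norm_integral_le_of_norm_le (integrable_const_mul_inv _) (.of_forall fun s => ?_)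
    rw [norm_mul, norm_mul, Real.norm_eq_abs, Real.norm_eq_abs, Real.norm_eq_abs]
    calc |H s| * (|s| * |Real.sin (s * u)|) ≤ |H s| * (|s| * (|s| * Real.sinh u)) := by
          gcongr; exact abs_sin_mul_le s hu
      _ = |H s| * s ^ 2 * Real.sinh u := by rw [← sq_abs s]; ring
      _ ≤ K * (1 + s ^ 2)⁻¹ * Real.sinh u :=
          mul_le_mul_of_nonneg_right (abs_mul_sq_le hK s) (Real.sinh_nonneg_iff.mpr hu)
      _ = _ := by ring
  rw [integral_const_mul, integral_univ_inv_one_add_sq] at this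
  rw [Real.norm_eq_abs] at this
  linarith

lemma hasDerivAt_integral_cos (hc : Continuous H)
    (hK : ∀ s, |H s| ≤ K * ((1 + s ^ 2) ^ 2)⁻¹) (u : ℝ) :
    HasDerivAt (fun u => ∫ s : ℝ, H s * Real.cos (s * u)) (-sineTransform H u) u := by
  have := (hasDerivAt_integral_of_dominated_loc_of_deriv_le (μ := volume)
    (F := fun u s => H s * Real.cos (s * u)) (F' := fun u s => -(H s * (s * Real.sin (s * u))))
    (bound := fun s => K * (1 + s ^ 2)⁻¹) (x₀ := u) Filter.univ_mem
    (.of_forall fun v => Continuous.aestronglyMeasurable (by fun_prop)) ?_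
    (Continuous.aestronglyMeasurable (by fun_prop))
    (.of_forall fun s v _ => by rw [norm_neg]; exact norm_sine_integrand_le hK s v)
    (integrable_const_mul_inv _) (.of_forall fun s v _ => ?_)).2
  · rwa [integral_neg] at this
  · refine (integrable_of_decay hc hK).mul_bdd (c := 1)
      (Continuous.aestronglyMeasurable (by fun_prop)) (.of_forall fun s => ?_)
    exact Real.abs_cos_le_one _
  · have h1 : HasDerivAt (fun v => s * v) s v := by simpa using (hasDerivAt_id v).const_mul s
    exact (h1.cos.const_mul (H s)).congr_deriv (by ring)

end

/-- The primitive of `-F` vanishing for large arguments. -/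
lemma hasDerivAt_tail {F : ℝ → ℝ} (hF : Continuous F) (W w : ℝ) :
    HasDerivAt (fun w => ∫ y in w..W, F y) (-F w) w :=
  intervalIntegral.integral_hasDerivAt_left (hF.intervalIntegrable _ _)
    (hF.stronglyMeasurableAtFilter _ _) hF.continuousAt

lemma tail_eq_zero {F : ℝ → ℝ} {W : ℝ} (hW : ∀ w, W < w → F w = 0) {w : ℝ} (hw : W ≤ w) :
    ∫ y in w..W, F y = 0 := by
  rw [intervalIntegral.integral_symm, intervalIntegral.integral_of_le hw,
    setIntegral_congr_fun measurableSet_Ioc (g := fun _ => (0 : ℝ)) (fun y hy => hW y hy.1)]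
  simp

/-- The Abel transform applied twice is integration. -/
lemma double_abel {F : ℝ → ℝ} {M W : ℝ} (hF : Continuous F) (hM : ∀ w, |F w| ≤ M)
    (hW : ∀ w, W < w → F w = 0) (h1 : 1 ≤ W) {w : ℝ} (hw : 0 ≤ w) :
    ∫ v : ℝ, ∫ v' : ℝ, F (w + v ^ 2 / 2 + v' ^ 2 / 2) = 2 * Real.pi * ∫ y in w..W, F y := by
  have hM0 : 0 ≤ M := (abs_nonneg _).trans (hM 0)
  set f : ℝ × ℝ → ℝ := fun p => F (w + p.1 ^ 2 / 2 + p.2 ^ 2 / 2) with hf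
  have hint : Integrable f (volume.prod volume) := by
    have hb : Integrable (fun p : ℝ × ℝ => (M * (1 + 2 * W) ^ 2 * (1 + p.1 ^ 2)⁻¹) *
        (1 * (1 + p.2 ^ 2)⁻¹)) (volume.prod volume) :=
      (integrable_const_mul_inv _).mul_prod (integrable_const_mul_inv _)
    refine hb.mono' (Continuous.aestronglyMeasurable (by fun_prop)) (.of_forall fun p => ?_)
    have hpos : 0 < (1 + p.1 ^ 2) * (1 + p.2 ^ 2) := by positivity
    rw [Real.norm_eq_abs, hf]
    by_cases hc : W < w + p.1 ^ 2 / 2 + p.2 ^ 2 / 2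
    · simp only [hW _ hc, abs_zero]; positivity
    · refine (hM _).trans ?_
      rw [show (M * (1 + 2 * W) ^ 2 * (1 + p.1 ^ 2)⁻¹) * (1 * (1 + p.2 ^ 2)⁻¹) =
        M * (1 + 2 * W) ^ 2 / ((1 + p.1 ^ 2) * (1 + p.2 ^ 2)) by field_simp, le_div_iff₀ hpos]
      refine mul_le_mul_of_nonneg_left ?_ hM0
      push Not at hc
      rw [sq (1 + 2 * W)]
      exact mul_le_mul (by nlinarith [sq_nonneg p.2]) (by nlinarith [sq_nonneg p.1])
        (by positivity) (by linarith)
  -- In polar coordinates the double integral depends on r alone, and r F(w + r²/2) is an exact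
  -- derivative, vanishing for large r.
  have hr : ∫ r in Set.Ioi (0 : ℝ), r * F (w + r ^ 2 / 2) = ∫ y in w..W, F y := by
    have hd : ∀ r : ℝ, HasDerivAt (fun r => -∫ y in (w + r ^ 2 / 2)..W, F y)
        (r * F (w + r ^ 2 / 2)) r := by
      intro r
      have h2 : HasDerivAt (fun r : ℝ => w + r ^ 2 / 2) r r := by
        have := ((hasDerivAt_pow 2 r).div_const 2).const_add w
        exact this.congr_deriv (by simp)
      exact ((hasDerivAt_tail hF W _).comp r h2).neg.congr_deriv (by ring)
    have hvan : ∀ r : ℝ, 2 * W ≤ r → W ≤ w + r ^ 2 / 2 := fun r hr => by nlinarith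
    have hvan' : ∀ r : ℝ, 2 * W < r → r * F (w + r ^ 2 / 2) = 0 := fun r hr => by
      rw [hW _ (by nlinarith), mul_zero]
    rw [integral_Ioi_of_hasDerivAt_of_tendsto (hd 0).continuousAt.continuousWithinAt
      (fun r _ => hd r) ?_ (m := 0) ?_]
    · simp
    · rw [← Set.Ioc_union_Ioi_eq_Ioi (show (0 : ℝ) ≤ 2 * W by linarith)]
      refine IntegrableOn.union ?_ ?_
      · exact (Continuous.integrableOn_Icc (by fun_prop)).mono_set Set.Ioc_subset_Icc_self
      · exact integrableOn_zero.congr_fun (fun r hr => (hvan' r hr).symm) measurableSet_Ioi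
    · refine tendsto_const_nhds.congr' ?_
      filter_upwards [Filter.eventually_ge_atTop (2 * W)] with r hr
      rw [tail_eq_zero hW (hvan r hr), neg_zero]
  have hpol := integral_comp_polarCoord_symm f
  rw [Measure.volume_eq_prod, integral_prod _ hint] at hpol
  rw [← hpol, polarCoord_target]
  have hcongr : ∀ p : ℝ × ℝ, p.1 • f (polarCoord.symm p) =
      (p.1 * F (w + p.1 ^ 2 / 2)) * (fun _ : ℝ => (1 : ℝ)) p.2 := by
    rintro ⟨r, θ⟩
    simp only [hf, polarCoord_symm_apply, smul_eq_mul, mul_one]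
    congr 2
    linear_combination (r ^ 2 / 2) * (Real.sin_sq_add_cos_sq θ)
  simp only [hcongr]
  rw [setIntegral_prod_mul (fun r => r * F (w + r ^ 2 / 2)) (fun _ => (1 : ℝ)), hr]
  simp only [integral_const, MeasurableSet.univ, measureReal_restrict_apply, Set.univ_inter,
    smul_eq_mul, mul_one]
  rw [Real.volume_real_Ioo_of_le (by linarith [Real.pi_pos])]
  ring

lemma sineTransform_eq_Ioi {H : ℝ → ℝ} (heven : ∀ s, H (-s) = H s) (u : ℝ) :
    sineTransform H u = 2 * ∫ s in Set.Ioi (0 : ℝ), H s * (s * Real.sin (s * u)) := by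
  rw [← integral_comp_abs, sineTransform]
  congr 1; ext s
  rcases abs_cases s with ⟨h, -⟩ | ⟨h, -⟩ <;> rw [h]
  rw [heven, neg_mul s u, Real.sin_neg]; ring

lemma one_lt_add_half_sq {w : ℝ} (hw : 1 < w) (v : ℝ) : 1 < w + v ^ 2 / 2 := by
  nlinarith [sq_nonneg v]

/-- For X = w + v²/2 > 1 one has X² - 1 ≥ (X-1)², so the square root is bounded below by w - 1 +
v²/2. -/
lemma inv_sqrt_sq_sub_one_le {w : ℝ} (hw : 1 < w) (v : ℝ) :
    (√((w + v ^ 2 / 2) ^ 2 - 1))⁻¹ ≤ (2 + (w - 1)⁻¹) * (1 + v ^ 2)⁻¹ := by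
  have hw0 : 0 < w - 1 := by linarith
  have h1 : w - 1 + v ^ 2 / 2 ≤ √((w + v ^ 2 / 2) ^ 2 - 1) := by
    apply Real.le_sqrt_of_sq_le
    nlinarith [sq_nonneg v]
  have h2 : 0 < w - 1 + v ^ 2 / 2 := by positivity
  refine (inv_anti₀ h2 h1).trans ?_
  rw [inv_eq_one_div, div_le_iff₀ h2, mul_assoc, inv_mul_eq_div, mul_div_assoc']
  rw [le_div_iff₀ (by positivity)]
  have : (w - 1)⁻¹ * (w - 1) = 1 := inv_mul_cancel₀ hw0.ne'
  have h3 : 0 < (w - 1)⁻¹ := by positivity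
  nlinarith [sq_nonneg v, mul_nonneg h3.le (sq_nonneg v)]

lemma continuous_inv_sqrt {w : ℝ} (hw : 1 < w) :
    Continuous fun v : ℝ => (√((w + v ^ 2 / 2) ^ 2 - 1))⁻¹ := by
  refine Continuous.inv₀ (by fun_prop) fun v => ?_
  have := one_lt_add_half_sq hw v
  exact (Real.sqrt_pos.mpr (by nlinarith)).ne'

lemma continuous_arcosh_add {w : ℝ} (hw : 1 < w) :
    Continuous fun v : ℝ => Real.arcosh (w + v ^ 2 / 2) :=
  Real.continuousOn_arcosh.comp_continuous (by fun_prop)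
    fun v => (one_lt_add_half_sq hw v).le

/-- Inversion of the Abel transform together with the Fourier transform. -/
lemma abel_inversion {F H : ℝ → ℝ} {M W K : ℝ} (hF : Continuous F) (hM : ∀ w, |F w| ≤ M)
    (hW : ∀ w, W < w → F w = 0) (h1 : 1 ≤ W) (hc : Continuous H)
    (hK : ∀ s, |H s| ≤ K * ((1 + s ^ 2) ^ 2)⁻¹)
    (hFH : ∀ s : ℝ, ∫ u : ℝ, (abelTransform F u : ℂ) * Complex.exp (-(Complex.I * s * u)) =
      (H s : ℂ)) {w : ℝ} (hw : 1 < w) :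
    (2 * Real.pi) ^ 2 * F w =
      ∫ v : ℝ, sineTransform H (Real.arcosh (w + v ^ 2 / 2)) * (√((w + v ^ 2 / 2) ^ 2 - 1))⁻¹ := by
  have hpi := Real.two_pi_pos
  have hK0 : 0 ≤ K := by have := (abs_nonneg _).trans (hK 0); simpa using this
  -- `Q` is the Abel transform in the variable x = cosh u. Fourier inversion expresses it as a
  -- cosine integral, which identifies its derivative as `q`.
  set Q : ℝ → ℝ := fun x => ∫ v : ℝ, F (x + v ^ 2 / 2) with hQ
  set q : ℝ → ℝ := fun x => -((2 * Real.pi)⁻¹ * (sineTransform H (Real.arcosh x) *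
    (√(x ^ 2 - 1))⁻¹)) with hq
  have hA := eq_integral_cos_of_fourier (continuous_abelTransform hF hM hW h1)
    (hasCompactSupport_abelTransform hW) (integrable_of_decay hc hK) hFH
  have hQd : ∀ x, 1 < x → HasDerivAt Q (q x) x := by
    intro x hx
    have h2 : HasDerivAt (fun x => (2 * Real.pi)⁻¹ *
        ∫ s : ℝ, H s * Real.cos (s * Real.arcosh x)) (q x) x := by
      have := ((hasDerivAt_integral_cos hc hK (Real.arcosh x)).comp x
        (Real.hasDerivAt_arcosh hx)).const_mul (2 * Real.pi)⁻¹
      exact this.congr_deriv (by rw [hq]; ring)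
    refine h2.congr_of_eventuallyEq ?_
    filter_upwards [lt_mem_nhds hx] with y hy
    rw [← hA, abelTransform, Real.cosh_arcosh hy.le]
  have hqb : ∀ x, 1 < x → |q x| ≤ K := by
    intro x hx
    have h2 := abs_sineTransform_le hK (Real.arcosh_nonneg hx.le)
    rw [Real.sinh_arcosh hx.le] at h2
    have h3 : 0 < √(x ^ 2 - 1) := Real.sqrt_pos.mpr (by nlinarith)
    rw [hq]
    simp only [abs_neg, abs_mul, abs_inv, abs_of_pos h3, abs_of_pos Real.pi_pos, abs_two]
    rw [inv_mul_le_iff₀ hpi, ← div_eq_mul_inv, div_le_iff₀ h3]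
    refine h2.trans ?_
    nlinarith [mul_nonneg (mul_nonneg hK0 Real.pi_pos.le) h3.le]
  have hqz : ∀ x, 1 < x → W < x → q x = 0 := by
    intro x hx hxW
    refine (hQd x hx).unique ?_
    refine (hasDerivAt_const x (0 : ℝ)).congr_of_eventuallyEq ?_
    filter_upwards [lt_mem_nhds hxW] with y hy
    rw [hQ]
    convert integral_zero ℝ ℝ with v
    exact hW _ (by nlinarith [sq_nonneg v])
  have hqb' : ∀ x, 1 < x → ∀ v : ℝ, ‖q (x + v ^ 2 / 2)‖ ≤ K * (1 + 2 * W) * (1 + v ^ 2)⁻¹ := by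
    intro x hx v
    have hx1 := one_lt_add_half_sq hx v
    rw [Real.norm_eq_abs]
    by_cases hcase : W < x + v ^ 2 / 2
    · rw [hqz _ hx1 hcase, abs_zero]; positivity
    · refine (hqb _ hx1).trans ?_
      rw [← div_eq_mul_inv, le_div_iff₀ (by positivity)]
      exact mul_le_mul_of_nonneg_left (by linarith) hK0
  have hQc : ∀ x, 1 < x → Continuous fun v : ℝ => Q (x + v ^ 2 / 2) := by
    intro x hx
    rw [continuous_iff_continuousAt]
    intro v
    exact ((hQd _ (one_lt_add_half_sq hx v)).continuousAt).comp (f := fun v : ℝ => x + v ^ 2 / 2)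
      (by fun_prop)
  have hQb : ∀ x, 1 < x → ∀ v : ℝ, ‖Q (x + v ^ 2 / 2)‖ ≤
      (∫ v : ℝ, M * (1 + 2 * W) * (1 + v ^ 2)⁻¹) * (1 + 2 * W) * (1 + v ^ 2)⁻¹ := by
    intro x hx v
    rw [Real.norm_eq_abs]
    -- Truncation to y ≥ 0 supplies the bound on the whole line required by `abs_comp_le_of_vanish`;
    -- only positive arguments are used.
    have hb : ∀ y, |if 0 ≤ y then Q y else 0| ≤ ∫ v : ℝ, M * (1 + 2 * W) * (1 + v ^ 2)⁻¹ := by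
      intro y
      split_ifs with hy
      · exact norm_integral_le_of_norm_le (f := fun v => F (y + v ^ 2 / 2))
          (integrable_const_mul_inv _)
          (.of_forall fun v => abs_comp_le_of_vanish hM hW h1 hy v)
      · rw [abs_zero]
        refine integral_nonneg fun v => ?_
        have : 0 ≤ M := (abs_nonneg _).trans (hM 0)
        positivity
    have hz : ∀ y, W < y → (if 0 ≤ y then Q y else 0) = 0 := by
      intro y hy
      rw [if_pos (by linarith), hQ]
      convert integral_zero ℝ ℝ with v
      exact hW _ (by nlinarith [sq_nonneg v])
    have := abs_comp_le_of_vanish hb hz h1 (show (0 : ℝ) ≤ x by linarith) v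
    rwa [if_pos (by nlinarith [sq_nonneg v])] at this
  have hcont_q : ∀ x, 1 < x → Continuous fun v : ℝ => q (x + v ^ 2 / 2) := fun x hx =>
    (continuous_const.mul (((continuous_sineTransform hc hK).comp (continuous_arcosh_add hx)).mul
      (continuous_inv_sqrt hx))).neg
  -- The Abel transform of `Q` is differentiated in two ways: under the integral sign, giving the
  -- Abel transform of `q`, and through `double_abel`, giving -2πF. Uniqueness of derivatives is the
  -- inversion formula.
  have hP := (hasDerivAt_integral_of_dominated_loc_of_deriv_le (μ := volume)
    (F := fun x v => Q (x + v ^ 2 / 2)) (F' := fun x v => q (x + v ^ 2 / 2))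
    (bound := fun v => K * (1 + 2 * W) * (1 + v ^ 2)⁻¹) (x₀ := w) (Ioi_mem_nhds hw)
    (by filter_upwards [lt_mem_nhds hw] with x hx using (hQc x hx).aestronglyMeasurable)
    (integrable_of_abs_le_inv (hQc w hw).aestronglyMeasurable (hQb w hw))
    (hcont_q w hw).aestronglyMeasurable
    (.of_forall fun v x hx => hqb' x hx v) (integrable_const_mul_inv _)
    (.of_forall fun v x hx => (hQd _ (one_lt_add_half_sq hx v)).comp_add_const x _)).2
  have hP2 : HasDerivAt (fun x => ∫ v : ℝ, Q (x + v ^ 2 / 2)) (2 * Real.pi * -F w) w := by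
    refine ((hasDerivAt_tail hF W w).const_mul (2 * Real.pi)).congr_of_eventuallyEq ?_
    filter_upwards [lt_mem_nhds hw] with x hx
    exact double_abel hF hM hW h1 (by linarith)
  have hfin := hP.unique hP2
  simp only [hq, integral_neg, integral_const_mul] at hfin
  rw [neg_eq_iff_eq_neg, inv_mul_eq_iff_eq_mul₀ hpi.ne'] at hfin
  rw [hfin]
  ring

/-- The inversion formula with the integral over the spectral parameter outside. -/
lemma abel_inversion_swap {F H : ℝ → ℝ} {M W K : ℝ} (hF : Continuous F) (hM : ∀ w, |F w| ≤ M)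
    (hW : ∀ w, W < w → F w = 0) (h1 : 1 ≤ W) (hc : Continuous H) (heven : ∀ s, H (-s) = H s)
    (hK : ∀ s, |H s| ≤ K * ((1 + s ^ 2) ^ 2)⁻¹)
    (hFH : ∀ s : ℝ, ∫ u : ℝ, (abelTransform F u : ℂ) * Complex.exp (-(Complex.I * s * u)) =
      (H s : ℂ)) {w : ℝ} (hw : 1 < w) :
    2 * Real.pi ^ 2 * F w = ∫ s in Set.Ioi (0 : ℝ), H s * s *
      ∫ v : ℝ, Real.sin (s * Real.arcosh (w + v ^ 2 / 2)) * (√((w + v ^ 2 / 2) ^ 2 - 1))⁻¹ := by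
  have hinv := abel_inversion hF hM hW h1 hc hK hFH hw
  have hint : Integrable (Function.uncurry fun (v s : ℝ) =>
      (H s * (s * Real.sin (s * Real.arcosh (w + v ^ 2 / 2)))) * (√((w + v ^ 2 / 2) ^ 2 - 1))⁻¹)
      (volume.prod (volume.restrict (Set.Ioi 0))) := by
    have hb : Integrable (fun p : ℝ × ℝ => ((2 + (w - 1)⁻¹) * (1 + p.1 ^ 2)⁻¹) *
        (K * (1 + p.2 ^ 2)⁻¹)) (volume.prod (volume.restrict (Set.Ioi 0))) :=
      (integrable_const_mul_inv _).mul_prod (integrable_const_mul_inv _).restrict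
    refine hb.mono' (Continuous.aestronglyMeasurable ?_) (.of_forall fun p => ?_)
    · have h2 := (continuous_arcosh_add hw).comp (continuous_fst (X := ℝ) (Y := ℝ))
      have h3 := (continuous_inv_sqrt hw).comp (continuous_fst (X := ℝ) (Y := ℝ))
      exact ((hc.comp continuous_snd).mul (continuous_snd.mul
        (Real.continuous_sin.comp (continuous_snd.mul h2)))).mul h3
    · rw [Function.uncurry, norm_mul, mul_comm]
      refine mul_le_mul ?_ (norm_sine_integrand_le hK _ _) (norm_nonneg _) ?_
      · rw [Real.norm_eq_abs, abs_of_nonneg (by positivity)]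
        exact inv_sqrt_sq_sub_one_le hw _
      · have : 0 < w - 1 := by linarith
        positivity
  have hswap := integral_integral_swap hint
  have e1 : (2 * Real.pi) ^ 2 * F w = 2 * ∫ v : ℝ, ∫ s in Set.Ioi (0 : ℝ),
      (H s * (s * Real.sin (s * Real.arcosh (w + v ^ 2 / 2)))) *
        (√((w + v ^ 2 / 2) ^ 2 - 1))⁻¹ := by
    rw [hinv, ← integral_const_mul]
    congr 1; ext v
    rw [integral_mul_const, sineTransform_eq_Ioi heven]; ring
  rw [hswap] at e1
  have e2 : 2 * Real.pi ^ 2 * F w = ∫ s in Set.Ioi (0 : ℝ), ∫ v : ℝ,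
      (H s * (s * Real.sin (s * Real.arcosh (w + v ^ 2 / 2)))) *
        (√((w + v ^ 2 / 2) ^ 2 - 1))⁻¹ := by linarith
  rw [e2]
  congr 1; ext s
  rw [← integral_const_mul]
  congr 1; ext v
  ring

/-! ### The product formula in hyperbolic 3-space -/

/-- The Poisson kernel of hyperbolic 3-space at the point `(a, y)`. -/
def poisson3 (a : ℂ) (y : ℝ) (ζ : ℂ) : ℝ := y / (‖ζ - a‖ ^ 2 + y ^ 2)

/-- The product `P₁ ^ (1 + i s) P₂ ^ (1 - i s)`. -/
def prodPow (s p₁ p₂ : ℝ) : ℂ :=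
  ((p₁ * p₂ : ℝ) : ℂ) * Complex.exp (((s * (Real.log p₁ - Real.log p₂) : ℝ) : ℂ) * Complex.I)

lemma norm_prodPow (s : ℝ) {p₁ p₂ : ℝ} (h1 : 0 ≤ p₁) (h2 : 0 ≤ p₂) :
    ‖prodPow s p₁ p₂‖ = p₁ * p₂ := by
  rw [prodPow, norm_mul, Complex.norm_exp_ofReal_mul_I, mul_one, Complex.norm_real,
    Real.norm_of_nonneg (mul_nonneg h1 h2)]

lemma prodPow_mul (s : ℝ) {c p₁ p₂ : ℝ} (hc : 0 < c) (h1 : 0 < p₁) (h2 : 0 < p₂) :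
    prodPow s (c * p₁) (c * p₂) = ((c ^ 2 : ℝ) : ℂ) * prodPow s p₁ p₂ := by
  rw [prodPow, prodPow, Real.log_mul hc.ne' h1.ne', Real.log_mul hc.ne' h2.ne']
  push_cast
  ring_nf

lemma poisson3_pos (a : ℂ) {y : ℝ} (hy : 0 < y) (ζ : ℂ) : 0 < poisson3 a y ζ := by
  rw [poisson3]; positivity

lemma inv_sq_add_sq_le {y : ℝ} (hy : 0 < y) (r : ℝ) :
    (r ^ 2 + y ^ 2)⁻¹ ≤ (1 + (y ^ 2)⁻¹) * (1 + r ^ 2)⁻¹ := by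
  have : (y ^ 2)⁻¹ * y ^ 2 = 1 := inv_mul_cancel₀ (by positivity)
  have h3 : 0 < (y ^ 2)⁻¹ := by positivity
  rw [← div_eq_mul_inv, le_div_iff₀ (by positivity), inv_mul_le_iff₀ (by positivity)]
  nlinarith [sq_nonneg r, sq_nonneg y, mul_nonneg h3.le (sq_nonneg r)]

/-- If L is the difference of the logarithms of the two Poisson kernels, then L' is a constant
multiple of r P₁P₂. Hence the integrand is a multiple of the derivative of e^(isL), and L runs from
-U at r = 0 to U at infinity, where U = log(y₁/y₂). -/
lemma integral_Ioi_prodPow {s y₁ y₂ : ℝ} (hs : 0 < s) (h1 : 0 < y₁) (h2 : 0 < y₂) (hne : y₁ ≠ y₂) :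
    ∫ r in Set.Ioi (0 : ℝ), (r : ℂ) * prodPow s (y₁ / (r ^ 2 + y₁ ^ 2)) (y₂ / (r ^ 2 + y₂ ^ 2)) =
      ((Real.sin (s * Real.log (y₁ / y₂)) / (2 * s * Real.sinh (Real.log (y₁ / y₂))) : ℝ) : ℂ) := by
  set U := Real.log (y₁ / y₂) with hU
  set c : ℝ := y₁ / y₂ - y₂ / y₁ with hc
  have hcU : c = 2 * Real.sinh U := by
    rw [hc, hU, Real.sinh_eq, Real.exp_neg, Real.exp_log (by positivity), inv_div]; ring
  have hc0 : c ≠ 0 := by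
    rw [hc, div_sub_div _ _ h2.ne' h1.ne', div_ne_zero_iff]
    refine ⟨fun h => hne ?_, by positivity⟩
    have : (y₁ - y₂) * (y₁ + y₂) = 0 := by linarith
    rcases mul_eq_zero.mp this with h | h <;> linarith
  set L : ℝ → ℝ := fun r => Real.log (y₁ / (r ^ 2 + y₁ ^ 2)) - Real.log (y₂ / (r ^ 2 + y₂ ^ 2)) with hL
  have hLd : ∀ r, HasDerivAt L
      (2 * c * (r * (y₁ / (r ^ 2 + y₁ ^ 2) * (y₂ / (r ^ 2 + y₂ ^ 2))))) r := by
    intro r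
    have hd : ∀ y : ℝ, 0 < y → HasDerivAt (fun r : ℝ => Real.log (y / (r ^ 2 + y ^ 2)))
        (-(2 * r / (r ^ 2 + y ^ 2))) r := by
      intro y hy
      have e : (fun r : ℝ => Real.log (y / (r ^ 2 + y ^ 2))) =
          fun r => Real.log y - Real.log (r ^ 2 + y ^ 2) := by
        ext r; rw [Real.log_div hy.ne' (by positivity)]
      rw [e]
      have h := ((hasDerivAt_pow 2 r).add_const (y ^ 2)).log (by positivity)
      exact (h.const_sub (Real.log y)).congr_deriv (by simp)
    refine ((hd y₁ h1).sub (hd y₂ h2)).congr_deriv ?_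
    rw [hc]
    have h3 : 0 < r ^ 2 + y₁ ^ 2 := by positivity
    have h4 : 0 < r ^ 2 + y₂ ^ 2 := by positivity
    field_simp
    ring
  have hEd : ∀ r : ℝ, HasDerivAt (fun r => (2 * Complex.I * s * c)⁻¹ *
      Complex.exp (((s * L r : ℝ) : ℂ) * Complex.I))
      ((r : ℂ) * prodPow s (y₁ / (r ^ 2 + y₁ ^ 2)) (y₂ / (r ^ 2 + y₂ ^ 2))) r := by
    intro r
    have h := ((((hLd r).const_mul s).ofReal_comp.mul_const Complex.I).cexp).const_mul
      (2 * Complex.I * s * c)⁻¹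
    refine h.congr_deriv ?_
    rw [prodPow]
    have hsC : (s : ℂ) ≠ 0 := by exact_mod_cast hs.ne'
    have hcC : (c : ℂ) ≠ 0 := by exact_mod_cast hc0
    have hI := Complex.I_ne_zero
    simp only [hL]
    push_cast
    field_simp
  have hcontL : Continuous L := continuous_iff_continuousAt.mpr fun r => (hLd r).continuousAt
  have hcont : Continuous fun r : ℝ =>
      (r : ℂ) * prodPow s (y₁ / (r ^ 2 + y₁ ^ 2)) (y₂ / (r ^ 2 + y₂ ^ 2)) := by
    have h3 : ∀ r : ℝ, r ^ 2 + y₁ ^ 2 ≠ 0 := fun r => by positivity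
    have h4 : ∀ r : ℝ, r ^ 2 + y₂ ^ 2 ≠ 0 := fun r => by positivity
    have h5 : Continuous fun r : ℝ => y₁ / (r ^ 2 + y₁ ^ 2) * (y₂ / (r ^ 2 + y₂ ^ 2)) :=
      (continuous_const.div (by fun_prop) h3).mul (continuous_const.div (by fun_prop) h4)
    simp only [prodPow]
    exact Complex.continuous_ofReal.mul ((Complex.continuous_ofReal.comp h5).mul
      (Complex.continuous_exp.comp ((Complex.continuous_ofReal.comp
        (continuous_const.mul hcontL)).mul continuous_const)))
  have hint : Integrable fun r : ℝ =>
      (r : ℂ) * prodPow s (y₁ / (r ^ 2 + y₁ ^ 2)) (y₂ / (r ^ 2 + y₂ ^ 2)) := by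
    refine integrable_of_abs_le_inv (K := y₂ * (1 + (y₂ ^ 2)⁻¹)) hcont.aestronglyMeasurable
      fun r => ?_
    rw [norm_mul, norm_prodPow _ (by positivity) (by positivity), Complex.norm_real,
      Real.norm_eq_abs]
    have h3 : |r| * (y₁ / (r ^ 2 + y₁ ^ 2)) ≤ 1 := by
      rw [mul_div_assoc', div_le_one (by positivity)]
      nlinarith [sq_nonneg (|r| - y₁), sq_abs r, abs_nonneg r]
    calc |r| * (y₁ / (r ^ 2 + y₁ ^ 2) * (y₂ / (r ^ 2 + y₂ ^ 2)))
        = (|r| * (y₁ / (r ^ 2 + y₁ ^ 2))) * (y₂ * (r ^ 2 + y₂ ^ 2)⁻¹) := by ring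
      _ ≤ 1 * (y₂ * ((1 + (y₂ ^ 2)⁻¹) * (1 + r ^ 2)⁻¹)) := by
          refine mul_le_mul h3 ?_ (by positivity) zero_le_one
          exact mul_le_mul_of_nonneg_left (inv_sq_add_sq_le h2 r) h2.le
      _ = _ := by ring
  have hlim : Filter.Tendsto L Filter.atTop (nhds U) := by
    have e : L = fun r => U + Real.log (1 + (y₂ ^ 2 - y₁ ^ 2) / (r ^ 2 + y₁ ^ 2)) := by
      ext r
      have h3 : 0 < r ^ 2 + y₁ ^ 2 := by positivity
      have h4 : 0 < r ^ 2 + y₂ ^ 2 := by positivity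
      have h5 : 1 + (y₂ ^ 2 - y₁ ^ 2) / (r ^ 2 + y₁ ^ 2) = (r ^ 2 + y₂ ^ 2) / (r ^ 2 + y₁ ^ 2) := by
        field_simp; ring
      rw [h5]
      simp only [hL, hU]
      rw [Real.log_div h1.ne' h3.ne', Real.log_div h2.ne' h4.ne', Real.log_div h1.ne' h2.ne',
        Real.log_div h4.ne' h3.ne']
      ring
    rw [e]
    have h3 : Filter.Tendsto (fun r : ℝ => 1 + (y₂ ^ 2 - y₁ ^ 2) / (r ^ 2 + y₁ ^ 2)) Filter.atTop
        (nhds (1 + 0)) := by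
      refine tendsto_const_nhds.add (Filter.Tendsto.const_div_atTop ?_ _)
      exact Filter.tendsto_atTop_add_const_right _ _ (Filter.tendsto_pow_atTop two_ne_zero)
    have h4 := (Real.continuousAt_log (show (1 + 0 : ℝ) ≠ 0 by norm_num)).tendsto.comp h3
    simpa using h4.const_add U
  have hlimE : Filter.Tendsto (fun r => (2 * Complex.I * s * c)⁻¹ *
      Complex.exp (((s * L r : ℝ) : ℂ) * Complex.I)) Filter.atTop
      (nhds ((2 * Complex.I * s * c)⁻¹ * Complex.exp (((s * U : ℝ) : ℂ) * Complex.I))) := by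
    have hg : Continuous fun x : ℝ => (2 * Complex.I * s * c)⁻¹ *
      Complex.exp (((s * x : ℝ) : ℂ) * Complex.I) := by fun_prop
    exact (hg.tendsto U).comp hlim
  rw [integral_Ioi_of_hasDerivAt_of_tendsto (hEd 0).continuousAt.continuousWithinAt
    (fun r _ => hEd r) hint.integrableOn hlimE]
  have hL0 : L 0 = -U := by
    simp only [hL, hU]
    rw [← Real.log_inv, inv_div, ← Real.log_div (by positivity) (by positivity)]
    congr 1
    field_simp
    ring
  rw [hL0, ← mul_sub]
  have hsin : Complex.exp (((s * U : ℝ) : ℂ) * Complex.I) -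
      Complex.exp (((s * -U : ℝ) : ℂ) * Complex.I) = 2 * Complex.I * (Real.sin (s * U) : ℂ) := by
    rw [Complex.ofReal_sin, Complex.sin, mul_neg, Complex.ofReal_neg]
    linear_combination (Complex.exp (((s * U : ℝ) : ℂ) * Complex.I) -
      Complex.exp (-((s * U : ℝ) : ℂ) * Complex.I)) * Complex.I_sq
  rw [hsin, hcU]
  have hsh : Real.sinh U ≠ 0 := fun h => hc0 (by rw [hcU, h, mul_zero])
  have hsC : (s : ℂ) ≠ 0 := by exact_mod_cast hs.ne'
  have hcC : (Real.sinh U : ℂ) ≠ 0 := by exact_mod_cast hsh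
  have hI := Complex.I_ne_zero
  rw [Complex.ofReal_div]
  push_cast at hcC ⊢
  field_simp

/-- The product formula for the spherical function of hyperbolic 3-space in terms of the hyperbolic
cosine `X` of the distance. -/
def sph3 (s X : ℝ) : ℝ := Real.sin (s * Real.arcosh X) / (s * √(X ^ 2 - 1))

lemma sin_log_div_sinh_log (s Y : ℝ) :
    Real.sin (s * Real.log Y) / (s * Real.sinh (Real.log Y)) =
      sph3 s (Real.cosh (Real.log Y)) := by
  rw [sph3, ← Real.sinh_arcosh (Real.one_le_cosh _)]
  rw [← Real.cosh_abs, Real.arcosh_cosh (abs_nonneg _)]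
  rcases abs_cases (Real.log Y) with ⟨h, -⟩ | ⟨h, -⟩ <;> rw [h]
  rw [Real.sinh_neg, mul_neg s, Real.sin_neg, mul_neg, neg_div_neg_eq]

/-- For two points above the same base point polar coordinates leave a radial integral, and
log(y₁/y₂) is the signed distance between the points. -/
lemma integral_prodPow_vertical {s y₁ y₂ : ℝ} (a : ℂ) (hs : 0 < s) (h1 : 0 < y₁) (h2 : 0 < y₂)
    (hne : y₁ ≠ y₂) :
    ∫ ζ : ℂ, prodPow s (poisson3 a y₁ ζ) (poisson3 a y₂ ζ) =
      ((Real.pi * sph3 s (1 + (y₁ - y₂) ^ 2 / (2 * y₁ * y₂)) : ℝ) : ℂ) := by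
  have e1 : ∫ ζ : ℂ, prodPow s (poisson3 a y₁ ζ) (poisson3 a y₂ ζ) =
      ∫ ζ : ℂ, prodPow s (poisson3 0 y₁ ζ) (poisson3 0 y₂ ζ) := by
    rw [← integral_sub_right_eq_self (fun ζ : ℂ => prodPow s (poisson3 0 y₁ ζ) (poisson3 0 y₂ ζ)) a]
    simp [poisson3]
  rw [e1, ← Complex.integral_comp_polarCoord_symm, polarCoord_target]
  have hcongr : ∀ p : ℝ × ℝ, p.1 • prodPow s (poisson3 0 y₁ (Complex.polarCoord.symm p))
      (poisson3 0 y₂ (Complex.polarCoord.symm p)) =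
      ((p.1 : ℂ) * prodPow s (y₁ / (p.1 ^ 2 + y₁ ^ 2)) (y₂ / (p.1 ^ 2 + y₂ ^ 2))) *
        (fun _ : ℝ => (1 : ℂ)) p.2 := by
    rintro ⟨r, θ⟩
    simp only [poisson3, sub_zero, Complex.norm_polarCoord_symm, sq_abs, Complex.real_smul, mul_one]
  simp only [hcongr]
  rw [Measure.volume_eq_prod, setIntegral_prod_mul (fun r : ℝ => (r : ℂ) *
    prodPow s (y₁ / (r ^ 2 + y₁ ^ 2)) (y₂ / (r ^ 2 + y₂ ^ 2))) (fun _ => (1 : ℂ)),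
    integral_Ioi_prodPow hs h1 h2 hne]
  have e2 : ∫ _ in Set.Ioo (-Real.pi) Real.pi, (1 : ℂ) = ((2 * Real.pi : ℝ) : ℂ) := by
    rw [setIntegral_const, Real.volume_real_Ioo_of_le (by linarith [Real.pi_pos]),
      Complex.real_smul, mul_one]
    congr 1; ring
  rw [e2, ← Complex.ofReal_mul]
  congr 1
  have h3 : Real.cosh (Real.log (y₁ / y₂)) = 1 + (y₁ - y₂) ^ 2 / (2 * y₁ * y₂) := by
    rw [Real.cosh_eq, Real.exp_neg, Real.exp_log (by positivity)]
    field_simp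
    ring
  rw [← h3, ← sin_log_div_sinh_log s]
  rw [mul_assoc 2 s, div_mul_eq_mul_div, mul_comm 2 Real.pi, ← mul_assoc,
    mul_comm _ (2 : ℝ), mul_div_mul_left _ _ two_ne_zero, mul_comm, mul_div_assoc]

lemma abs_det_inv_deriv (ζ : ℂ) :
    |((ContinuousLinearMap.toSpanSingleton ℂ (-(ζ ^ 2)⁻¹)).restrictScalars ℝ).det| =
      (‖ζ‖ ^ 4)⁻¹ := by
  have : ((ContinuousLinearMap.toSpanSingleton ℂ (-(ζ ^ 2)⁻¹)).restrictScalars ℝ).det =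
      ‖-(ζ ^ 2)⁻¹‖ ^ 2 := by
    rw [ContinuousLinearMap.det]
    change LinearMap.det (LinearMap.restrictScalars ℝ
      (ContinuousLinearMap.toSpanSingleton ℂ (-(ζ ^ 2)⁻¹)).toLinearMap) = _
    rw [LinearMap.det_restrictScalars, Algebra.norm_complex_apply, Complex.normSq_eq_norm_sq]
    simp
  rw [this, abs_of_nonneg (by positivity), norm_neg, norm_inv, norm_pow]
  rw [inv_pow, ← pow_mul]

/-- Inversion as a change of variables in the complex plane. -/
lemma integral_comp_inv_complex (f : ℂ → ℂ) :
    ∫ ζ : ℂ, f ζ = ∫ ζ : ℂ, ((‖ζ‖ ^ 4)⁻¹ : ℝ) • f ζ⁻¹ := by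
  have himg : (fun ζ : ℂ => ζ⁻¹) '' {0}ᶜ = {0}ᶜ := by
    ext ζ
    constructor
    · rintro ⟨η, hη, rfl⟩
      exact inv_ne_zero hη
    · intro h
      exact ⟨ζ⁻¹, inv_ne_zero h, inv_inv ζ⟩
  have h := integral_image_eq_integral_abs_det_fderiv_smul (volume : Measure ℂ)
    (s := {0}ᶜ) (f := fun ζ : ℂ => ζ⁻¹)
    (f' := fun ζ => (ContinuousLinearMap.toSpanSingleton ℂ (-(ζ ^ 2)⁻¹)).restrictScalars ℝ)
    (measurableSet_singleton 0).compl
    (fun ζ hζ => ((hasDerivAt_inv hζ).hasFDerivAt.restrictScalars ℝ).hasFDerivWithinAt)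
    inv_injective.injOn f
  rw [himg] at h
  simp only [abs_det_inv_deriv] at h
  rwa [restrict_compl_singleton] at h

/-- Inversion of the boundary extends to an isometry of hyperbolic 3-space; the Poisson kernel
changes by the conformal factor ‖ζ‖² and its point moves by that isometry. -/
lemma poisson3_inv (a : ℂ) {y : ℝ} (hy : 0 < y) {ζ : ℂ} (hζ : ζ ≠ 0) :
    poisson3 a y ζ⁻¹ = ‖ζ‖ ^ 2 * poisson3 (star a * ((‖a‖ ^ 2 + y ^ 2)⁻¹ : ℝ))
      (y / (‖a‖ ^ 2 + y ^ 2)) ζ := by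
  have hz : 0 < ‖ζ‖ := norm_pos_iff.mpr hζ
  set D := ‖a‖ ^ 2 + y ^ 2 with hD
  have hDp : 0 < D := by positivity
  have e1 : ‖ζ⁻¹ - a‖ ^ 2 = ‖1 - a * ζ‖ ^ 2 / ‖ζ‖ ^ 2 := by
    rw [← div_pow, ← norm_div]
    congr 2; field_simp
  have e2 : ‖1 - a * ζ‖ ^ 2 + y ^ 2 * ‖ζ‖ ^ 2 =
      D * (‖ζ - star a * ((D⁻¹ : ℝ) : ℂ)‖ ^ 2 + (y / D) ^ 2) := by
    have h3 : D = a.re * a.re + a.im * a.im + y ^ 2 := by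
      rw [hD, ← Complex.normSq_eq_norm_sq, Complex.normSq_apply]
    have h4 : (y / D) ^ 2 = (D - a.re * a.re - a.im * a.im) / D ^ 2 := by
      rw [div_pow, h3]; ring
    rw [h4, ← Complex.normSq_eq_norm_sq, ← Complex.normSq_eq_norm_sq, ← Complex.normSq_eq_norm_sq,
      show y ^ 2 = D - a.re * a.re - a.im * a.im by rw [h3]; ring]
    simp only [Complex.normSq_apply, Complex.sub_re, Complex.sub_im, Complex.mul_re, Complex.mul_im,
      Complex.star_def, Complex.conj_re, Complex.conj_im, Complex.ofReal_re, Complex.ofReal_im,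
      Complex.one_re, Complex.one_im]
    field_simp
    ring
  rw [poisson3, poisson3, e1]
  have h5 : 0 < ‖ζ - star a * ((D⁻¹ : ℝ) : ℂ)‖ ^ 2 + (y / D) ^ 2 := by positivity
  have h6 : ‖1 - a * ζ‖ ^ 2 / ‖ζ‖ ^ 2 + y ^ 2 =
      D * (‖ζ - star a * ((D⁻¹ : ℝ) : ℂ)‖ ^ 2 + (y / D) ^ 2) / ‖ζ‖ ^ 2 := by
    rw [← e2]; field_simp
  rw [h6, div_div_eq_mul_div, div_div, mul_div_assoc', mul_comm y]

/-- The hypothesis `hcol` says that inversion moves both points over the same base point, which is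
the vertical case. The two conformal factors cancel the Jacobian ‖ζ‖^(-4), and they drop out of the
phase because it depends only on the ratio of the kernels. -/
lemma integral_prodPow_of_collinear {s y₁ y₂ : ℝ} {a₁ a₂ : ℂ} (hs : 0 < s) (h1 : 0 < y₁)
    (h2 : 0 < y₂) (hX : 0 < ‖a₁ - a₂‖ ^ 2 + (y₁ - y₂) ^ 2)
    (hcol : a₁ * ((‖a₁‖ ^ 2 + y₁ ^ 2)⁻¹ : ℝ) = a₂ * ((‖a₂‖ ^ 2 + y₂ ^ 2)⁻¹ : ℝ)) :
    ∫ ζ : ℂ, prodPow s (poisson3 a₁ y₁ ζ) (poisson3 a₂ y₂ ζ) =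
      ((Real.pi * sph3 s (1 + (‖a₁ - a₂‖ ^ 2 + (y₁ - y₂) ^ 2) / (2 * y₁ * y₂)) : ℝ) : ℂ) := by
  set D₁ := ‖a₁‖ ^ 2 + y₁ ^ 2 with hD1
  set D₂ := ‖a₂‖ ^ 2 + y₂ ^ 2 with hD2
  have hp1 : 0 < D₁ := by positivity
  have hp2 : 0 < D₂ := by positivity
  set c : ℂ := star a₁ * ((D₁⁻¹ : ℝ) : ℂ) with hc
  have hc2 : star a₂ * ((D₂⁻¹ : ℝ) : ℂ) = c := by
    have := congrArg star hcol
    simpa [hc] using this.symm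
  -- Inversion preserves cosh of the distance.
  have hid : (y₁ / D₁ - y₂ / D₂) ^ 2 / (2 * (y₁ / D₁) * (y₂ / D₂)) =
      (‖a₁ - a₂‖ ^ 2 + (y₁ - y₂) ^ 2) / (2 * y₁ * y₂) := by
    obtain ⟨b, hb⟩ : ∃ b : ℂ, b = a₁ * ((D₁⁻¹ : ℝ) : ℂ) := ⟨_, rfl⟩
    have hc1 : (D₁ : ℂ) ≠ 0 := by exact_mod_cast hp1.ne'
    have hc2 : (D₂ : ℂ) ≠ 0 := by exact_mod_cast hp2.ne'
    have ha1 : a₁ = b * D₁ := by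
      rw [hb, Complex.ofReal_inv, mul_assoc, inv_mul_cancel₀ hc1, mul_one]
    have ha2 : a₂ = b * D₂ := by
      rw [hb, hcol, Complex.ofReal_inv, mul_assoc, inv_mul_cancel₀ hc2, mul_one]
    have hn1 : ‖a₁‖ ^ 2 = ‖b‖ ^ 2 * D₁ ^ 2 := by
      rw [ha1, norm_mul, Complex.norm_real, mul_pow, Real.norm_eq_abs, sq_abs]
    have hn2 : ‖a₂‖ ^ 2 = ‖b‖ ^ 2 * D₂ ^ 2 := by
      rw [ha2, norm_mul, Complex.norm_real, mul_pow, Real.norm_eq_abs, sq_abs]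
    have hn3 : ‖a₁ - a₂‖ ^ 2 = ‖b‖ ^ 2 * (D₁ - D₂) ^ 2 := by
      rw [ha1, ha2, ← mul_sub, ← Complex.ofReal_sub, norm_mul, Complex.norm_real, mul_pow,
        Real.norm_eq_abs, sq_abs]
    rw [hn1] at hD1
    rw [hn2] at hD2
    rw [hn3]
    field_simp
    linear_combination (D₂ * D₁ - D₂ ^ 2) * hD1 + (D₁ * D₂ - D₁ ^ 2) * hD2
  have hne : y₁ / D₁ ≠ y₂ / D₂ := by
    intro h
    rw [h, sub_self, zero_pow two_ne_zero, zero_div] at hid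
    have : 0 < (‖a₁ - a₂‖ ^ 2 + (y₁ - y₂) ^ 2) / (2 * y₁ * y₂) := by positivity
    linarith
  rw [integral_comp_inv_complex, ← hid,
    ← integral_prodPow_vertical c hs (by positivity) (by positivity) hne]
  refine integral_congr_ae ?_
  have h0 : ∀ᵐ ζ : ℂ, ζ ≠ 0 := by
    rw [ae_iff]; simp
  filter_upwards [h0] with ζ hζ
  have hz : 0 < ‖ζ‖ := norm_pos_iff.mpr hζ
  rw [poisson3_inv a₁ h1 hζ, poisson3_inv a₂ h2 hζ, ← hD1, ← hD2, hc2, ← hc,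
    prodPow_mul s (by positivity) (poisson3_pos _ (by positivity) _)
      (poisson3_pos _ (by positivity) _), Complex.real_smul, ← mul_assoc, ← Complex.ofReal_mul,
    show (‖ζ‖ ^ 4)⁻¹ * (‖ζ‖ ^ 2) ^ 2 = 1 by field_simp, Complex.ofReal_one, one_mul]

/-- The product formula in hyperbolic 3-space. -/
lemma integral_prodPow {s y₁ y₂ : ℝ} {a₁ a₂ : ℂ} (hs : 0 < s) (h1 : 0 < y₁)
    (h2 : 0 < y₂) (hX : 0 < ‖a₁ - a₂‖ ^ 2 + (y₁ - y₂) ^ 2) :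
    ∫ ζ : ℂ, prodPow s (poisson3 a₁ y₁ ζ) (poisson3 a₂ y₂ ζ) =
      ((Real.pi * sph3 s (1 + (‖a₁ - a₂‖ ^ 2 + (y₁ - y₂) ^ 2) / (2 * y₁ * y₂)) : ℝ) : ℂ) := by
  by_cases ha : a₁ = a₂
  · subst ha
    simp only [sub_self, norm_zero, zero_pow two_ne_zero, zero_add] at hX ⊢
    exact integral_prodPow_vertical a₁ hs h1 h2 (fun h => by simp [h] at hX)
  have hL : 0 < ‖a₁ - a₂‖ ^ 2 := by
    have := norm_pos_iff.mpr (sub_ne_zero.mpr ha); positivity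
  set Λ := ‖a₁ - a₂‖ ^ 2 with hΛ
  -- The root k makes e = a₁ + k(a₂ - a₁) an endpoint of the geodesic through the two points; after
  -- translating e to 0 the collinear case applies. Real roots exist because the leading coefficient
  -- is positive and the constant term negative.
  obtain ⟨k, hk⟩ : ∃ k : ℝ, Λ * (k * k) + (-(Λ + y₂ ^ 2 - y₁ ^ 2)) * k + (-y₁ ^ 2) = 0 := by
    refine exists_quadratic_eq_zero hL.ne' ⟨√(discrim Λ (-(Λ + y₂ ^ 2 - y₁ ^ 2)) (-y₁ ^ 2)), ?_⟩
    rw [Real.mul_self_sqrt]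
    rw [discrim]; nlinarith [sq_nonneg (-(Λ + y₂ ^ 2 - y₁ ^ 2)), mul_pos hL (pow_pos h1 2)]
  set e : ℂ := a₁ + k * (a₂ - a₁) with he
  have hs1 : a₁ - e = k * (a₁ - a₂) := by rw [he]; ring
  have hs2 : a₂ - e = ((k - 1 : ℝ) : ℂ) * (a₁ - a₂) := by rw [he]; push_cast; ring
  have hn1 : ‖a₁ - e‖ ^ 2 = k ^ 2 * Λ := by
    rw [hs1, norm_mul, Complex.norm_real, mul_pow, Real.norm_eq_abs, sq_abs]
  have hn2 : ‖a₂ - e‖ ^ 2 = (k - 1) ^ 2 * Λ := by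
    rw [hs2, norm_mul, Complex.norm_real, mul_pow, Real.norm_eq_abs, sq_abs]
  have hp1 : 0 < k ^ 2 * Λ + y₁ ^ 2 := by positivity
  have hp2 : 0 < (k - 1) ^ 2 * Λ + y₂ ^ 2 := by positivity
  have hsub : a₁ - a₂ = (a₁ - e) - (a₂ - e) := by ring
  have hshift : ∫ ζ : ℂ, prodPow s (poisson3 a₁ y₁ ζ) (poisson3 a₂ y₂ ζ) =
      ∫ ζ : ℂ, prodPow s (poisson3 (a₁ - e) y₁ ζ) (poisson3 (a₂ - e) y₂ ζ) := by
    rw [← integral_add_right_eq_self (fun ζ : ℂ => prodPow s (poisson3 a₁ y₁ ζ)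
      (poisson3 a₂ y₂ ζ)) e]
    congr 1; ext ζ
    simp only [poisson3]
    rw [show ζ + e - a₁ = ζ - (a₁ - e) by ring, show ζ + e - a₂ = ζ - (a₂ - e) by ring]
  have hkey := integral_prodPow_of_collinear (a₁ := a₁ - e) (a₂ := a₂ - e) hs h1 h2
    (by rw [← hsub]; exact hX) (by
      rw [hn1, hn2, hs1, hs2, mul_right_comm, mul_right_comm (((k - 1 : ℝ) : ℂ))]
      rw [← Complex.ofReal_mul, ← Complex.ofReal_mul]
      congr 2
      rw [← div_eq_mul_inv, ← div_eq_mul_inv, div_eq_div_iff hp1.ne' hp2.ne']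
      linear_combination -hk)
  rw [← hsub] at hkey
  rw [hshift, hkey]

/-! ### Descent to the hyperbolic plane and the spectral expansion -/

/-- The power `p ^ (1 + i s)`. -/
def onePow (s p : ℝ) : ℂ := (p : ℂ) * Complex.exp (((s * Real.log p : ℝ) : ℂ) * Complex.I)

/-- The power `p ^ (1/2 + i s)`. -/
def halfPow (s p : ℝ) : ℂ := (√p : ℂ) * Complex.exp (((s * Real.log p : ℝ) : ℂ) * Complex.I)

/-- The integral `∫ (1 + r²) ^ (-1 - i s) dr`. -/
def bFactor (s : ℝ) : ℂ := ∫ r : ℝ, onePow s ((1 + r ^ 2)⁻¹)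

lemma prodPow_eq (s p q : ℝ) : prodPow s p q = onePow s p * onePow (-s) q := by
  rw [prodPow, onePow, onePow, mul_mul_mul_comm, ← Complex.exp_add]
  push_cast
  ring_nf

lemma norm_onePow (s : ℝ) {p : ℝ} (hp : 0 ≤ p) : ‖onePow s p‖ = p := by
  rw [onePow, norm_mul, Complex.norm_exp_ofReal_mul_I, mul_one, Complex.norm_real,
    Real.norm_of_nonneg hp]

lemma norm_halfPow (s p : ℝ) : ‖halfPow s p‖ = √p := by
  rw [halfPow, norm_mul, Complex.norm_exp_ofReal_mul_I, mul_one, Complex.norm_real,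
    Real.norm_of_nonneg (Real.sqrt_nonneg p)]

lemma onePow_mul (s : ℝ) {p q : ℝ} (hp : 0 < p) (hq : 0 < q) :
    onePow s (p * q) = onePow s p * onePow s q := by
  rw [onePow, onePow, onePow, mul_mul_mul_comm, ← Complex.exp_add, Real.log_mul hp.ne' hq.ne']
  push_cast
  ring_nf

lemma continuous_onePow_comp {X : Type*} [TopologicalSpace X] (s : ℝ) {p : X → ℝ}
    (hp : Continuous p) (hpos : ∀ x, 0 < p x) : Continuous fun x => onePow s (p x) := by
  have h : Continuous fun x => Real.log (p x) := hp.log fun x => (hpos x).ne'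
  unfold onePow
  fun_prop

lemma integrable_onePow_inv (s : ℝ) : Integrable fun r : ℝ => onePow s ((1 + r ^ 2)⁻¹) := by
  refine integrable_of_abs_le_inv (K := 1)
    (continuous_onePow_comp s (p := fun r : ℝ => (1 + r ^ 2)⁻¹)
      (Continuous.inv₀ (by fun_prop) fun r => by positivity)
      fun r => by positivity).aestronglyMeasurable fun r => ?_
  rw [norm_onePow _ (by positivity), one_mul]

lemma norm_bFactor_le (s : ℝ) : ‖bFactor s‖ ≤ Real.pi := by
  rw [bFactor, ← integral_univ_inv_one_add_sq]
  refine norm_integral_le_of_norm_le integrable_inv_one_add_sq (.of_forall fun r => ?_)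
  rw [norm_onePow _ (by positivity)]

lemma onePow_div_scale (s : ℝ) {y R : ℝ} (hy : 0 < y) (hR : 0 < R) (r : ℝ) :
    onePow s (y / (R + r ^ 2)) = onePow s (y / R) * onePow s ((1 + ((√R)⁻¹ * r) ^ 2)⁻¹) := by
  rw [← onePow_mul s (by positivity) (by positivity), mul_pow, inv_pow, Real.sq_sqrt hR.le]
  congr 1
  field_simp

lemma integrable_onePow (s : ℝ) {y R : ℝ} (hy : 0 < y) (hR : 0 < R) :
    Integrable fun r : ℝ => onePow s (y / (R + r ^ 2)) := by
  simp only [onePow_div_scale s hy hR]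
  exact ((integrable_onePow_inv s).comp_mul_left' (by positivity)).const_mul _

lemma integral_onePow (s : ℝ) {y R : ℝ} (hy : 0 < y) (hR : 0 < R) :
    ∫ r : ℝ, onePow s (y / (R + r ^ 2)) = (√y : ℂ) * halfPow s (y / R) * bFactor s := by
  simp only [onePow_div_scale s hy hR]
  rw [integral_const_mul, Measure.integral_comp_mul_left (fun r => onePow s ((1 + r ^ 2)⁻¹)),
    ← bFactor, inv_inv, abs_of_nonneg (Real.sqrt_nonneg R), onePow, halfPow, Complex.real_smul]
  have h : y / R * √R = √y * √(y / R) := by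
    rw [Real.sqrt_div hy.le, mul_div_assoc', Real.mul_self_sqrt hy.le, div_mul_eq_mul_div,
      div_eq_div_iff hR.ne' (by positivity), mul_assoc, Real.mul_self_sqrt hR.le]
  have hC : ((y / R : ℝ) : ℂ) * (√R : ℂ) = (√y : ℂ) * (√(y / R) : ℂ) := by exact_mod_cast h
  linear_combination (Complex.exp (((s * Real.log (y / R) : ℝ) : ℂ) * Complex.I) * bFactor s) * hC

/-- The modulus is the integrand at s = 0, and `bFactor 0` equals π. -/
lemma integral_norm_onePow (s : ℝ) {y R : ℝ} (hy : 0 < y) (hR : 0 < R) :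
    ∫ r : ℝ, ‖onePow s (y / (R + r ^ 2))‖ = √y * √(y / R) * Real.pi := by
  have h := integral_onePow 0 hy hR
  have h2 : ∀ r : ℝ, onePow 0 (y / (R + r ^ 2)) = ((‖onePow s (y / (R + r ^ 2))‖ : ℝ) : ℂ) := by
    intro r
    rw [norm_onePow s (by positivity), onePow]; simp
  have h3 : bFactor 0 = (Real.pi : ℂ) := by
    rw [bFactor, ← integral_univ_inv_one_add_sq, ← integral_complex_ofReal]
    congr 1; ext r; simp [onePow]
  simp only [h2] at h
  rw [integral_complex_ofReal, h3, halfPow] at h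
  simp only [zero_mul, Complex.ofReal_zero, Complex.exp_zero, mul_one] at h
  exact_mod_cast h

/-- The Poisson kernel of the hyperbolic plane at `z`. -/
def poisson (z : ℍ) (ξ : ℝ) : ℝ := z.im / ((ξ - z.re) ^ 2 + z.im ^ 2)

lemma poisson_denom_pos (z : ℍ) (ξ : ℝ) : 0 < (ξ - z.re) ^ 2 + z.im ^ 2 := by
  have := z.im_pos; positivity

lemma poisson_pos (z : ℍ) (ξ : ℝ) : 0 < poisson z ξ :=
  div_pos z.im_pos (poisson_denom_pos z ξ)

lemma continuous_poisson (z : ℍ) : Continuous (poisson z) :=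
  continuous_const.div (by fun_prop) fun ξ => (poisson_denom_pos z ξ).ne'

lemma integrable_poisson (z : ℍ) : Integrable (poisson z) := by
  have h : Integrable fun r : ℝ => z.im / (z.im ^ 2 + r ^ 2) := by
    refine (integrable_onePow 0 z.im_pos (pow_pos z.im_pos 2)).norm.congr (.of_forall fun r => ?_)
    exact norm_onePow 0 (div_nonneg z.im_pos.le (by positivity))
  refine (h.comp_sub_right z.re).congr (.of_forall fun ξ => ?_)
  simp only [poisson]
  rw [add_comm]

/-- The integrand in the coordinates `(ξ, (r, η))`. -/
lemma integrable_triple (s : ℝ) (z₁ z₂ : ℍ) :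
    Integrable (fun p : ℝ × ℝ × ℝ =>
      onePow s (z₁.im / ((p.1 - z₁.re) ^ 2 + z₁.im ^ 2 + p.2.1 ^ 2)) *
      onePow (-s) (z₂.im / ((p.1 - z₂.re) ^ 2 + z₂.im ^ 2 + (p.2.2 - p.2.1) ^ 2)))
      (volume.prod (volume.prod volume)) := by
  have y1 := z₁.im_pos
  have y2 := z₂.im_pos
  have hd1 : ∀ p : ℝ × ℝ × ℝ, 0 < (p.1 - z₁.re) ^ 2 + z₁.im ^ 2 + p.2.1 ^ 2 :=
    fun p => by positivity
  have hd2 : ∀ p : ℝ × ℝ × ℝ, 0 < (p.1 - z₂.re) ^ 2 + z₂.im ^ 2 + (p.2.2 - p.2.1) ^ 2 :=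
    fun p => by positivity
  have hcont : Continuous (fun p : ℝ × ℝ × ℝ =>
      onePow s (z₁.im / ((p.1 - z₁.re) ^ 2 + z₁.im ^ 2 + p.2.1 ^ 2)) *
      onePow (-s) (z₂.im / ((p.1 - z₂.re) ^ 2 + z₂.im ^ 2 + (p.2.2 - p.2.1) ^ 2))) :=
    (continuous_onePow_comp s (continuous_const.div (by fun_prop) fun p => (hd1 p).ne')
      fun p => div_pos y1 (hd1 p)).mul
    (continuous_onePow_comp (-s) (continuous_const.div (by fun_prop) fun p => (hd2 p).ne')
      fun p => div_pos y2 (hd2 p))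
  -- For fixed ξ the function of (r, η) is the integrand of a convolution of two integrable
  -- functions.
  have hconv : ∀ ξ : ℝ, Integrable (fun q : ℝ × ℝ =>
      onePow s (z₁.im / ((ξ - z₁.re) ^ 2 + z₁.im ^ 2 + q.1 ^ 2)) *
      onePow (-s) (z₂.im / ((ξ - z₂.re) ^ 2 + z₂.im ^ 2 + (q.2 - q.1) ^ 2)))
      (volume.prod volume) := fun ξ =>
    ((integrable_onePow s y1 (poisson_denom_pos z₁ ξ)).convolution_integrand
      (ContinuousLinearMap.mul ℝ ℂ) (integrable_onePow (-s) y2 (poisson_denom_pos z₂ ξ))).swap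
  rw [integrable_prod_iff hcont.aestronglyMeasurable]
  refine ⟨.of_forall hconv, ?_⟩
  have hval : ∀ ξ : ℝ, ∫ q : ℝ × ℝ,
      ‖onePow s (z₁.im / ((ξ - z₁.re) ^ 2 + z₁.im ^ 2 + q.1 ^ 2)) *
      onePow (-s) (z₂.im / ((ξ - z₂.re) ^ 2 + z₂.im ^ 2 + (q.2 - q.1) ^ 2))‖
      ∂(volume.prod volume) =
      (√z₁.im * √z₂.im * Real.pi ^ 2) * (√(poisson z₁ ξ) * √(poisson z₂ ξ)) := by
    intro ξ
    rw [integral_prod _ (hconv ξ).norm]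
    simp only [norm_mul, integral_const_mul]
    have hin : ∀ r : ℝ, ∫ η : ℝ,
        ‖onePow (-s) (z₂.im / ((ξ - z₂.re) ^ 2 + z₂.im ^ 2 + (η - r) ^ 2))‖ =
        √z₂.im * √(poisson z₂ ξ) * Real.pi := by
      intro r
      rw [integral_sub_right_eq_self (fun η =>
        ‖onePow (-s) (z₂.im / ((ξ - z₂.re) ^ 2 + z₂.im ^ 2 + η ^ 2))‖) r,
        integral_norm_onePow _ y2 (poisson_denom_pos z₂ ξ), poisson]
    simp only [hin]
    rw [integral_mul_const, integral_norm_onePow _ y1 (poisson_denom_pos z₁ ξ)]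
    simp only [poisson]
    ring
  refine Integrable.congr ?_ (.of_forall fun ξ => (hval ξ).symm)
  refine Integrable.const_mul ?_ _
  -- After the inner integration √P₁ √P₂ remains, which is at most P₁ + P₂.
  refine ((integrable_poisson z₁).add (integrable_poisson z₂)).mono'
    ((continuous_poisson z₁).sqrt.mul (continuous_poisson z₂).sqrt).aestronglyMeasurable
    (.of_forall fun ξ => ?_)
  rw [Real.norm_of_nonneg (by positivity), Pi.add_apply]
  nlinarith [sq_nonneg (√(poisson z₁ ξ) - √(poisson z₂ ξ)), Real.sq_sqrt (poisson_pos z₁ ξ).le,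
    Real.sq_sqrt (poisson_pos z₂ ξ).le, Real.sqrt_nonneg (poisson z₁ ξ),
    Real.sqrt_nonneg (poisson z₂ ξ)]

/-- Write ζ = ξ + ir and move the second point by η in the imaginary direction. Integrating over η
first decouples the two powers, and each remaining fibre integral turns P^(1+is) on the complex
boundary into P^(1/2+is) on the real line times a `bFactor`. -/
lemma integral_triple (s : ℝ) (z₁ z₂ : ℍ) :
    ∫ η : ℝ, ∫ ζ : ℂ, prodPow s (poisson3 z₁.re z₁.im ζ)
        (poisson3 (z₂.re + η * Complex.I) z₂.im ζ) =
      (√z₁.im : ℂ) * (√z₂.im : ℂ) * (bFactor s * bFactor (-s)) *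
        ∫ ξ : ℝ, halfPow s (poisson z₁ ξ) * halfPow (-s) (poisson z₂ ξ) := by
  have y1 := z₁.im_pos
  have y2 := z₂.im_pos
  set Φ : ℝ × ℝ × ℝ → ℂ := fun p =>
      onePow s (z₁.im / ((p.1 - z₁.re) ^ 2 + z₁.im ^ 2 + p.2.1 ^ 2)) *
      onePow (-s) (z₂.im / ((p.1 - z₂.re) ^ 2 + z₂.im ^ 2 + (p.2.2 - p.2.1) ^ 2)) with hΦ
  have hint : Integrable Φ (volume.prod (volume.prod volume)) := integrable_triple s z₁ z₂
  have hζ : ∀ η : ℝ, ∫ ζ : ℂ, prodPow s (poisson3 z₁.re z₁.im ζ)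
        (poisson3 (z₂.re + η * Complex.I) z₂.im ζ) =
      ∫ q : ℝ × ℝ, Φ (q.1, q.2, η) ∂(volume.prod volume) := by
    intro η
    rw [← Measure.volume_eq_prod, ← Complex.volume_preserving_equiv_real_prod.integral_comp
      Complex.measurableEquivRealProd.measurableEmbedding]
    congr 1; ext ζ
    rw [prodPow_eq, poisson3, poisson3, hΦ]
    simp only [Complex.measurableEquivRealProd_apply]
    rw [← Complex.normSq_eq_norm_sq, ← Complex.normSq_eq_norm_sq, Complex.normSq_apply,
      Complex.normSq_apply]
    simp only [Complex.sub_re, Complex.sub_im, Complex.ofReal_re, Complex.ofReal_im,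
      Complex.add_re, Complex.add_im, Complex.mul_re, Complex.mul_im, Complex.I_re, Complex.I_im]
    congr 2 <;> ring
  have hassoc := measurePreserving_prodAssoc (volume : Measure ℝ) (volume : Measure ℝ)
    (volume : Measure ℝ)
  have hint2 : Integrable (fun p : (ℝ × ℝ) × ℝ => Φ (p.1.1, p.1.2, p.2))
      ((volume.prod volume).prod volume) :=
    hassoc.integrable_comp_of_integrable hint
  have e1 : ∫ p : (ℝ × ℝ) × ℝ, Φ (p.1.1, p.1.2, p.2) ∂((volume.prod volume).prod volume) =
      ∫ p, Φ p ∂(volume.prod (volume.prod volume)) :=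
    hassoc.integral_comp MeasurableEquiv.prodAssoc.measurableEmbedding Φ
  rw [integral_prod_symm _ hint2, integral_prod _ hint] at e1
  simp only [hζ]
  rw [e1, ← integral_const_mul]
  refine integral_congr_ae ?_
  filter_upwards [hint.prod_right_ae] with ξ hξ
  rw [integral_prod _ hξ]
  simp only [hΦ, integral_const_mul]
  have hin : ∀ r : ℝ, ∫ η : ℝ,
      onePow (-s) (z₂.im / ((ξ - z₂.re) ^ 2 + z₂.im ^ 2 + (η - r) ^ 2)) =
      (√z₂.im : ℂ) * halfPow (-s) (poisson z₂ ξ) * bFactor (-s) := by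
    intro r
    rw [integral_sub_right_eq_self (fun η =>
      onePow (-s) (z₂.im / ((ξ - z₂.re) ^ 2 + z₂.im ^ 2 + η ^ 2))) r,
      integral_onePow _ y2 (poisson_denom_pos z₂ ξ), poisson]
  simp only [hin]
  rw [integral_mul_const, integral_onePow _ y1 (poisson_denom_pos z₁ ξ), ← poisson]
  ring

lemma exists_bound_profile {κ : ℝ → ℝ}
    (hκ : Continuous fun z : ℍ => κ (dist UpperHalfPlane.I z)) (h1 : ∀ r, 1 < r → κ r = 0) :
    ∃ M, ∀ w, |profile κ w| ≤ M := by
  obtain ⟨M, hM⟩ := (isCompact_Icc (a := (1 : ℝ)) (b := Real.cosh 1)).exists_bound_of_continuousOn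
    (continuous_profile hκ).continuousOn
  have hM1 := hM 1 ⟨le_refl 1, Real.one_le_cosh 1⟩
  refine ⟨M, fun w => ?_⟩
  rcases le_or_gt w 1 with h | h
  · have : profile κ w = profile κ 1 := by simp [profile, max_eq_right h]
    rw [this]; exact hM1
  · rcases le_or_gt w (Real.cosh 1) with h' | h'
    · exact hM w ⟨h.le, h'⟩
    · rw [profile_eq_zero h1 h', abs_zero]
      exact (norm_nonneg _).trans hM1

/-- The pairing of two points with the boundary, with spectral parameter `s`. -/
def boundaryPairing (s : ℝ) (z₁ z₂ : ℍ) : ℂ :=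
  ∫ ξ : ℝ, halfPow s (poisson z₁ ξ) * halfPow (-s) (poisson z₂ ξ)

/-- Displacing z₂ by η in the third dimension changes cosh of the distance by η²/(2 y₁ y₂). With v =
η/√(y₁y₂), the η-integral of the product formula is exactly the v-integral in the inverse Abel
transform. -/
lemma integral_sph3 {s : ℝ} (hs : 0 < s) {z₁ z₂ : ℍ} (hne : z₁ ≠ z₂) :
    ((Real.pi * ∫ v : ℝ, sph3 s (Real.cosh (dist z₁ z₂) + v ^ 2 / 2) : ℝ) : ℂ) =
      bFactor s * bFactor (-s) * boundaryPairing s z₁ z₂ := by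
  have y1 := z₁.im_pos
  have y2 := z₂.im_pos
  have hd : 0 < (z₁.re - z₂.re) ^ 2 + (z₁.im - z₂.im) ^ 2 := by
    by_contra hcon
    have ha : (z₁.re - z₂.re) ^ 2 = 0 := by nlinarith [sq_nonneg (z₁.re - z₂.re), sq_nonneg (z₁.im - z₂.im)]
    have hb : (z₁.im - z₂.im) ^ 2 = 0 := by nlinarith [sq_nonneg (z₁.re - z₂.re), sq_nonneg (z₁.im - z₂.im)]
    refine hne (UpperHalfPlane.ext (Complex.ext ?_ ?_))
    · exact sub_eq_zero.mp (pow_eq_zero_iff two_ne_zero |>.mp ha)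
    · exact sub_eq_zero.mp (pow_eq_zero_iff two_ne_zero |>.mp hb)
  have hnorm : ∀ η : ℝ, ‖(z₁.re : ℂ) - (z₂.re + η * Complex.I)‖ ^ 2 =
      (z₁.re - z₂.re) ^ 2 + η ^ 2 := by
    intro η
    rw [← Complex.normSq_eq_norm_sq, Complex.normSq_apply]
    simp
    ring
  have htriple := integral_triple s z₁ z₂
  have hprod : ∀ η : ℝ, ∫ ζ : ℂ, prodPow s (poisson3 z₁.re z₁.im ζ)
        (poisson3 (z₂.re + η * Complex.I) z₂.im ζ) = ((Real.pi * sph3 s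
          (Real.cosh (dist z₁ z₂) + ((√(z₁.im * z₂.im))⁻¹ * η) ^ 2 / 2) : ℝ) : ℂ) := by
    intro η
    rw [integral_prodPow hs y1 y2 (by rw [hnorm]; nlinarith [sq_nonneg η]), hnorm]
    congr 3
    rw [mul_pow, inv_pow, Real.sq_sqrt (by positivity), UpperHalfPlane.cosh_dist,
      Complex.dist_eq, ← Complex.normSq_eq_norm_sq, Complex.normSq_apply]
    simp only [Complex.sub_re, Complex.sub_im, UpperHalfPlane.coe_re, UpperHalfPlane.coe_im]
    field_simp
    ring
  simp only [hprod] at htriple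
  rw [integral_complex_ofReal, integral_const_mul, Measure.integral_comp_mul_left (fun v =>
    sph3 s (Real.cosh (dist z₁ z₂) + v ^ 2 / 2)), inv_inv, abs_of_nonneg (Real.sqrt_nonneg _),
    smul_eq_mul, Real.sqrt_mul y1.le] at htriple
  have hne1 : (√z₁.im : ℂ) ≠ 0 := by exact_mod_cast (Real.sqrt_pos.mpr y1).ne'
  have hne2 : (√z₂.im : ℂ) ≠ 0 := by exact_mod_cast (Real.sqrt_pos.mpr y2).ne'
  rw [boundaryPairing]
  apply mul_left_cancel₀ (mul_ne_zero hne1 hne2)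
  push_cast at htriple ⊢
  linear_combination htriple

/-- The spectral expansion of a rotation invariant kernel. -/
lemma kernel_formula {κ H : ℝ → ℝ} {K : ℝ} (hker : IsKernelOf κ H) (hc : Continuous H)
    (heven : ∀ s, H (-s) = H s) (hK : ∀ s, |H s| ≤ K * ((1 + s ^ 2) ^ 2)⁻¹) {z₁ z₂ : ℍ}
    (hne : z₁ ≠ z₂) :
    (κ (dist z₁ z₂) : ℂ) = ((2 * Real.pi ^ 3)⁻¹ : ℝ) * ∫ s in Set.Ioi (0 : ℝ),
      ((H s * s ^ 2 : ℝ) : ℂ) * (bFactor s * bFactor (-s)) * boundaryPairing s z₁ z₂ := by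
  obtain ⟨M, hM⟩ := exists_bound_profile hker.cont hker.supp
  have hw : 1 < Real.cosh (dist z₁ z₂) := Real.one_lt_cosh.mpr (dist_pos.mpr hne).ne'
  have hinv := abel_inversion_swap (continuous_profile hker.cont) hM
    (fun w hw => profile_eq_zero hker.supp hw) (Real.one_le_cosh 1) hc heven hK
    (fun s => by rw [← hcTransform_eq_fourier hker.cont hker.supp]; exact hker.transform s) hw
  rw [profile_cosh κ dist_nonneg] at hinv
  have hpi : (Real.pi : ℂ) ≠ 0 := by exact_mod_cast Real.pi_pos.ne'
  have hC := congrArg (fun x : ℝ => (x : ℂ)) hinv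
  rw [← integral_complex_ofReal] at hC
  -- The sine quotient is s times `sph3`; together with the s already present this gives the weight
  -- s².
  have hin : ∀ s ∈ Set.Ioi (0 : ℝ), (((H s * s * ∫ v : ℝ,
      Real.sin (s * Real.arcosh (Real.cosh (dist z₁ z₂) + v ^ 2 / 2)) *
        (√((Real.cosh (dist z₁ z₂) + v ^ 2 / 2) ^ 2 - 1))⁻¹ : ℝ)) : ℂ) =
      (Real.pi : ℂ)⁻¹ * (((H s * s ^ 2 : ℝ) : ℂ) * (bFactor s * bFactor (-s)) *
        boundaryPairing s z₁ z₂) := by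
    intro s hs
    have hs' : (0 : ℝ) < s := hs
    rw [mul_assoc (((H s * s ^ 2 : ℝ) : ℂ)), ← integral_sph3 hs' hne]
    have e : ∀ v : ℝ, Real.sin (s * Real.arcosh (Real.cosh (dist z₁ z₂) + v ^ 2 / 2)) *
        (√((Real.cosh (dist z₁ z₂) + v ^ 2 / 2) ^ 2 - 1))⁻¹ =
        s * sph3 s (Real.cosh (dist z₁ z₂) + v ^ 2 / 2) := by
      intro v
      rw [sph3, mul_div_assoc', mul_div_mul_left _ _ hs'.ne', ← div_eq_mul_inv]
    simp only [e, integral_const_mul]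
    push_cast
    field_simp
  rw [setIntegral_congr_fun measurableSet_Ioi hin, integral_const_mul] at hC
  generalize (∫ s in Set.Ioi (0 : ℝ),
      ((H s * s ^ 2 : ℝ) : ℂ) * (bFactor s * bFactor (-s)) * boundaryPairing s z₁ z₂) = J at hC ⊢
  push_cast at hC ⊢
  rw [eq_inv_mul_iff_mul_eq₀ (mul_ne_zero two_ne_zero (pow_ne_zero 3 hpi))]
  rw [eq_inv_mul_iff_mul_eq₀ hpi] at hC
  linear_combination hC

/-! ### Regularised van der Corput estimates -/

/-- A regularised form of van der Corput's lemma. -/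
lemma norm_integral_le_of_phase {f U V : ℝ → ℂ} {N N' : ℝ → ℝ} {μ : ℝ} (hμ : 0 < μ)
    (hU : ∀ x, HasDerivAt U (V x + Complex.I * N x * f x) x)
    (hN : ∀ x, HasDerivAt N (N' x) x) (hN' : Measurable N') (hf : Integrable f)
    (hVm : AEStronglyMeasurable V)
    (hV : Integrable fun x => ‖V x‖ * (|N x| / (N x ^ 2 + μ ^ 2)))
    (hUN : Integrable fun x => ‖U x‖ * (|N' x| / (N x ^ 2 + μ ^ 2)))
    (hbot : Filter.Tendsto (fun x => U x * ((N x / (N x ^ 2 + μ ^ 2) : ℝ) : ℂ))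
      Filter.atBot (nhds 0))
    (htop : Filter.Tendsto (fun x => U x * ((N x / (N x ^ 2 + μ ^ 2) : ℝ) : ℂ))
      Filter.atTop (nhds 0)) :
    ‖∫ x, f x‖ ≤ (∫ x, ‖f x‖ * (μ ^ 2 / (N x ^ 2 + μ ^ 2))) +
      (∫ x, ‖V x‖ * (|N x| / (N x ^ 2 + μ ^ 2))) +
      ∫ x, ‖U x‖ * (|N' x| / (N x ^ 2 + μ ^ 2)) := by
  have hR : ∀ x, 0 < N x ^ 2 + μ ^ 2 := fun x => by positivity
  have hNc : Continuous N := continuous_iff_continuousAt.mpr fun x => (hN x).continuousAt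
  have hUc : Continuous U := continuous_iff_continuousAt.mpr fun x => (hU x).continuousAt
  have hRc : Continuous fun x => N x ^ 2 + μ ^ 2 := by fun_prop
  have hR0 : ∀ x, N x ^ 2 + μ ^ 2 ≠ 0 := fun x => (hR x).ne'
  have hfi : Integrable fun x => ‖f x‖ * (μ ^ 2 / (N x ^ 2 + μ ^ 2)) := by
    refine hf.norm.mul_bdd (c := 1)
      (continuous_const.div hRc hR0).aestronglyMeasurable (.of_forall fun x => ?_)
    rw [Real.norm_of_nonneg (div_nonneg (sq_nonneg _) (hR x).le), div_le_one (hR x)]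
    nlinarith [sq_nonneg (N x)]
  -- Multiplying U' = V + iNf by N/(N²+μ²) gives if up to the error if μ²/(N²+μ²), and the weight
  -- stays bounded at zeros of N. No stationary point has to be excised: `E` collects this error,
  -- the V term and the derivative of the weight.
  set E : ℝ → ℂ := fun x => Complex.I * f x * ((μ ^ 2 / (N x ^ 2 + μ ^ 2) : ℝ) : ℂ) -
    V x * ((N x / (N x ^ 2 + μ ^ 2) : ℝ) : ℂ) -
    U x * ((N' x * (μ ^ 2 - N x ^ 2) / (N x ^ 2 + μ ^ 2) ^ 2 : ℝ) : ℂ) with hE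
  have hEb : ∀ x, ‖E x‖ ≤ ‖f x‖ * (μ ^ 2 / (N x ^ 2 + μ ^ 2)) +
      ‖V x‖ * (|N x| / (N x ^ 2 + μ ^ 2)) + ‖U x‖ * (|N' x| / (N x ^ 2 + μ ^ 2)) := by
    intro x
    refine (norm_sub_le _ _).trans (add_le_add ((norm_sub_le _ _).trans (add_le_add ?_ ?_)) ?_)
    · rw [norm_mul, norm_mul, Complex.norm_I, one_mul, Complex.norm_real,
        Real.norm_of_nonneg (div_nonneg (sq_nonneg _) (hR x).le)]
    · rw [norm_mul, Complex.norm_real, Real.norm_eq_abs, abs_div, abs_of_pos (hR x)]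
    · rw [norm_mul, Complex.norm_real, Real.norm_eq_abs, abs_div, abs_mul, abs_of_pos (pow_pos (hR x) 2)]
      refine mul_le_mul_of_nonneg_left ?_ (norm_nonneg _)
      rw [div_le_div_iff₀ (pow_pos (hR x) 2) (hR x), sq (N x ^ 2 + μ ^ 2), ← mul_assoc]
      refine mul_le_mul_of_nonneg_right ?_ (hR x).le
      refine mul_le_mul_of_nonneg_left ?_ (abs_nonneg _)
      rw [abs_le]
      constructor <;> nlinarith [sq_nonneg (N x), sq_nonneg μ]
  have hEi : Integrable E := by
    refine ((hfi.add hV).add hUN).mono' ?_ (.of_forall hEb)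
    refine ((hf.aestronglyMeasurable.const_mul _).mul ?_ |>.sub (hVm.mul ?_)).sub
      (hUc.aestronglyMeasurable.mul ?_)
    · exact (Complex.continuous_ofReal.comp (continuous_const.div hRc hR0)).aestronglyMeasurable
    · exact (Complex.continuous_ofReal.comp (hNc.div hRc hR0)).aestronglyMeasurable
    · refine Measurable.aestronglyMeasurable ?_
      refine Complex.measurable_ofReal.comp ?_
      exact (hN'.mul (by fun_prop)).div (by fun_prop)
  have hG : ∀ x, HasDerivAt (fun x => U x * ((N x / (N x ^ 2 + μ ^ 2) : ℝ) : ℂ))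
      (Complex.I * f x - E x) x := by
    intro x
    have h1 : HasDerivAt (fun x => N x / (N x ^ 2 + μ ^ 2))
        (N' x * (μ ^ 2 - N x ^ 2) / (N x ^ 2 + μ ^ 2) ^ 2) x := by
      refine ((hN x).div (((hN x).fun_pow 2).add_const (μ ^ 2)) (hR0 x)).congr_deriv ?_
      congr 1
      push_cast
      ring
    refine ((hU x).mul h1.ofReal_comp).congr_deriv ?_
    have hRC : ((N x : ℂ) ^ 2 + (μ : ℂ) ^ 2) ≠ 0 := by exact_mod_cast hR0 x
    simp only [hE]
    push_cast
    field_simp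
    ring
  have hint := integral_of_hasDerivAt_of_tendsto hG ((hf.const_mul _).sub hEi) hbot htop
  rw [integral_sub (hf.const_mul _) hEi, sub_zero, sub_eq_zero, integral_const_mul] at hint
  have hnorm : ‖∫ x, f x‖ = ‖∫ x, E x‖ := by
    rw [← hint, norm_mul, Complex.norm_I, one_mul]
  have hsum : Integrable fun x => ‖f x‖ * (μ ^ 2 / (N x ^ 2 + μ ^ 2)) +
      ‖V x‖ * (|N x| / (N x ^ 2 + μ ^ 2)) := hfi.add hV
  rw [hnorm, ← integral_add hfi hV, ← integral_add hsum hUN]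
  exact norm_integral_le_of_norm_le (hsum.add hUN) (.of_forall hEb)

/-- The version of the regularised van der Corput lemma for integrands supported in a compact
interval. -/
lemma norm_integral_le_of_phase_Icc {f U V : ℝ → ℂ} {N N' : ℝ → ℝ} {μ a b Af Au Av : ℝ}
    {S : Set ℝ} (hμ : 0 < μ) (hab : a ≤ b) (hS : MeasurableSet S) (hSab : S ⊆ Set.Icc a b)
    (hU : ∀ x, HasDerivAt U (V x + Complex.I * N x * f x) x)
    (hN : ∀ x, HasDerivAt N (N' x) x) (hN' : Continuous N')
    (hfm : AEStronglyMeasurable f) (hVm : AEStronglyMeasurable V)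
    (hf0 : ∀ x, x ∉ S → f x = 0) (hU0 : ∀ x, x ∉ Set.Icc a b → U x = 0)
    (hV0 : ∀ x, x ∉ Set.Icc a b → V x = 0)
    (hf : ∀ x ∈ S, ‖f x‖ ≤ Af) (hUb : ∀ x ∈ Set.Icc a b, ‖U x‖ ≤ Au)
    (hVb : ∀ x ∈ Set.Icc a b, ‖V x‖ ≤ Av) :
    ‖∫ x, f x‖ ≤ Af * (∫ x in S, μ ^ 2 / (N x ^ 2 + μ ^ 2)) +
      Av * (∫ x in a..b, |N x| / (N x ^ 2 + μ ^ 2)) +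
      Au * ∫ x in a..b, |N' x| / (N x ^ 2 + μ ^ 2) := by
  have hR : ∀ x, 0 < N x ^ 2 + μ ^ 2 := fun x => by positivity
  have hNc : Continuous N := continuous_iff_continuousAt.mpr fun x => (hN x).continuousAt
  have hUc : Continuous U := continuous_iff_continuousAt.mpr fun x => (hU x).continuousAt
  have hRc : Continuous fun x => N x ^ 2 + μ ^ 2 := by fun_prop
  have hR0 : ∀ x, N x ^ 2 + μ ^ 2 ≠ 0 := fun x => (hR x).ne'
  -- The set T is kept general so that the term in f can be integrated over the smaller set S, while
  -- the terms in U and V use the whole interval.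
  have key : ∀ (T : Set ℝ) (g : ℝ → ℂ) (A : ℝ) (w : ℝ → ℝ), MeasurableSet T → T ⊆ Set.Icc a b →
      AEStronglyMeasurable g → Continuous w →
      (∀ x, 0 ≤ w x) → (∀ x, x ∉ T → g x = 0) → (∀ x ∈ T, ‖g x‖ ≤ A) →
      Integrable (fun x => ‖g x‖ * w x) ∧ ∫ x, ‖g x‖ * w x ≤ A * ∫ x in T, w x := by
    intro T g A w hT hTab hgm hw hw0 hg0 hgA
    have hAw : IntegrableOn (fun x => A * w x) T :=
      ((continuous_const.mul hw).integrableOn_Icc).mono_set hTab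
    have hon : IntegrableOn (fun x => ‖g x‖ * w x) T := by
      refine hAw.mono' (hgm.norm.mul hw.aestronglyMeasurable).restrict ?_
      refine (ae_restrict_iff' hT).mpr (.of_forall fun x hx => ?_)
      rw [Real.norm_of_nonneg (mul_nonneg (norm_nonneg _) (hw0 x))]
      exact mul_le_mul_of_nonneg_right (hgA x hx) (hw0 x)
    have hz : ∀ x, x ∉ T → ‖g x‖ * w x = 0 := fun x hx => by rw [hg0 x hx]; simp
    refine ⟨(integrableOn_iff_integrable_of_support_subset fun x hx => ?_).mp hon, ?_⟩
    · by_contra hc; exact hx (hz x hc)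
    · rw [← setIntegral_eq_integral_of_forall_compl_eq_zero hz, ← integral_const_mul]
      exact setIntegral_mono_on hon hAw hT fun x hx =>
        mul_le_mul_of_nonneg_right (hgA x hx) (hw0 x)
  have hIcc : ∀ w : ℝ → ℝ, ∫ x in Set.Icc a b, w x = ∫ x in a..b, w x := fun w => by
    rw [intervalIntegral.integral_of_le hab, integral_Icc_eq_integral_Ioc]
  obtain ⟨-, b1⟩ := key S f Af (fun x => μ ^ 2 / (N x ^ 2 + μ ^ 2)) hS hSab hfm
    (continuous_const.div hRc hR0) (fun x => div_nonneg (sq_nonneg _) (hR x).le) hf0 hf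
  obtain ⟨iV, b2⟩ := key _ V Av (fun x => |N x| / (N x ^ 2 + μ ^ 2)) measurableSet_Icc le_rfl hVm
    (hNc.abs.div hRc hR0) (fun x => div_nonneg (abs_nonneg _) (hR x).le) hV0 hVb
  obtain ⟨iU, b3⟩ := key _ U Au (fun x => |N' x| / (N x ^ 2 + μ ^ 2)) measurableSet_Icc le_rfl
    hUc.aestronglyMeasurable
    (hN'.abs.div hRc hR0) (fun x => div_nonneg (abs_nonneg _) (hR x).le) hU0 hUb
  obtain ⟨if1, -⟩ := key S f Af (fun x => 1) hS hSab hfm continuous_const (fun x => zero_le_one)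
    hf0 hf
  rw [hIcc] at b2 b3
  have hfi : Integrable f := by
    rw [← integrable_norm_iff hfm]; simpa using if1
  refine (norm_integral_le_of_phase hμ hU hN hN'.measurable hfi hVm iV iU ?_ ?_).trans
    (add_le_add (add_le_add b1 b2) b3)
  · refine tendsto_const_nhds.congr' ?_
    filter_upwards [Filter.eventually_lt_atBot a] with x hx
    rw [hU0 x (fun h => absurd h.1 (not_le.mpr hx)), zero_mul]
  · refine tendsto_const_nhds.congr' ?_
    filter_upwards [Filter.eventually_gt_atTop b] with x hx
    rw [hU0 x (fun h => absurd h.2 (not_le.mpr hx)), zero_mul]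

/-- The integrand is the derivative of μ⁻¹ arctan(N/μ), so the bound depends neither on the length
of the interval nor on the size of N. -/
lemma integral_deriv_div_le {N N' : ℝ → ℝ} {μ a b : ℝ} (hμ : 0 < μ)
    (hN : ∀ x, HasDerivAt N (N' x) x) (hN' : Continuous N') :
    |∫ x in a..b, N' x / (N x ^ 2 + μ ^ 2)| ≤ Real.pi / μ := by
  have hNc : Continuous N := continuous_iff_continuousAt.mpr fun x => (hN x).continuousAt
  have hd : ∀ x, HasDerivAt (fun x => μ⁻¹ * Real.arctan (N x / μ)) (N' x / (N x ^ 2 + μ ^ 2)) x := by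
    intro x
    refine ((((hN x).div_const μ).arctan).const_mul μ⁻¹).congr_deriv ?_
    have : 0 < N x ^ 2 + μ ^ 2 := by positivity
    field_simp
    ring
  rw [intervalIntegral.integral_eq_sub_of_hasDerivAt (fun x _ => hd x)
    ((hN'.div (by fun_prop) fun x => by positivity).intervalIntegrable _ _), ← mul_sub, abs_mul,
    abs_of_pos (inv_pos.mpr hμ), div_eq_inv_mul Real.pi]
  refine mul_le_mul_of_nonneg_left ?_ (inv_pos.mpr hμ).le
  have h1 := Real.arctan_lt_pi_div_two (N b / μ)
  have h2 := Real.neg_pi_div_two_lt_arctan (N b / μ)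
  have h3 := Real.arctan_lt_pi_div_two (N a / μ)
  have h4 := Real.neg_pi_div_two_lt_arctan (N a / μ)
  rw [abs_le]
  constructor <;> linarith

/-- Monotone phases: the sign of the derivative is constant. -/
lemma integral_abs_deriv_div_le {N N' : ℝ → ℝ} {μ a b : ℝ} (hμ : 0 < μ) (hab : a ≤ b)
    (hN : ∀ x, HasDerivAt N (N' x) x) (hN' : Continuous N')
    (hsign : (∀ x ∈ Set.Icc a b, 0 ≤ N' x) ∨ ∀ x ∈ Set.Icc a b, N' x ≤ 0) :
    ∫ x in a..b, |N' x| / (N x ^ 2 + μ ^ 2) ≤ Real.pi / μ := by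
  have h := abs_le.mp (integral_deriv_div_le (a := a) (b := b) hμ hN hN')
  rcases hsign with hs | hs
  · rw [intervalIntegral.integral_congr (g := fun x => N' x / (N x ^ 2 + μ ^ 2))]
    · exact h.2
    · intro x hx
      rw [Set.uIcc_of_le hab] at hx
      simp only [abs_of_nonneg (hs x hx)]
  · rw [intervalIntegral.integral_congr (g := fun x => -(N' x / (N x ^ 2 + μ ^ 2)))]
    · rw [intervalIntegral.integral_neg]; linarith [h.1]
    · intro x hx
      rw [Set.uIcc_of_le hab] at hx
      simp only [abs_of_nonpos (hs x hx), neg_div]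

lemma integrable_sq_div {c μ : ℝ} (hc : 0 < c) (hμ : 0 < μ) :
    Integrable (fun r : ℝ => μ ^ 2 / ((c * r) ^ 2 + μ ^ 2)) ∧
      ∫ r : ℝ, μ ^ 2 / ((c * r) ^ 2 + μ ^ 2) = μ / c * Real.pi := by
  have e : ∀ r : ℝ, μ ^ 2 / ((c * r) ^ 2 + μ ^ 2) = (1 + (c / μ * r) ^ 2)⁻¹ := by
    intro r
    have : 0 < (c * r) ^ 2 + μ ^ 2 := by positivity
    field_simp
    ring
  simp only [e]
  refine ⟨integrable_inv_one_add_sq.comp_mul_left' (by positivity), ?_⟩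
  rw [Measure.integral_comp_mul_left (fun r : ℝ => (1 + r ^ 2)⁻¹), integral_univ_inv_one_add_sq,
    inv_div, abs_of_pos (by positivity), smul_eq_mul]

/-- Take U = (1+r²)^(-it) with |t| = s: then V = 0 and N = -2tr, so there is one nondegenerate
stationary point and μ = √s balances the terms. The product of the two bounds shows that the
spectral density s²|`bFactor`|² grows only linearly. -/
lemma norm_bFactor_le_inv_sqrt {s : ℝ} (hs : 0 < s) :
    ‖bFactor s‖ ≤ 2 * Real.pi / √s ∧ ‖bFactor (-s)‖ ≤ 2 * Real.pi / √s := by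
  have main : ∀ t : ℝ, |t| = s → ‖bFactor t‖ ≤ 2 * Real.pi / √s := by
    intro t ht
    have hμ : 0 < √s := Real.sqrt_pos.mpr hs
    have hsq : ∀ r : ℝ, (-(2 * t * r)) ^ 2 = (2 * s * r) ^ 2 := by
      intro r; simp only [neg_sq, mul_pow, ← ht, sq_abs]
    obtain ⟨i1, v1⟩ := integrable_sq_div (c := 2 * s) (by positivity) hμ
    set U : ℝ → ℂ := fun r => Complex.exp (((t * Real.log ((1 + r ^ 2)⁻¹) : ℝ) : ℂ) * Complex.I)
    have hUn : ∀ r, ‖U r‖ = 1 := fun r => Complex.norm_exp_ofReal_mul_I _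
    have i3 : Integrable fun r : ℝ => ‖U r‖ * (|-(2 * t)| / ((-(2 * t * r)) ^ 2 + √s ^ 2)) := by
      refine (i1.const_mul (2 * s / √s ^ 2)).congr (.of_forall fun r => ?_)
      simp only [hUn, hsq, abs_neg, abs_mul, ht, abs_two]
      field_simp
    have v3 : ∫ r : ℝ, ‖U r‖ * (|-(2 * t)| / ((-(2 * t * r)) ^ 2 + √s ^ 2)) =
        Real.pi / √s := by
      calc _ = ∫ r : ℝ, 2 * s / √s ^ 2 * (√s ^ 2 / ((2 * s * r) ^ 2 + √s ^ 2)) := by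
            congr 1; ext r
            simp only [hUn, hsq, abs_neg, abs_mul, ht, abs_two]
            field_simp
        _ = _ := by rw [integral_const_mul, v1]; field_simp
    have hlim : ∀ l : Filter ℝ, Filter.Tendsto (fun r : ℝ => |r|) l Filter.atTop →
        Filter.Tendsto (fun r => U r * ((-(2 * t * r) / ((-(2 * t * r)) ^ 2 + √s ^ 2) : ℝ) : ℂ)) l
          (nhds 0) := by
      intro l hl
      have h0 : Filter.Tendsto (fun r : ℝ => (2 * s)⁻¹ * |r|⁻¹) l (nhds 0) := by
        simpa using (tendsto_inv_atTop_zero.comp hl).const_mul (2 * s)⁻¹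
      refine squeeze_zero_norm' ?_ h0
      filter_upwards [hl.eventually_gt_atTop 0] with r hr
      have habs : |2 * t * r| = 2 * s * |r| := by rw [abs_mul, abs_mul, abs_two, ht]
      have hden : 0 < (2 * s * r) ^ 2 + √s ^ 2 := by positivity
      rw [norm_mul, hUn, one_mul, Complex.norm_real, Real.norm_eq_abs, abs_div, abs_neg, habs, hsq,
        abs_of_pos hden, ← mul_inv, div_le_iff₀ hden, inv_mul_eq_div, le_div_iff₀ (by positivity)]
      rw [mul_pow _ r, ← sq_abs r]
      nlinarith [sq_nonneg √s]
    have hbd := norm_integral_le_of_phase (f := fun r => onePow t ((1 + r ^ 2)⁻¹))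
      (U := U) (V := fun _ => 0) (N := fun r => -(2 * t * r)) (N' := fun _ => -(2 * t)) hμ ?_ ?_
      measurable_const (integrable_onePow_inv t) aestronglyMeasurable_const (by simp) i3
      (hlim _ Filter.tendsto_abs_atBot_atTop) (hlim _ Filter.tendsto_abs_atTop_atTop)
    · rw [v3] at hbd
      simp only [norm_zero, zero_mul, integral_zero, add_zero, hsq] at hbd
      have h1 : ∫ r : ℝ, ‖onePow t ((1 + r ^ 2)⁻¹)‖ * (√s ^ 2 / ((2 * s * r) ^ 2 + √s ^ 2)) ≤
          √s / (2 * s) * Real.pi := by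
        rw [← v1]
        refine integral_mono_of_nonneg (.of_forall fun r => by positivity) i1
          (.of_forall fun r => ?_)
        refine mul_le_of_le_one_left (by positivity) ?_
        rw [norm_onePow _ (by positivity)]
        exact inv_le_one_of_one_le₀ (by nlinarith [sq_nonneg r])
      have h2 : √s / (2 * s) * Real.pi = Real.pi / √s / 2 := by
        rw [div_mul_eq_mul_div, div_div, div_eq_div_iff (by positivity) (by positivity)]
        linear_combination (2 * Real.pi) * Real.mul_self_sqrt hs.le
      have h3 : 0 < Real.pi / √s := by positivity
      rw [h2] at h1
      rw [bFactor, mul_div_assoc]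
      linarith
    · intro r
      have hp : 0 < 1 + r ^ 2 := by positivity
      have hd : HasDerivAt (fun r : ℝ => t * Real.log ((1 + r ^ 2)⁻¹))
          (-(2 * t * r) * (1 + r ^ 2)⁻¹) r := by
        simp only [Real.log_inv]
        have h := (((hasDerivAt_pow 2 r).const_add 1).log hp.ne').neg.const_mul t
        exact h.congr_deriv (by push_cast; field_simp)
      refine ((hd.ofReal_comp.mul_const Complex.I).cexp).congr_deriv ?_
      simp only [onePow]
      push_cast
      ring
    · intro r
      exact ((hasDerivAt_id r).const_mul (2 * t)).neg.congr_deriv (by simp)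
  exact ⟨main s (abs_of_pos hs), main (-s) (by rw [abs_neg, abs_of_pos hs])⟩

/-! ### Twisted periods along one geodesic: the first stationary phase -/

/-- `b` is smooth, vanishes off `[0, 1]`, and `b` and `b'` are bounded by `M`. -/
structure IsAmp (b : ℝ → ℂ) (M : ℝ) : Prop where
  smooth : ContDiff ℝ ∞ b
  supp : ∀ x, x ∉ Set.Icc (0 : ℝ) 1 → b x = 0
  bound : ∀ x, ‖b x‖ ≤ M
  bound_deriv : ∀ x, ‖deriv b x‖ ≤ M

namespace IsAmp

variable {b : ℝ → ℂ} {M : ℝ}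

lemma hasDerivAt (hb : IsAmp b M) (x : ℝ) : HasDerivAt b (deriv b x) x :=
  (hb.smooth.differentiable (by simp) x).hasDerivAt

lemma nonneg (hb : IsAmp b M) : 0 ≤ M := (norm_nonneg _).trans (hb.bound 0)

lemma deriv_supp (hb : IsAmp b M) {x : ℝ} (hx : x ∉ Set.Icc (0 : ℝ) 1) : deriv b x = 0 := by
  have h : b =ᶠ[nhds x] fun _ => 0 := by
    filter_upwards [isClosed_Icc.isOpen_compl.mem_nhds hx] with y hy using hb.supp y hy
  rw [h.deriv_eq, deriv_const]

lemma hasCompactSupport (hb : IsAmp b M) : HasCompactSupport b :=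
  HasCompactSupport.intro isCompact_Icc fun x hx => hb.supp x hx

lemma contDiff_deriv (hb : IsAmp b M) : ContDiff ℝ ∞ (deriv b) :=
  ((contDiff_infty_iff_deriv (𝕜 := ℝ)).mp hb.smooth).2

lemma star (hb : IsAmp b M) : IsAmp (fun x => (starRingEnd ℂ) (b x)) M := by
  have hd : ∀ x, HasDerivAt (fun x => (starRingEnd ℂ) (b x)) ((starRingEnd ℂ) (deriv b x)) x :=
    fun x => (hb.hasDerivAt x).star_conj
  refine ⟨?_, fun x hx => by simp [hb.supp x hx], fun x => by simpa using hb.bound x, fun x => ?_⟩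
  · exact Complex.conjCLE.contDiff.comp hb.smooth
  · rw [(hd x).deriv]; simpa using hb.bound_deriv x

end IsAmp

lemma hasDerivAt_tanh (x : ℝ) : HasDerivAt Real.tanh (1 / Real.cosh x ^ 2) x := by
  have h : Real.tanh = fun x => Real.sinh x / Real.cosh x := by
    ext x; exact Real.tanh_eq_sinh_div_cosh x
  rw [h]
  refine ((Real.hasDerivAt_sinh x).div (Real.hasDerivAt_cosh x)
    (Real.cosh_pos x).ne').congr_deriv ?_
  congr 1
  nlinarith [Real.cosh_sq x]

lemma continuous_tanh : Continuous Real.tanh :=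
  continuous_iff_continuousAt.mpr fun x => (hasDerivAt_tanh x).continuousAt

/-- The oscillating factor `e ^ (i λ u) (cosh u) ^ (-1/2 - i s)`. -/
def oscFactor (s lam u : ℝ) : ℂ :=
  Complex.exp (((-(1 / 2) * Real.log (Real.cosh u) : ℝ) : ℂ) +
    ((lam * u - s * Real.log (Real.cosh u) : ℝ) : ℂ) * Complex.I)

lemma hasDerivAt_log_cosh (u : ℝ) :
    HasDerivAt (fun u => Real.log (Real.cosh u)) (Real.tanh u) u := by
  rw [Real.tanh_eq_sinh_div_cosh]
  exact (Real.hasDerivAt_cosh u).log (Real.cosh_pos u).ne'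

lemma hasDerivAt_oscFactor (s lam u : ℝ) : HasDerivAt (oscFactor s lam)
    (oscFactor s lam u * (((-(1 / 2) * Real.tanh u : ℝ) : ℂ) +
      ((lam - s * Real.tanh u : ℝ) : ℂ) * Complex.I)) u := by
  have h1 := ((hasDerivAt_log_cosh u).const_mul (-(1 / 2))).ofReal_comp
  have h2 := (((hasDerivAt_id u).const_mul lam).sub
    ((hasDerivAt_log_cosh u).const_mul s)).ofReal_comp.mul_const Complex.I
  refine (h1.add h2).cexp.congr_deriv ?_
  simp [oscFactor]

lemma continuous_oscFactor (s lam : ℝ) : Continuous (oscFactor s lam) :=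
  continuous_iff_continuousAt.mpr fun u => (hasDerivAt_oscFactor s lam u).continuousAt

lemma norm_oscFactor (s lam u : ℝ) : ‖oscFactor s lam u‖ = √(Real.cosh u)⁻¹ := by
  rw [oscFactor, Complex.exp_add, norm_mul, Complex.norm_exp_ofReal_mul_I, mul_one,
    ← Complex.ofReal_exp, Complex.norm_real, Real.norm_of_nonneg (Real.exp_pos _).le,
    Real.sqrt_eq_rpow, Real.rpow_def_of_pos (inv_pos.mpr (Real.cosh_pos u)), Real.log_inv]
  ring_nf

lemma norm_oscFactor_le_one (s lam u : ℝ) : ‖oscFactor s lam u‖ ≤ 1 := by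
  rw [norm_oscFactor, Real.sqrt_le_one]
  exact inv_le_one_of_one_le₀ (Real.one_le_cosh u)

/-- On the support of u ↦ b(τ+u) the variable u is within distance 1 of -τ, so cosh u and cosh τ are
comparable. -/
lemma cosh_le_exp_one_mul_cosh {τ u : ℝ} (h : u ∈ Set.Icc (-τ) (1 - τ)) :
    Real.cosh τ ≤ Real.exp 1 * Real.cosh u := by
  obtain ⟨h1, h2⟩ := h
  rw [Real.cosh_eq, Real.cosh_eq]
  have a1 : Real.exp τ ≤ Real.exp 1 * Real.exp (-u) := by
    rw [← Real.exp_add]; exact Real.exp_le_exp.mpr (by linarith)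
  have a2 : Real.exp (-τ) ≤ Real.exp 1 * Real.exp u := by
    rw [← Real.exp_add]; exact Real.exp_le_exp.mpr (by linarith)
  linarith

lemma norm_oscFactor_le (s lam : ℝ) {τ u : ℝ} (h : u ∈ Set.Icc (-τ) (1 - τ)) :
    ‖oscFactor s lam u‖ ≤ √(Real.exp 1) * √(Real.cosh τ)⁻¹ := by
  rw [norm_oscFactor, ← Real.sqrt_mul (Real.exp_pos 1).le]
  refine Real.sqrt_le_sqrt ?_
  rw [← div_eq_mul_inv, inv_le_comm₀ (Real.cosh_pos u) (by have := Real.cosh_pos τ; positivity),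
    inv_div, div_le_iff₀ (Real.exp_pos 1)]
  linarith [cosh_le_exp_one_mul_cosh h]

/-- The oscillating integral `∫ b(τ + u) e ^ (i λ u) (cosh u) ^ (-1/2 - i s) du`. -/
def betaInt (b : ℝ → ℂ) (s lam τ : ℝ) : ℂ := ∫ u : ℝ, b (τ + u) * oscFactor s lam u

/-- The parameter τ occurs only in b, not in the oscillating factor. Differentiation therefore
replaces b by b' and costs no power of s. -/
lemma hasDerivAt_betaInt {b : ℝ → ℂ} {M : ℝ} (hb : IsAmp b M) (s lam τ : ℝ) :
    HasDerivAt (betaInt b s lam) (betaInt (deriv b) s lam τ) τ := by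
  have hcont : Continuous fun t => oscFactor s lam (-t) :=
    (continuous_oscFactor s lam).comp continuous_neg
  have key := hb.hasCompactSupport.hasDerivAt_convolution_right (ContinuousLinearMap.mul ℝ ℂ)
    (f₀ := fun t => oscFactor s lam (-t)) (μ := volume) hcont.locallyIntegrable
    (hb.smooth.of_le (by simp)) τ
  have e : ∀ (g : ℝ → ℂ) (x : ℝ),
      (convolution (fun t => oscFactor s lam (-t)) g (ContinuousLinearMap.mul ℝ ℂ) volume) x =
        betaInt g s lam x := by
    intro g x
    rw [convolution_def, betaInt, ← integral_neg_eq_self]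
    congr 1; ext u
    simp [mul_comm]
  rw [e] at key
  refine key.congr_of_eventuallyEq (.of_forall fun x => (e b x).symm)

/-- This is the van der Corput inequality with μ = √s and N = λ - s tanh u. The factor 2 before Q
comes from |b'| + |b|/2, since the amplitude (cosh u)^(-1/2) is differentiated as well. -/
lemma norm_betaInt_le_of {b : ℝ → ℂ} {M K P Q : ℝ} (hb : IsAmp b M) {s lam τ : ℝ} (hs : 0 < s)
    (hk : ∀ u ∈ Set.Icc (-τ) (1 - τ), ‖oscFactor s lam u‖ ≤ K)
    (hP : ∫ u in (-τ)..(1 - τ), (√s) ^ 2 / ((lam - s * Real.tanh u) ^ 2 + (√s) ^ 2) ≤ P)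
    (hQ : ∫ u in (-τ)..(1 - τ),
      |lam - s * Real.tanh u| / ((lam - s * Real.tanh u) ^ 2 + (√s) ^ 2) ≤ Q)
    {S : ℝ} (hS : ∫ u in (-τ)..(1 - τ),
      |-(s * (1 / Real.cosh u ^ 2))| / ((lam - s * Real.tanh u) ^ 2 + (√s) ^ 2) ≤ S) :
    ‖betaInt b s lam τ‖ ≤ M * K * (P + 2 * Q + S) := by
  have hM := hb.nonneg
  have hK : 0 ≤ K := (norm_nonneg _).trans (hk (-τ) ⟨le_rfl, by linarith⟩)
  have hoff : ∀ x, x ∉ Set.Icc (-τ) (1 - τ) → τ + x ∉ Set.Icc (0 : ℝ) 1 := by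
    intro x hx hx'; exact hx ⟨by linarith [hx'.1], by linarith [hx'.2]⟩
  have hbτ : ∀ x, HasDerivAt (fun u => b (τ + u)) (deriv b (τ + x)) x := fun x =>
    (hb.hasDerivAt (τ + x)).comp_const_add τ x
  have hbc : Continuous fun u => b (τ + u) := hb.smooth.continuous.comp (by fun_prop)
  have hbc' : Continuous fun u => deriv b (τ + u) :=
    hb.contDiff_deriv.continuous.comp (by fun_prop)
  have hoc := continuous_oscFactor s lam
  have htc := continuous_tanh
  have hcosh : ∀ u, Real.cosh u ^ 2 ≠ 0 := fun u => (pow_pos (Real.cosh_pos u) 2).ne'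
  refine (norm_integral_le_of_phase_Icc (f := fun u => b (τ + u) * oscFactor s lam u)
    (U := fun u => b (τ + u) * oscFactor s lam u)
    (V := fun u => (deriv b (τ + u) + ((-(1 / 2) * Real.tanh u : ℝ) : ℂ) * b (τ + u)) *
      oscFactor s lam u) (N := fun u => lam - s * Real.tanh u)
    (N' := fun u => -(s * (1 / Real.cosh u ^ 2))) (μ := √s) (a := -τ) (b := 1 - τ)
    (Af := M * K) (Au := M * K) (Av := 2 * (M * K)) (Real.sqrt_pos.mpr hs) (by linarith)
    measurableSet_Icc le_rfl ?_ ?_ ?_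
    (hbc.mul hoc).aestronglyMeasurable ?_ ?_ ?_ ?_ ?_ ?_ ?_).trans ?_
  · intro x
    refine ((hbτ x).mul (hasDerivAt_oscFactor s lam x)).congr_deriv ?_
    push_cast; ring
  · intro x
    exact ((hasDerivAt_tanh x).const_mul s).const_sub lam
  · exact ((continuous_const.div (by fun_prop) hcosh).const_mul s).neg
  · refine Continuous.aestronglyMeasurable ?_
    have : Continuous fun u => ((-(1 / 2) * Real.tanh u : ℝ) : ℂ) :=
      Complex.continuous_ofReal.comp (htc.const_mul _)
    exact (hbc'.add (this.mul hbc)).mul hoc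
  · intro x hx; simp [hb.supp _ (hoff x hx)]
  · intro x hx; simp [hb.supp _ (hoff x hx)]
  · intro x hx; simp [hb.supp _ (hoff x hx), hb.deriv_supp (hoff x hx)]
  · intro x hx
    rw [norm_mul]; exact mul_le_mul (hb.bound _) (hk x hx) (norm_nonneg _) hM
  · intro x hx
    rw [norm_mul]; exact mul_le_mul (hb.bound _) (hk x hx) (norm_nonneg _) hM
  · intro x hx
    rw [norm_mul, ← mul_assoc]
    refine mul_le_mul ?_ (hk x hx) (norm_nonneg _) (by positivity)
    refine (norm_add_le _ _).trans ?_
    rw [norm_mul, Complex.norm_real, Real.norm_eq_abs, abs_mul]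
    have h1 := hb.bound_deriv (τ + x)
    have h2 := hb.bound (τ + x)
    have h3 := Real.abs_tanh_lt_one x
    have h4 : |(-(1 / 2) : ℝ)| = 1 / 2 := by norm_num
    rw [h4]
    nlinarith [norm_nonneg (b (τ + x)), abs_nonneg (Real.tanh x)]
  · rw [integral_Icc_eq_integral_Ioc, ← intervalIntegral.integral_of_le (by linarith)]
    have hMK : 0 ≤ M * K := mul_nonneg hM hK
    nlinarith [mul_le_mul_of_nonneg_left hP hMK, mul_le_mul_of_nonneg_left hQ hMK,
      mul_le_mul_of_nonneg_left hS hMK]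

lemma continuous_betaPhase (s lam : ℝ) : Continuous fun u => (lam - s * Real.tanh u) :=
  continuous_const.sub (continuous_tanh.const_mul s)

lemma abs_div_sq_add_sq_le {N μ : ℝ} (hμ : 0 < μ) : |N| / (N ^ 2 + μ ^ 2) ≤ 1 / (2 * μ) := by
  rw [div_le_div_iff₀ (by positivity) (by positivity)]
  nlinarith [sq_nonneg (|N| - μ), sq_abs N]

/-- For bounded τ the derivative of λ - s tanh u has constant sign and size comparable with s,
whatever λ is. Thus μ²/(N²+μ²) is dominated by a constant times |N'|/(N²+μ²), whose integral is
O(1/√s). -/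
lemma norm_betaInt_le {b : ℝ → ℂ} {M R : ℝ} (hb : IsAmp b M) {s lam τ : ℝ} (hs : 0 < s)
    (hτ : |τ| ≤ R) :
    ‖betaInt b s lam τ‖ ≤ M * (Real.pi * Real.cosh (R + 1) ^ 2 + 1 + Real.pi) / √s := by
  have hsq : 0 < √s := Real.sqrt_pos.mpr hs
  have hNc := continuous_betaPhase s lam
  have hcosh : ∀ u, Real.cosh u ^ 2 ≠ 0 := fun u => (pow_pos (Real.cosh_pos u) 2).ne'
  have hN'c : Continuous fun u => -(s * (1 / Real.cosh u ^ 2)) :=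
    ((continuous_const.div (by fun_prop) hcosh).const_mul s).neg
  have hR : ∀ u, (lam - s * Real.tanh u) ^ 2 + (√s) ^ 2 ≠ 0 := fun u => by positivity
  have hle : -τ ≤ 1 - τ := by linarith
  have hS := integral_abs_deriv_div_le (N := fun u => lam - s * Real.tanh u)
    (N' := fun u => -(s * (1 / Real.cosh u ^ 2))) hsq hle
    (fun x => ((hasDerivAt_tanh x).const_mul s).const_sub lam) hN'c
    (Or.inr fun x _ => by have := Real.cosh_pos x; simp; positivity)
  have i3 : IntervalIntegrable (fun u => |-(s * (1 / Real.cosh u ^ 2))| /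
      ((lam - s * Real.tanh u) ^ 2 + (√s) ^ 2)) volume (-τ) (1 - τ) :=
    (hN'c.abs.div (by fun_prop) hR).intervalIntegrable _ _
  have hP : ∫ u in (-τ)..(1 - τ), (√s) ^ 2 / ((lam - s * Real.tanh u) ^ 2 + (√s) ^ 2) ≤
      Real.cosh (R + 1) ^ 2 * (Real.pi / √s) := by
    refine le_trans ?_ (mul_le_mul_of_nonneg_left hS (by positivity))
    rw [← intervalIntegral.integral_const_mul]
    refine intervalIntegral.integral_mono_on hle
      ((continuous_const.div (by fun_prop) hR).intervalIntegrable _ _) (i3.const_mul _) ?_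
    intro u hu
    rw [mul_div_assoc']
    refine div_le_div_of_nonneg_right ?_ (by positivity)
    have hcu : Real.cosh u ≤ Real.cosh (R + 1) := by
      rw [Real.cosh_le_cosh, abs_of_nonneg (a := R + 1) (by linarith [abs_nonneg τ])]
      rw [abs_le] at hτ ⊢
      exact ⟨by linarith [hu.1], by linarith [hu.2]⟩
    have hcp := Real.cosh_pos u
    rw [abs_neg, abs_of_nonneg (by positivity), Real.sq_sqrt hs.le, mul_one_div, mul_div_assoc',
      le_div_iff₀ (by positivity), mul_comm s]
    gcongr
  have hQ : ∫ u in (-τ)..(1 - τ),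
      |lam - s * Real.tanh u| / ((lam - s * Real.tanh u) ^ 2 + (√s) ^ 2) ≤ 1 / (2 * √s) := by
    have := intervalIntegral.integral_mono_on hle
      ((hNc.abs.div (by fun_prop) hR).intervalIntegrable _ _)
      (intervalIntegrable_const (c := 1 / (2 * √s)) (μ := volume))
      (fun u _ => abs_div_sq_add_sq_le (N := lam - s * Real.tanh u) hsq)
    rwa [intervalIntegral.integral_const, sub_neg_eq_add, sub_add_cancel, one_smul] at this
  refine (norm_betaInt_le_of hb hs (fun u _ => norm_oscFactor_le_one s lam u) hP hQ hS).trans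
    (le_of_eq ?_)
  field_simp

/-- Without a stationary point the gain is a full power of s. The factor (cosh τ)^(-1/2) is retained
because τ is unbounded here and the result is later integrated over the boundary. -/
lemma norm_betaInt_le_of_phase {b : ℝ → ℂ} {M δ : ℝ} (hb : IsAmp b M) {s lam τ : ℝ} (hs : 0 < s)
    (hδ : 0 < δ) (hN : ∀ u ∈ Set.Icc (-τ) (1 - τ), δ * s ≤ |lam - s * Real.tanh u|) :
    ‖betaInt b s lam τ‖ ≤
      M * (√(Real.exp 1) * √(Real.cosh τ)⁻¹) * (2 / (δ ^ 2 * s) + 2 / (δ * s)) := by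
  have hsq : 0 < √s := Real.sqrt_pos.mpr hs
  have hNc := continuous_betaPhase s lam
  have hcosh : ∀ u, Real.cosh u ^ 2 ≠ 0 := fun u => (pow_pos (Real.cosh_pos u) 2).ne'
  have hN'c : Continuous fun u => -(s * (1 / Real.cosh u ^ 2)) :=
    ((continuous_const.div (by fun_prop) hcosh).const_mul s).neg
  have hR : ∀ u, (lam - s * Real.tanh u) ^ 2 + (√s) ^ 2 ≠ 0 := fun u => by positivity
  have hle : -τ ≤ 1 - τ := by linarith
  have hsm := Real.sq_sqrt hs.le
  have hden : ∀ u ∈ Set.Icc (-τ) (1 - τ),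
      δ ^ 2 * s ^ 2 ≤ (lam - s * Real.tanh u) ^ 2 := by
    intro u hu
    have := pow_le_pow_left₀ (by positivity) (hN u hu) 2
    rwa [mul_pow, sq_abs] at this
  have key : ∀ (w : ℝ → ℝ) (c : ℝ), Continuous w → (∀ u ∈ Set.Icc (-τ) (1 - τ), w u ≤ c) →
      ∫ u in (-τ)..(1 - τ), w u ≤ c := by
    intro w c hw hc
    have := intervalIntegral.integral_mono_on hle (hw.intervalIntegrable _ _)
      (intervalIntegrable_const (c := c) (μ := volume)) hc
    rwa [intervalIntegral.integral_const, sub_neg_eq_add, sub_add_cancel, one_smul] at this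
  refine (norm_betaInt_le_of hb hs (fun u hu => norm_oscFactor_le s lam hu)
    (P := 1 / (δ ^ 2 * s)) (Q := 1 / (δ * s)) (S := 1 / (δ ^ 2 * s))
    (key _ _ (continuous_const.div (by fun_prop) hR) fun u hu => ?_)
    (key _ _ (hNc.abs.div (by fun_prop) hR) fun u hu => ?_)
    (key _ _ (hN'c.abs.div (by fun_prop) hR) fun u hu => ?_)).trans (le_of_eq ?_)
  · rw [hsm, div_le_div_iff₀ (by positivity) (by positivity)]
    nlinarith [hden u hu]
  · have h1 := hN u hu
    rw [div_le_div_iff₀ (by positivity) (by positivity), one_mul, ← sq_abs (lam - _)]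
    nlinarith [abs_nonneg (lam - s * Real.tanh u), sq_nonneg (√s)]
  · have h1 : |-(s * (1 / Real.cosh u ^ 2))| ≤ s := by
      rw [abs_neg, abs_of_nonneg (by positivity)]
      refine mul_le_of_le_one_right hs.le ?_
      rw [div_le_one (by have := Real.cosh_pos u; positivity)]
      exact one_le_pow₀ (Real.one_le_cosh u)
    rw [div_le_div_iff₀ (by positivity) (by positivity)]
    have h2 := mul_le_mul_of_nonneg_right h1 (by positivity : 0 ≤ δ ^ 2 * s)
    nlinarith [hden u hu]
  · congr 1; ring

lemma one_sub_tanh_le {v : ℝ} (hv : 0 < v) : 1 - v⁻¹ ≤ Real.tanh v := by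
  have h1 := Real.add_one_le_exp v
  have h2 : 0 < Real.exp (-v) := Real.exp_pos _
  have h3 : Real.exp v * Real.exp (-v) = 1 := by rw [← Real.exp_add]; simp
  have h4 : Real.exp (-v) ≤ 1 := Real.exp_le_one_iff.mpr (by linarith)
  rw [Real.tanh_eq_sinh_div_cosh, le_div_iff₀ (Real.cosh_pos v), Real.cosh_eq, Real.sinh_eq]
  have h5 : v * v⁻¹ = 1 := mul_inv_cancel₀ hv.ne'
  have h6 : 0 < v⁻¹ := inv_pos.mpr hv
  nlinarith [mul_le_mul_of_nonneg_left h1 h6.le, mul_pos h6 h2]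

lemma abs_tanh_ge {u v : ℝ} (hv : 0 < v) (h : v ≤ |u|) : 1 - v⁻¹ ≤ |Real.tanh u| := by
  have hu : 0 < |u| := hv.trans_le h
  have h1 := one_sub_tanh_le hu
  have h2 : Real.tanh |u| ≤ |Real.tanh u| := by
    rcases abs_cases u with ⟨h, _⟩ | ⟨h, _⟩ <;> rw [h]
    · exact le_abs_self _
    · rw [Real.tanh_neg]; exact neg_le_abs _
  have h3 : |u|⁻¹ ≤ v⁻¹ := inv_anti₀ hv h
  linarith

/-- If |τ| ≥ 2/δ + 1, then |u| ≥ 2/δ on the support and |tanh u| ≥ 1 - δ/2. Against |λ| ≤ (1-δ)s the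
phase derivative is at least δs/2. -/
lemma norm_betaInt_le_of_large {b : ℝ → ℂ} {M δ : ℝ} (hb : IsAmp b M) {s lam τ : ℝ} (hs : 0 < s)
    (hδ : 0 < δ) (hlam : |lam| ≤ (1 - δ) * s) (hτ : 2 / δ + 1 ≤ |τ|) :
    ‖betaInt b s lam τ‖ ≤
      M * (√(Real.exp 1) * √(Real.cosh τ)⁻¹) * (8 / (δ ^ 2 * s) + 4 / (δ * s)) := by
  refine (norm_betaInt_le_of_phase hb hs (half_pos hδ) fun u hu => ?_).trans (le_of_eq ?_)
  · have hu' : 2 / δ ≤ |u| := by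
      have : |τ| ≤ |u| + 1 := by
        rw [abs_le]
        constructor
        · linarith [hu.1, hu.2, neg_abs_le u, le_abs_self u]
        · linarith [hu.1, hu.2, neg_abs_le u, le_abs_self u]
      linarith
    have h1 := abs_tanh_ge (by positivity) hu'
    rw [inv_div] at h1
    have h2 : |s * Real.tanh u| - |lam| ≤ |lam - s * Real.tanh u| := by
      rw [abs_sub_comm lam]; exact abs_sub_abs_le_abs_sub _ _
    rw [abs_mul, abs_of_pos hs] at h2
    nlinarith [mul_le_mul_of_nonneg_left h1 hs.le]
  · congr 1; field_simp; ring

/-- The twisted period `∫ b(x) e ^ (i λ x) (e ^ x / (p² + e ^ (2 x) q²)) ^ (1/2 + i s) dx`. -/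
def boundaryCoef (b : ℝ → ℂ) (s lam p q : ℝ) : ℂ :=
  ∫ x : ℝ, b x * Complex.exp (((lam * x : ℝ) : ℂ) * Complex.I) *
    halfPow s (Real.exp x / (p ^ 2 + Real.exp x ^ 2 * q ^ 2))

/-- The phase of the leading term of `boundaryCoef`. -/
def coefPhase (s lam p q : ℝ) : ℂ :=
  Complex.exp (((-s * (Real.log 2 + Real.log p + Real.log q) +
    lam * (Real.log p - Real.log q) : ℝ) : ℂ) * Complex.I)

/-- `(2 |p q|) ^ (-1/2)`. -/
def coefSize (p q : ℝ) : ℝ := Real.exp (-(1 / 2) * (Real.log 2 + Real.log p + Real.log q))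

lemma exp_log_sub_log {p q : ℝ} (hp : p ≠ 0) (hq : q ≠ 0) :
    Real.exp (Real.log p - Real.log q) = |p| / |q| := by
  rw [Real.exp_sub, Real.exp_log_eq_abs hp, Real.exp_log_eq_abs hq]

lemma cosh_log_sub_log {p q : ℝ} (hp : p ≠ 0) (hq : q ≠ 0) :
    Real.cosh (Real.log p - Real.log q) = (p ^ 2 + q ^ 2) / (2 * |p| * |q|) := by
  have hp' := abs_pos.mpr hp
  have hq' := abs_pos.mpr hq
  rw [Real.cosh_eq, Real.exp_neg, exp_log_sub_log hp hq, ← sq_abs p, ← sq_abs q]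
  field_simp

/-- The prefactor is singular when p or q tends to 0; the decay in τ compensates, leaving a weight
that is singular only where both vanish. -/
lemma coefSize_mul_sqrt {p q : ℝ} (hp : p ≠ 0) (hq : q ≠ 0) :
    coefSize p q * √(Real.cosh (Real.log p - Real.log q))⁻¹ = (√(p ^ 2 + q ^ 2))⁻¹ := by
  have hp' := abs_pos.mpr hp
  have hq' := abs_pos.mpr hq
  have h : coefSize p q = √(2 * |p| * |q|)⁻¹ := by
    rw [coefSize, Real.sqrt_eq_rpow, Real.rpow_def_of_pos (by positivity), Real.log_inv,
      Real.log_mul (by positivity) (by positivity), Real.log_mul (by positivity) (by positivity),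
      Real.log_abs, Real.log_abs]
    ring_nf
  rw [h, cosh_log_sub_log hp hq, ← Real.sqrt_mul (by positivity), ← Real.sqrt_inv]
  congr 1
  field_simp

/-- The shift x = τ + u with τ = log|p/q| makes p² + e^(2x)q² symmetric, equal to 2|pq| e^x cosh u.
Signs of p and q play no role, `Real.log` being the logarithm of the absolute value. -/
lemma boundaryCoef_eq (b : ℝ → ℂ) (s lam : ℝ) {p q : ℝ} (hp : p ≠ 0) (hq : q ≠ 0) :
    boundaryCoef b s lam p q =
      coefSize p q * coefPhase s lam p q * betaInt b s lam (Real.log p - Real.log q) := by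
  set τ := Real.log p - Real.log q with hτ
  rw [boundaryCoef, betaInt, ← integral_const_mul, ← integral_add_left_eq_self _ τ]
  congr 1; ext u
  have hp' := abs_pos.mpr hp
  have hq' := abs_pos.mpr hq
  have hc := Real.cosh_pos u
  have hval : Real.exp (τ + u) / (p ^ 2 + Real.exp (τ + u) ^ 2 * q ^ 2) =
      (2 * |p| * |q| * Real.cosh u)⁻¹ := by
    rw [Real.exp_add, hτ, exp_log_sub_log hp hq, Real.cosh_eq, Real.exp_neg, ← sq_abs p,
      ← sq_abs q]
    have := Real.exp_pos u
    field_simp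
    ring
  have hlog : Real.log (2 * |p| * |q| * Real.cosh u)⁻¹ =
      -(Real.log 2 + Real.log p + Real.log q) - Real.log (Real.cosh u) := by
    rw [Real.log_inv, Real.log_mul (by positivity) hc.ne',
      Real.log_mul (by positivity) (by positivity), Real.log_mul (by positivity) (by positivity),
      Real.log_abs, Real.log_abs]
    ring
  have hsqrt : √(2 * |p| * |q| * Real.cosh u)⁻¹ =
      Real.exp (-(1 / 2) * (Real.log 2 + Real.log p + Real.log q) +
        -(1 / 2) * Real.log (Real.cosh u)) := by
    rw [Real.sqrt_eq_rpow, Real.rpow_def_of_pos (by positivity), hlog]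
    ring_nf
  rw [halfPow, hval, hlog, hsqrt, coefSize, coefPhase, oscFactor, Real.exp_add]
  push_cast
  rw [Complex.exp_add]
  have e1 : ∀ x y z : ℂ, x * y * z = x * (y * z) := mul_assoc
  have : Complex.exp ((lam : ℂ) * (τ + u) * Complex.I) * Complex.exp ((s : ℂ) *
      (-((Real.log 2 : ℂ) + Real.log p + Real.log q) - Real.log (Real.cosh u)) * Complex.I) =
      Complex.exp ((-(s : ℂ) * ((Real.log 2 : ℂ) + Real.log p + Real.log q) +
        lam * ((Real.log p : ℂ) - Real.log q)) * Complex.I) *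
      Complex.exp (((lam : ℂ) * u - s * Real.log (Real.cosh u)) * Complex.I) := by
    rw [← Complex.exp_add, ← Complex.exp_add, hτ]
    congr 1; push_cast; ring
  linear_combination (b (τ + u) * Complex.exp (-(1 / 2) * ((Real.log 2 : ℂ) + Real.log p +
    Real.log q)) * Complex.exp (-(1 / 2) * Real.log (Real.cosh u))) * this

/-! ### The cutoff and the amplitude of the leading term -/

/-- `χ` is a cutoff function, equal to `1` on `[-R₀, R₀]` and to `0` off `[-R, R]`. -/
structure IsCutoff (χ : ℝ → ℝ) (R₀ R K : ℝ) : Prop where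
  diff : Differentiable ℝ χ
  nonneg : ∀ x, 0 ≤ χ x
  le_one : ∀ x, χ x ≤ 1
  deriv_le : ∀ x, |deriv χ x| ≤ K
  eq_one : ∀ x, |x| ≤ R₀ → χ x = 1
  eq_zero : ∀ x, R ≤ |x| → χ x = 0
  deriv_eq_zero : ∀ x, R ≤ |x| → deriv χ x = 0

lemma exists_isCutoff {R₀ : ℝ} (hR : 0 < R₀) : ∃ χ K, IsCutoff χ R₀ (R₀ + 2) K := by
  let f : ContDiffBump (0 : ℝ) := ⟨R₀, R₀ + 1, hR, by linarith⟩
  have hd : ContDiff ℝ ∞ f := f.contDiff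
  have hz : ∀ x : ℝ, R₀ + 1 < |x| → f x = 0 := fun x hx =>
    f.zero_of_le_dist (by simpa [f] using hx.le)
  obtain ⟨K, hK⟩ := f.hasCompactSupport.deriv.exists_bound_of_continuous
    (((contDiff_infty_iff_deriv (𝕜 := ℝ)).mp hd).2.continuous)
  refine ⟨f, K, hd.differentiable (by simp), fun x => f.nonneg, fun x => f.le_one,
    hK, fun x hx => f.one_of_mem_closedBall (by simpa [f] using hx), fun x hx => hz x (by linarith),
    fun x hx => ?_⟩
  have : (f : ℝ → ℝ) =ᶠ[nhds x] fun _ => 0 := by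
    filter_upwards [continuous_abs.continuousAt.eventually (lt_mem_nhds (show R₀ + 1 < |x| by
      linarith))] with y hy using hz y hy
  rw [this.deriv_eq, deriv_const]

/-- The amplitude of the leading term of `boundaryCoef`. -/
def coefAmp (χ : ℝ → ℝ) (b : ℝ → ℂ) (s lam p q : ℝ) : ℂ :=
  if p * q = 0 then 0 else
    coefSize p q * (χ (Real.log p - Real.log q) * betaInt b s lam (Real.log p - Real.log q))

lemma coefSize_eq {p q : ℝ} (hp : p ≠ 0) (hq : q ≠ 0) : coefSize p q = √(2 * |p| * |q|)⁻¹ := by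
  have hp' := abs_pos.mpr hp
  have hq' := abs_pos.mpr hq
  rw [coefSize, Real.sqrt_eq_rpow, Real.rpow_def_of_pos (by positivity), Real.log_inv,
    Real.log_mul (by positivity) (by positivity), Real.log_mul (by positivity) (by positivity),
    Real.log_abs, Real.log_abs]
  ring_nf

lemma coefSize_pos (p q : ℝ) : 0 < coefSize p q := Real.exp_pos _

lemma coefAmp_eq_zero {χ : ℝ → ℝ} {R₀ R K : ℝ} (hχ : IsCutoff χ R₀ R K) (b : ℝ → ℂ) (s lam : ℝ)
    {p q : ℝ} (h : p * q = 0 ∨ R ≤ |Real.log p - Real.log q|) : coefAmp χ b s lam p q = 0 := by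
  rw [coefAmp]
  split_ifs with h0
  · rfl
  · rw [hχ.eq_zero _ (h.resolve_left h0)]; simp

lemma abs_le_of_log_sub {p q R : ℝ} (hp : p ≠ 0) (hq : q ≠ 0)
    (h : |Real.log p - Real.log q| ≤ R) : |p| ≤ Real.exp R * |q| ∧ |q| ≤ Real.exp R * |p| := by
  have hp' := abs_pos.mpr hp
  have hq' := abs_pos.mpr hq
  rw [abs_le] at h
  constructor
  · rw [← div_le_iff₀ hq', ← exp_log_sub_log hp hq]
    exact Real.exp_le_exp.mpr h.2
  · rw [← div_le_iff₀ hp', ← exp_log_sub_log hq hp]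
    exact Real.exp_le_exp.mpr (by linarith)

lemma coefAmp_eq_zero_of_lt {χ : ℝ → ℝ} {R₀ R K : ℝ} (hχ : IsCutoff χ R₀ R K) (b : ℝ → ℂ)
    (s lam : ℝ) {p q : ℝ} (h : Real.exp R * |p| < |q| ∨ Real.exp R * |q| < |p|) :
    coefAmp χ b s lam p q = 0 := by
  apply coefAmp_eq_zero hχ
  by_contra hc
  push Not at hc
  obtain ⟨h0, hR⟩ := hc
  have := abs_le_of_log_sub (left_ne_zero_of_mul h0) (right_ne_zero_of_mul h0) hR.le
  rcases h with h | h
  · linarith [this.2]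
  · linarith [this.1]

/-- Near a zero of exactly one of p and q the true value of |log|p/q|| exceeds the range of the
cutoff. Hence the value 0 prescribed in `coefAmp` at pq = 0 is the smooth extension, although
`Real.log 0 = 0` would suggest otherwise. -/
lemma eventually_coefAmp_eq_zero {χ : ℝ → ℝ} {R₀ R K : ℝ} (hχ : IsCutoff χ R₀ R K) (b : ℝ → ℂ)
    (s lam : ℝ) {p q : ℝ → ℝ} {x : ℝ} (hp : Continuous p) (hq : Continuous q)
    (h0 : p x * q x = 0) (h1 : p x ≠ 0 ∨ q x ≠ 0) :
    (fun ξ => coefAmp χ b s lam (p ξ) (q ξ)) =ᶠ[nhds x] fun _ => 0 := by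
  have key : Real.exp R * |p x| < |q x| ∨ Real.exp R * |q x| < |p x| := by
    rcases mul_eq_zero.mp h0 with h | h
    · left; rw [h, abs_zero, mul_zero]; exact abs_pos.mpr (h1.resolve_left (not_not.mpr h))
    · right; rw [h, abs_zero, mul_zero]; exact abs_pos.mpr (h1.resolve_right (not_not.mpr h))
  have c1 : Continuous fun ξ => Real.exp R * |p ξ| := continuous_const.mul hp.abs
  have c2 : Continuous fun ξ => Real.exp R * |q ξ| := continuous_const.mul hq.abs
  rcases key with h | h
  · filter_upwards [c1.continuousAt.eventually_lt hq.abs.continuousAt h] with ξ hξ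
    exact coefAmp_eq_zero_of_lt hχ b s lam (Or.inl hξ)
  · filter_upwards [c2.continuousAt.eventually_lt hp.abs.continuousAt h] with ξ hξ
    exact coefAmp_eq_zero_of_lt hχ b s lam (Or.inr hξ)

/-- The two forms are not both small, and inside the cutoff their ratio is bounded; hence neither is
small. -/
lemma lower_bounds {p q L R : ℝ} (hp : p ≠ 0) (hq : q ≠ 0) (hL : 1 ≤ L * (|p| + |q|)) (hL0 : 0 ≤ L)
    (h : |Real.log p - Real.log q| ≤ R) :
    |p|⁻¹ ≤ L * (1 + Real.exp R) ∧ |q|⁻¹ ≤ L * (1 + Real.exp R) := by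
  obtain ⟨h1, h2⟩ := abs_le_of_log_sub hp hq h
  have hp' := abs_pos.mpr hp
  have hq' := abs_pos.mpr hq
  constructor
  · rw [inv_le_iff_one_le_mul₀ hp']
    nlinarith [mul_le_mul_of_nonneg_left h2 hL0]
  · rw [inv_le_iff_one_le_mul₀ hq']
    nlinarith [mul_le_mul_of_nonneg_left h1 hL0]

lemma coefSize_le {p q T : ℝ} (hp : p ≠ 0) (hq : q ≠ 0) (h1 : |p|⁻¹ ≤ T) (h2 : |q|⁻¹ ≤ T) :
    coefSize p q ≤ T := by
  have hp' := inv_pos.mpr (abs_pos.mpr hp)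
  have hq' := inv_pos.mpr (abs_pos.mpr hq)
  rw [coefSize_eq hp hq]
  refine Real.sqrt_le_iff.mpr ⟨by linarith, ?_⟩
  rw [mul_inv, mul_inv]
  nlinarith [mul_le_mul h1 h2 hq'.le (by linarith)]

/-- The derivative of the amplitude along a line. -/
lemma hasDerivAt_coefAmp {χ : ℝ → ℝ} {b : ℝ → ℂ} {R₀ R K M : ℝ} (hχ : IsCutoff χ R₀ R K)
    (hb : IsAmp b M) (s lam : ℝ) {a e c d x : ℝ} (hp : a * x + e ≠ 0) (hq : c * x + d ≠ 0) :
    HasDerivAt (fun ξ => coefAmp χ b s lam (a * ξ + e) (c * ξ + d))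
      (coefSize (a * x + e) (c * x + d) *
        (((-(1 / 2) * (a / (a * x + e) + c / (c * x + d)) : ℝ) : ℂ) *
          (χ (Real.log (a * x + e) - Real.log (c * x + d)) *
            betaInt b s lam (Real.log (a * x + e) - Real.log (c * x + d))) +
        ((a / (a * x + e) - c / (c * x + d) : ℝ) : ℂ) *
          (deriv χ (Real.log (a * x + e) - Real.log (c * x + d)) *
            betaInt b s lam (Real.log (a * x + e) - Real.log (c * x + d)) +
          χ (Real.log (a * x + e) - Real.log (c * x + d)) *
            betaInt (deriv b) s lam (Real.log (a * x + e) - Real.log (c * x + d))))) x := by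
  have hlin : ∀ u v : ℝ, HasDerivAt (fun ξ : ℝ => u * ξ + v) u x := fun u v => by
    simpa using ((hasDerivAt_id x).const_mul u).add_const v
  have hlp := (hlin a e).log hp
  have hlq := (hlin c d).log hq
  have h1 : HasDerivAt (fun ξ => coefSize (a * ξ + e) (c * ξ + d)) _ x :=
    (((hlp.const_add (Real.log 2)).add hlq).const_mul (-(1 / 2))).exp
  have hτ := hlp.sub hlq
  have h2 := (hχ.diff (Real.log (a * x + e) - Real.log (c * x + d))).hasDerivAt.comp x hτ
  have h3 := (hasDerivAt_betaInt hb s lam (Real.log (a * x + e) - Real.log (c * x + d))).scomp x hτ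
  have h := h1.ofReal_comp.mul (h2.ofReal_comp.mul h3)
  have hev : (fun ξ => coefAmp χ b s lam (a * ξ + e) (c * ξ + d)) =ᶠ[nhds x]
      fun ξ => (coefSize (a * ξ + e) (c * ξ + d) : ℂ) *
        (χ (Real.log (a * ξ + e) - Real.log (c * ξ + d)) *
            betaInt b s lam (Real.log (a * ξ + e) - Real.log (c * ξ + d))) := by
    have hn := (hlin a e).continuousAt.eventually_ne hp
    have hn' := (hlin c d).continuousAt.eventually_ne hq
    filter_upwards [hn, hn'] with ξ h1 h2
    rw [coefAmp, if_neg (mul_ne_zero h1 h2)]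
  refine (h.congr_of_eventuallyEq hev).congr_deriv ?_
  simp only [Pi.sub_apply, Pi.add_apply, Function.comp_apply, Complex.real_smul, Pi.mul_apply]
  rw [coefSize]
  push_cast
  ring

/-- Determinant one gives a(cx+d) - c(ax+e) = 1, so the linear forms cannot both be small, and on
the support of the cutoff each is bounded below. There the size factor and τ have bounded
derivatives, and the derivative of `betaInt` is again of size s^(-1/2). -/
lemma coefAmp_bounds {χ : ℝ → ℝ} {R₀ R K M : ℝ} (hχ : IsCutoff χ R₀ R K) {b : ℝ → ℂ}
    (hb : IsAmp b M) (hb' : IsAmp (deriv b) M) {L : ℝ} (hL : 0 ≤ L) : ∃ C, 0 ≤ C ∧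
    ∀ s lam a e c d : ℝ, 0 < s → |a| ≤ L → |c| ≤ L → a * d - e * c = 1 → ∀ x,
      HasDerivAt (fun ξ => coefAmp χ b s lam (a * ξ + e) (c * ξ + d))
        (deriv (fun ξ => coefAmp χ b s lam (a * ξ + e) (c * ξ + d)) x) x ∧
      ‖coefAmp χ b s lam (a * x + e) (c * x + d)‖ ≤ C / √s ∧
      ‖deriv (fun ξ => coefAmp χ b s lam (a * ξ + e) (c * ξ + d)) x‖ ≤ C / √s ∧
      (((a * x + e) * (c * x + d) = 0 ∨ R ≤ |Real.log (a * x + e) - Real.log (c * x + d)|) →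
        coefAmp χ b s lam (a * x + e) (c * x + d) = 0 ∧
        deriv (fun ξ => coefAmp χ b s lam (a * ξ + e) (c * ξ + d)) x = 0) := by
  have hM := hb.nonneg
  have hK : 0 ≤ K := (abs_nonneg _).trans (hχ.deriv_le 0)
  set B := M * (Real.pi * Real.cosh (R + 1) ^ 2 + 1 + Real.pi) with hB
  have hB0 : 0 ≤ B := by have := Real.pi_pos; positivity
  set T := L * (1 + Real.exp R) with hT
  have hT0 : 0 ≤ T := by positivity
  refine ⟨T * B + T * (L * T * B + 2 * (L * T) * (K * B + B)), by positivity, ?_⟩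
  intro s lam a e c d hs ha hc hdet x
  have hsq : 0 < √s := Real.sqrt_pos.mpr hs
  have hlow : 1 ≤ L * (|a * x + e| + |c * x + d|) := by
    have h1 : a * (c * x + d) - c * (a * x + e) = 1 := by linear_combination hdet
    have h2 : |a * (c * x + d)| + |c * (a * x + e)| ≥ 1 := by
      calc (1 : ℝ) = |a * (c * x + d) - c * (a * x + e)| := by rw [h1, abs_one]
        _ ≤ _ := abs_sub _ _
    rw [abs_mul, abs_mul] at h2
    nlinarith [mul_le_mul_of_nonneg_right ha (abs_nonneg (c * x + d)),
      mul_le_mul_of_nonneg_right hc (abs_nonneg (a * x + e))]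
  have hnz : a * x + e ≠ 0 ∨ c * x + d ≠ 0 := by
    by_contra hcon
    push Not at hcon
    rw [hcon.1, hcon.2] at hlow
    simp at hlow
    linarith
  by_cases h0 : (a * x + e) * (c * x + d) = 0
  · have hev := eventually_coefAmp_eq_zero hχ b s lam (p := fun ξ => a * ξ + e)
      (q := fun ξ => c * ξ + d) (x := x) (by fun_prop) (by fun_prop) h0 hnz
    have hd : HasDerivAt (fun ξ => coefAmp χ b s lam (a * ξ + e) (c * ξ + d)) 0 x :=
      (hasDerivAt_const x (0 : ℂ)).congr_of_eventuallyEq hev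
    have hz := coefAmp_eq_zero hχ b s lam (Or.inl h0)
    rw [hd.deriv, hz, norm_zero]
    exact ⟨hd, by positivity, by positivity, fun _ => ⟨rfl, rfl⟩⟩
  · have hp := left_ne_zero_of_mul h0
    have hq := right_ne_zero_of_mul h0
    have hd := hasDerivAt_coefAmp hχ hb s lam hp hq
    set p := a * x + e
    set q := c * x + d
    set τ := Real.log p - Real.log q with hτ
    refine ⟨by rw [hd.deriv]; exact hd, ?_⟩
    rw [hd.deriv, coefAmp, if_neg h0, ← hτ]
    rcases le_or_gt R |τ| with h | h
    · rw [hχ.eq_zero _ h, hχ.deriv_eq_zero _ h]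
      simp
      positivity
    · have hβ := norm_betaInt_le hb hs h.le (lam := lam)
      have hβ' := norm_betaInt_le hb' hs h.le (lam := lam)
      rw [← hB] at hβ hβ'
      obtain ⟨l1, l2⟩ := lower_bounds hp hq hlow hL h.le
      rw [← hT] at l1 l2
      have hsz := coefSize_le hp hq l1 l2
      have hχn : ‖(χ τ : ℂ)‖ ≤ 1 := by
        rw [Complex.norm_real, Real.norm_of_nonneg (hχ.nonneg _)]; exact hχ.le_one _
      have hχn' : ‖((deriv χ τ : ℝ) : ℂ)‖ ≤ K := by rw [Complex.norm_real]; exact hχ.deriv_le _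
      have hszn : ‖(coefSize p q : ℂ)‖ ≤ T := by
        rw [Complex.norm_real, Real.norm_of_nonneg (coefSize_pos _ _).le]; exact hsz
      have hap : |a / p| ≤ L * T := by
        rw [div_eq_mul_inv, abs_mul, abs_inv]; exact mul_le_mul ha l1 (by positivity) hL
      have hcq : |c / q| ≤ L * T := by
        rw [div_eq_mul_inv, abs_mul, abs_inv]; exact mul_le_mul hc l2 (by positivity) hL
      have n1 : ‖(χ τ : ℂ) * betaInt b s lam τ‖ ≤ B / √s := by
        rw [norm_mul]
        calc _ ≤ 1 * (B / √s) := mul_le_mul hχn hβ (norm_nonneg _) zero_le_one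
          _ = _ := one_mul _
      have n2 : ‖((deriv χ τ : ℝ) : ℂ) * betaInt b s lam τ‖ ≤ K * (B / √s) := by
        rw [norm_mul]; exact mul_le_mul hχn' hβ (norm_nonneg _) hK
      have n3 : ‖(χ τ : ℂ) * betaInt (deriv b) s lam τ‖ ≤ B / √s := by
        rw [norm_mul]
        calc _ ≤ 1 * (B / √s) := mul_le_mul hχn hβ' (norm_nonneg _) zero_le_one
          _ = _ := one_mul _
      have hBs : 0 ≤ B / √s := by positivity
      refine ⟨?_, ?_, fun hcon => absurd h (not_lt.mpr (hcon.resolve_left h0))⟩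
      · rw [norm_mul]
        refine (mul_le_mul hszn n1 (norm_nonneg _) hT0).trans ?_
        rw [mul_div_assoc']
        refine div_le_div_of_nonneg_right ?_ hsq.le
        have : 0 ≤ T * (L * T * B + 2 * (L * T) * (K * B + B)) := by positivity
        linarith
      · rw [norm_mul]
        have h4 : ‖((-(1 / 2) * (a / p + c / q) : ℝ) : ℂ)‖ ≤ L * T := by
          rw [Complex.norm_real, Real.norm_eq_abs, abs_mul]
          have h5 : |(-(1 / 2) : ℝ)| = 1 / 2 := by norm_num
          rw [h5]
          linarith [abs_add_le (a / p) (c / q)]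
        have h6 : ‖((a / p - c / q : ℝ) : ℂ)‖ ≤ 2 * (L * T) := by
          rw [Complex.norm_real, Real.norm_eq_abs]
          linarith [abs_sub (a / p) (c / q)]
        have h7 : ‖((-(1 / 2) * (a / p + c / q) : ℝ) : ℂ) * (χ τ * betaInt b s lam τ) +
            ((a / p - c / q : ℝ) : ℂ) * (deriv χ τ * betaInt b s lam τ +
              χ τ * betaInt (deriv b) s lam τ)‖ ≤
            L * T * (B / √s) + 2 * (L * T) * (K * (B / √s) + B / √s) := by
          refine (norm_add_le _ _).trans (add_le_add ?_ ?_)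
          · rw [norm_mul]; exact mul_le_mul h4 n1 (norm_nonneg _) (by positivity)
          · rw [norm_mul]
            exact mul_le_mul h6 ((norm_add_le _ _).trans (add_le_add n2 n3)) (norm_nonneg _)
              (by positivity)
        refine (mul_le_mul hszn h7 (norm_nonneg _) hT0).trans ?_
        have : T * (L * T * (B / √s) + 2 * (L * T) * (K * (B / √s) + B / √s)) =
          T * (L * T * B + 2 * (L * T) * (K * B + B)) / √s := by ring
        rw [this]
        refine div_le_div_of_nonneg_right ?_ hsq.le
        have : 0 ≤ T * B := by positivity
        linarith

lemma norm_coefPhase (s lam p q : ℝ) : ‖coefPhase s lam p q‖ = 1 := by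
  rw [coefPhase, Complex.norm_exp_ofReal_mul_I]

/-- The trivial bound for the twisted periods. -/
lemma norm_boundaryCoef_le {b : ℝ → ℂ} {M : ℝ} (hb : IsAmp b M) (s lam : ℝ) {p q : ℝ}
    (h : 0 < p ^ 2 + q ^ 2) :
    ‖boundaryCoef b s lam p q‖ ≤ M * √(Real.exp 1) * (√(p ^ 2 + q ^ 2))⁻¹ := by
  have hM := hb.nonneg
  set A := M * √(Real.exp 1) * (√(p ^ 2 + q ^ 2))⁻¹ with hA
  have hA0 : 0 ≤ A := by positivity
  have hz : ∀ x, x ∉ Set.Icc (0 : ℝ) 1 → b x * Complex.exp (((lam * x : ℝ) : ℂ) * Complex.I) *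
      halfPow s (Real.exp x / (p ^ 2 + Real.exp x ^ 2 * q ^ 2)) = 0 := fun x hx => by
    rw [hb.supp x hx]; simp
  rw [boundaryCoef, ← setIntegral_eq_integral_of_forall_compl_eq_zero hz]
  refine (norm_setIntegral_le_of_norm_le_const (C := A) (by simp) fun x hx => ?_).trans
    (by simp)
  rw [norm_mul, norm_mul, Complex.norm_exp_ofReal_mul_I, mul_one, norm_halfPow, hA, mul_assoc]
  refine mul_le_mul (hb.bound x) ?_ (Real.sqrt_nonneg _) hM
  rw [← Real.sqrt_inv, ← Real.sqrt_mul (Real.exp_pos 1).le]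
  refine Real.sqrt_le_sqrt ?_
  have h1 : 1 ≤ Real.exp x := Real.one_le_exp hx.1
  have h2 : Real.exp x ≤ Real.exp 1 := Real.exp_le_exp.mpr hx.2
  rw [← div_eq_mul_inv]
  refine div_le_div₀ (Real.exp_pos 1).le h2 h ?_
  nlinarith [sq_nonneg q, sq_nonneg (Real.exp x - 1)]

/-- The remainder lives where χ differs from 1, hence at large |τ|, where the phase is not
stationary and the bound is O(1/s). The leading term lives at bounded τ and is O(s^(-1/2)). Both
carry the same weight (p²+q²)^(-1/2). -/
lemma coef_remainder {χ : ℝ → ℝ} {R K M δ : ℝ} {b : ℝ → ℂ} (hχ : IsCutoff χ (2 / δ + 1) R K)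
    (hb : IsAmp b M) (hδ : 0 < δ) : ∃ C, 0 ≤ C ∧ ∀ s lam p q : ℝ, 1 ≤ s → |lam| ≤ (1 - δ) * s →
      p ≠ 0 → q ≠ 0 →
      ‖boundaryCoef b s lam p q - coefAmp χ b s lam p q * coefPhase s lam p q‖ ≤
        C * s⁻¹ * (√(p ^ 2 + q ^ 2))⁻¹ ∧
      ‖coefAmp χ b s lam p q * coefPhase s lam p q‖ ≤ C * (√s)⁻¹ * (√(p ^ 2 + q ^ 2))⁻¹ ∧
      ‖boundaryCoef b s lam p q‖ ≤ C * (√s)⁻¹ * (√(p ^ 2 + q ^ 2))⁻¹ := by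
  have hM := hb.nonneg
  set B := M * (Real.pi * Real.cosh (R + 1) ^ 2 + 1 + Real.pi) with hB
  have hB0 : 0 ≤ B := by have := Real.pi_pos; positivity
  set C₁ := M * √(Real.exp 1) * (8 / δ ^ 2 + 4 / δ) with hC₁
  have hC₁0 : 0 ≤ C₁ := by positivity
  set C₂ := B * √(Real.cosh R) with hC₂
  have hC₂0 : 0 ≤ C₂ := by positivity
  refine ⟨C₁ + C₂, by positivity, ?_⟩
  intro s lam p q hs hlam hp hq
  have hs0 : 0 < s := by linarith
  have hsq : 0 < √s := Real.sqrt_pos.mpr hs0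
  set τ := Real.log p - Real.log q with hτ
  have hsize := coefSize_mul_sqrt hp hq
  rw [← hτ] at hsize
  set w := (√(p ^ 2 + q ^ 2))⁻¹ with hw
  have hw0 : 0 ≤ w := by positivity
  have hcs := (coefSize_pos p q).le
  have hamp : coefAmp χ b s lam p q = coefSize p q * (χ τ * betaInt b s lam τ) := by
    rw [coefAmp, if_neg (mul_ne_zero hp hq)]
  have hrem : ‖boundaryCoef b s lam p q - coefAmp χ b s lam p q * coefPhase s lam p q‖ ≤
      C₁ * s⁻¹ * w := by
    have e : boundaryCoef b s lam p q - coefAmp χ b s lam p q * coefPhase s lam p q =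
        coefPhase s lam p q * (coefSize p q * (((1 - χ τ : ℝ) : ℂ) * betaInt b s lam τ)) := by
      rw [boundaryCoef_eq b s lam hp hq, hamp, ← hτ]; push_cast; ring
    rw [e, norm_mul, norm_coefPhase, one_mul, norm_mul, Complex.norm_real,
      Real.norm_of_nonneg hcs]
    rcases le_or_gt |τ| (2 / δ + 1) with h | h
    · rw [hχ.eq_one _ h]; simp; positivity
    · have hβ := norm_betaInt_le_of_large hb hs0 hδ hlam h.le
      have h1 : ‖((1 - χ τ : ℝ) : ℂ) * betaInt b s lam τ‖ ≤ ‖betaInt b s lam τ‖ := by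
        rw [norm_mul, Complex.norm_real, Real.norm_of_nonneg (by linarith [hχ.le_one τ])]
        exact mul_le_of_le_one_left (norm_nonneg _) (by linarith [hχ.nonneg τ])
      refine (mul_le_mul_of_nonneg_left (h1.trans hβ) hcs).trans (le_of_eq ?_)
      rw [← hsize, hC₁]
      field_simp
  have hmain : ‖coefAmp χ b s lam p q * coefPhase s lam p q‖ ≤ C₂ * (√s)⁻¹ * w := by
    rw [norm_mul, norm_coefPhase, mul_one, hamp, norm_mul, Complex.norm_real,
      Real.norm_of_nonneg hcs, norm_mul, Complex.norm_real, Real.norm_of_nonneg (hχ.nonneg _)]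
    rcases le_or_gt R |τ| with h | h
    · rw [hχ.eq_zero _ h]; simp; positivity
    · have hβ := norm_betaInt_le hb hs0 h.le (lam := lam)
      rw [← hB] at hβ
      have hcosh : Real.cosh τ ≤ Real.cosh R := by
        rw [Real.cosh_le_cosh]; exact h.le.trans (le_abs_self R)
      have h1 : 1 ≤ √(Real.cosh τ)⁻¹ * √(Real.cosh R) := by
        rw [← Real.sqrt_mul (inv_nonneg.mpr (Real.cosh_pos τ).le), ← div_eq_inv_mul]
        exact Real.one_le_sqrt.mpr ((one_le_div (Real.cosh_pos τ)).mpr hcosh)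
      calc coefSize p q * (χ τ * ‖betaInt b s lam τ‖)
          ≤ coefSize p q * (1 * (B / √s)) := mul_le_mul_of_nonneg_left
            (mul_le_mul (hχ.le_one τ) hβ (norm_nonneg _) zero_le_one) hcs
        _ ≤ coefSize p q * (1 * (B / √s)) * (√(Real.cosh τ)⁻¹ * √(Real.cosh R)) :=
            le_mul_of_one_le_right (by positivity) h1
        _ = C₂ * (√s)⁻¹ * w := by rw [← hsize, hC₂]; ring
  have hinv : s⁻¹ ≤ (√s)⁻¹ := inv_anti₀ hsq (Real.sqrt_le_iff.mpr ⟨by linarith, by nlinarith⟩)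
  have hsi : 0 ≤ (√s)⁻¹ := by positivity
  have hsi' : 0 ≤ s⁻¹ := by positivity
  refine ⟨hrem.trans ?_, hmain.trans ?_, ?_⟩
  · gcongr; linarith
  · gcongr; linarith
  · have := norm_add_le (boundaryCoef b s lam p q - coefAmp χ b s lam p q * coefPhase s lam p q)
      (coefAmp χ b s lam p q * coefPhase s lam p q)
    rw [sub_add_cancel] at this
    have h3 : C₁ * s⁻¹ * w ≤ C₁ * (√s)⁻¹ * w := by gcongr
    linarith

/-! ### Regularised sublevel integrals of quadratic polynomials -/

lemma hasDerivAt_quadratic (A B E x : ℝ) :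
    HasDerivAt (fun x => A * x ^ 2 + B * x + E) (2 * A * x + B) x := by
  refine ((((hasDerivAt_id x).fun_pow 2).const_mul A).add
    ((hasDerivAt_id x).const_mul B)).add_const E |>.congr_deriv ?_
  simp; ring

/-- A quadratic polynomial is monotone on each side of its vertex, and each side contributes at most
π/μ. -/
lemma integral_abs_deriv_quadratic_le {A B E μ ρ : ℝ} (hμ : 0 < μ) (hρ : 0 ≤ ρ) :
    ∫ x in (-ρ)..ρ, |2 * A * x + B| / ((A * x ^ 2 + B * x + E) ^ 2 + μ ^ 2) ≤
      2 * Real.pi / μ := by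
  have hc : Continuous fun x : ℝ => 2 * A * x + B := by fun_prop
  have hR : ∀ x : ℝ, (A * x ^ 2 + B * x + E) ^ 2 + μ ^ 2 ≠ 0 := fun x => by positivity
  have key : ∀ u v : ℝ, u ≤ v → ((∀ x ∈ Set.Icc u v, 0 ≤ 2 * A * x + B) ∨
      (∀ x ∈ Set.Icc u v, 2 * A * x + B ≤ 0)) →
      ∫ x in u..v, |2 * A * x + B| / ((A * x ^ 2 + B * x + E) ^ 2 + μ ^ 2) ≤ Real.pi / μ :=
    fun u v huv h => integral_abs_deriv_div_le hμ huv (hasDerivAt_quadratic A B E) hc h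
  have hpi : Real.pi / μ ≤ 2 * Real.pi / μ := by
    have := Real.pi_pos
    refine div_le_div_of_nonneg_right (by linarith) hμ.le
  have hle : -ρ ≤ ρ := by linarith
  rcases eq_or_ne A 0 with rfl | hA
  · refine (key _ _ hle ?_).trans hpi
    rcases le_total 0 B with h | h
    · left; intro x _; linarith
    · right; intro x _; linarith
  obtain ⟨t, ht⟩ : ∃ t, ∀ x, 2 * A * x + B = 2 * A * (x - t) :=
    ⟨-B / (2 * A), fun x => by field_simp; ring⟩
  have hsgn : ∀ u v : ℝ, (v ≤ t ∨ t ≤ u) → ((∀ x ∈ Set.Icc u v, 0 ≤ 2 * A * x + B) ∨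
      (∀ x ∈ Set.Icc u v, 2 * A * x + B ≤ 0)) := by
    intro u v h
    simp only [ht]
    rcases le_total 0 A with hA' | hA' <;> rcases h with h | h
    · right; intro x hx; nlinarith [hx.2]
    · left; intro x hx; nlinarith [hx.1]
    · left; intro x hx; nlinarith [hx.2]
    · right; intro x hx; nlinarith [hx.1]
  rcases le_or_gt t (-ρ) with h1 | h1
  · exact (key _ _ hle (hsgn _ _ (Or.inr h1))).trans hpi
  rcases le_or_gt ρ t with h2 | h2
  · exact (key _ _ hle (hsgn _ _ (Or.inl h2))).trans hpi
  have hii : ∀ u v : ℝ, IntervalIntegrable (fun x : ℝ => |2 * A * x + B| /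
      ((A * x ^ 2 + B * x + E) ^ 2 + μ ^ 2)) volume u v := fun u v =>
    (hc.abs.div (by fun_prop) hR).intervalIntegrable _ _
  rw [← intervalIntegral.integral_add_adjacent_intervals (hii (-ρ) t) (hii t ρ)]
  have e1 := key _ _ h1.le (hsgn _ _ (Or.inl le_rfl))
  have e2 := key _ _ h2.le (hsgn _ _ (Or.inr le_rfl))
  calc _ ≤ Real.pi / μ + Real.pi / μ := add_le_add e1 e2
    _ = _ := by ring

lemma setIntegral_le_interval {ρ : ℝ} (hρ : 0 ≤ ρ) {S : Set ℝ} (hS : MeasurableSet S)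
    (hSρ : S ⊆ Set.Icc (-ρ) ρ) {w v : ℝ → ℝ} (hw : Continuous w)
    (hv : IntervalIntegrable v volume (-ρ) ρ) (hv0 : ∀ x, 0 ≤ v x) (hwv : ∀ x ∈ S, w x ≤ v x) :
    ∫ x in S, w x ≤ ∫ x in (-ρ)..ρ, v x := by
  have hvI : IntegrableOn v (Set.Icc (-ρ) ρ) :=
    (intervalIntegrable_iff_integrableOn_Icc_of_le (by linarith)).mp hv
  rw [intervalIntegral.integral_of_le (by linarith), ← integral_Icc_eq_integral_Ioc]
  exact (setIntegral_mono_on (hw.integrableOn_Icc.mono_set hSρ) (hvI.mono_set hSρ) hS hwv).trans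
    (setIntegral_mono_set hvI (.of_forall hv0) hSρ.eventuallyLE)

/-- At each point either |N| ≥ ν/2, so the integrand is at most 4μ²/ν², or |N'| ≥ ν/2, so it is at
most 2μ²/ν times |N'|/(N²+μ²), whose integral is already controlled. -/
lemma integral_quadratic_le {A B E μ ρ ν : ℝ} (hμ : 0 < μ) (hρ : 0 ≤ ρ) (hν : 0 < ν)
    {S : Set ℝ} (hS : MeasurableSet S) (hSρ : S ⊆ Set.Icc (-ρ) ρ)
    (h : ∀ x ∈ S, ν ≤ |A * x ^ 2 + B * x + E| + |2 * A * x + B|) :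
    ∫ x in S, μ ^ 2 / ((A * x ^ 2 + B * x + E) ^ 2 + μ ^ 2) ≤
      8 * ρ * μ ^ 2 / ν ^ 2 + 4 * Real.pi * μ / ν := by
  have hc : Continuous fun x : ℝ => 2 * A * x + B := by fun_prop
  have hR : ∀ x : ℝ, (A * x ^ 2 + B * x + E) ^ 2 + μ ^ 2 ≠ 0 := fun x => by positivity
  have i1 : IntervalIntegrable (fun x : ℝ => |2 * A * x + B| /
      ((A * x ^ 2 + B * x + E) ^ 2 + μ ^ 2)) volume (-ρ) ρ :=
    (hc.abs.div (by fun_prop) hR).intervalIntegrable _ _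
  have hq := integral_abs_deriv_quadratic_le (A := A) (B := B) (E := E) hμ hρ
  have hmono := setIntegral_le_interval hρ hS hSρ
    (w := fun x => μ ^ 2 / ((A * x ^ 2 + B * x + E) ^ 2 + μ ^ 2))
    (v := fun x => 4 * μ ^ 2 / ν ^ 2 + 2 * μ ^ 2 / ν * (|2 * A * x + B| /
      ((A * x ^ 2 + B * x + E) ^ 2 + μ ^ 2)))
    (continuous_const.div (by fun_prop) hR)
    (intervalIntegrable_const.add (i1.const_mul _)) (fun x => by positivity) (fun x hx => ?_)
  · rw [intervalIntegral.integral_add intervalIntegrable_const (i1.const_mul _),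
      intervalIntegral.integral_const, intervalIntegral.integral_const_mul, smul_eq_mul] at hmono
    refine hmono.trans ?_
    have := mul_le_mul_of_nonneg_left hq (by positivity : 0 ≤ 2 * μ ^ 2 / ν)
    calc _ ≤ (ρ - -ρ) * (4 * μ ^ 2 / ν ^ 2) + 2 * μ ^ 2 / ν * (2 * Real.pi / μ) := by linarith
      _ = _ := by field_simp; ring
  · have hx' := h x hx
    set N := A * x ^ 2 + B * x + E
    rcases le_total (ν / 2) |N| with h1 | h1
    · have : μ ^ 2 / (N ^ 2 + μ ^ 2) ≤ 4 * μ ^ 2 / ν ^ 2 := by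
        rw [div_le_div_iff₀ (by positivity) (by positivity)]
        have h2 := pow_le_pow_left₀ (by positivity) h1 2
        rw [sq_abs] at h2
        nlinarith [sq_nonneg μ, mul_le_mul_of_nonneg_left h2 (sq_nonneg μ), pow_pos hμ 4]
      have : 0 ≤ 2 * μ ^ 2 / ν * (|2 * A * x + B| / (N ^ 2 + μ ^ 2)) := by positivity
      linarith
    · have h2 : ν / 2 ≤ |2 * A * x + B| := by linarith
      have : μ ^ 2 / (N ^ 2 + μ ^ 2) ≤ 2 * μ ^ 2 / ν * (|2 * A * x + B| / (N ^ 2 + μ ^ 2)) := by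
        rw [mul_div_assoc']
        refine div_le_div_of_nonneg_right ?_ (by positivity)
        rw [div_mul_eq_mul_div, le_div_iff₀ hν]
        nlinarith [mul_le_mul_of_nonneg_left h2 (sq_nonneg μ)]
      have : 0 ≤ 4 * μ ^ 2 / ν ^ 2 := by positivity
      linarith

/-- This covers a possible double zero. The set where |N'| < ν lies in an interval of length ν/|A|
about the vertex, where the integrand is at most 1; elsewhere |N'| ≥ ν gives the second term. -/
lemma integral_quadratic_le_of_leading {A B E μ ρ ν : ℝ} (hμ : 0 < μ) (hρ : 0 ≤ ρ) (hν : 0 < ν)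
    (hA : A ≠ 0) {S : Set ℝ} (hS : MeasurableSet S) (hSρ : S ⊆ Set.Icc (-ρ) ρ) :
    ∫ x in S, μ ^ 2 / ((A * x ^ 2 + B * x + E) ^ 2 + μ ^ 2) ≤
      ν / |A| + 2 * Real.pi * μ / ν := by
  have hc : Continuous fun x : ℝ => 2 * A * x + B := by fun_prop
  have hA' := abs_pos.mpr hA
  have hR : ∀ x : ℝ, (A * x ^ 2 + B * x + E) ^ 2 + μ ^ 2 ≠ 0 := fun x => by positivity
  have i1 : IntervalIntegrable (fun x : ℝ => |2 * A * x + B| /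
      ((A * x ^ 2 + B * x + E) ^ 2 + μ ^ 2)) volume (-ρ) ρ :=
    (hc.abs.div (by fun_prop) hR).intervalIntegrable _ _
  have hq := integral_abs_deriv_quadratic_le (A := A) (B := B) (E := E) hμ hρ
  obtain ⟨t, ht⟩ : ∃ t, ∀ x, 2 * A * x + B = 2 * A * (x - t) :=
    ⟨-B / (2 * A), fun x => by field_simp; ring⟩
  set J := Set.Icc (t - ν / (2 * |A|)) (t + ν / (2 * |A|)) with hJ
  have hJi : Integrable (J.indicator fun _ => (1 : ℝ)) :=
    (integrable_indicator_iff measurableSet_Icc).mpr (integrableOn_const (by simp))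
  have hJv : ∫ x in (-ρ)..ρ, J.indicator (fun _ => (1 : ℝ)) x ≤ ν / |A| := by
    rw [intervalIntegral.integral_of_le (by linarith)]
    refine (setIntegral_le_integral hJi (.of_forall fun x =>
      Set.indicator_nonneg (fun _ _ => zero_le_one) x)).trans ?_
    rw [integral_indicator measurableSet_Icc, setIntegral_const, smul_eq_mul, mul_one,
      Real.volume_real_Icc_of_le (by have : 0 ≤ ν / (2 * |A|) := by positivity
                                     linarith)]
    refine le_of_eq ?_
    field_simp; ring
  have hmono := setIntegral_le_interval hρ hS hSρ
    (w := fun x => μ ^ 2 / ((A * x ^ 2 + B * x + E) ^ 2 + μ ^ 2))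
    (v := fun x => J.indicator (fun _ => (1 : ℝ)) x + μ ^ 2 / ν * (|2 * A * x + B| /
      ((A * x ^ 2 + B * x + E) ^ 2 + μ ^ 2)))
    (continuous_const.div (by fun_prop) hR)
    (hJi.intervalIntegrable.add (i1.const_mul _)) (fun x => add_nonneg
      (Set.indicator_nonneg (fun _ _ => zero_le_one) x) (by positivity)) (fun x hx => ?_)
  · rw [intervalIntegral.integral_add hJi.intervalIntegrable (i1.const_mul _),
      intervalIntegral.integral_const_mul] at hmono
    refine hmono.trans ?_
    have := mul_le_mul_of_nonneg_left hq (by positivity : 0 ≤ μ ^ 2 / ν)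
    calc _ ≤ ν / |A| + μ ^ 2 / ν * (2 * Real.pi / μ) := by linarith
      _ = _ := by field_simp
  · set N := A * x ^ 2 + B * x + E
    by_cases hxJ : x ∈ J
    · rw [Set.indicator_of_mem hxJ]
      have : μ ^ 2 / (N ^ 2 + μ ^ 2) ≤ 1 := by
        rw [div_le_one (by positivity)]; nlinarith [sq_nonneg N]
      have : 0 ≤ μ ^ 2 / ν * (|2 * A * x + B| / (N ^ 2 + μ ^ 2)) := by positivity
      linarith
    · rw [Set.indicator_of_notMem hxJ, zero_add, mul_div_assoc']
      refine div_le_div_of_nonneg_right ?_ (by positivity)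
      have h2 : ν ≤ |2 * A * x + B| := by
        rw [ht, abs_mul, abs_mul, abs_of_pos (zero_lt_two' ℝ)]
        by_contra hcon
        push Not at hcon
        have h3 : |x - t| ≤ ν / (2 * |A|) := by
          rw [le_div_iff₀ (by positivity)]; linarith
        rw [abs_le] at h3
        exact hxJ ⟨by linarith, by linarith⟩
      rw [div_mul_eq_mul_div, le_div_iff₀ hν]
      exact mul_le_mul_of_nonneg_left h2 (sq_nonneg μ)

/-- If |A| is at least a multiple of r³, the previous estimate with ν = r² balances ν/|A| against
r/ν, both of order 1/r. Otherwise B or E dominates, and |N| + |N'| is at least a multiple of r³ on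
the whole bounded set. The exponent 1/3 of the theorem arises here, with r³ in the role of s. -/
lemma integral_quadratic_degenerate {ρ c : ℝ} (hρ : 0 ≤ ρ) (hc : 0 < c) {S : Set ℝ}
    (hS : MeasurableSet S) (hSρ : S ⊆ Set.Icc (-ρ) ρ) : ∃ C, 0 ≤ C ∧
    ∀ r A B E : ℝ, 1 ≤ r → c * r ^ 3 ≤ |A| + |B| + |E| →
      ∫ x in S, r ^ 2 / ((A * x ^ 2 + B * x + E) ^ 2 + r ^ 2) ≤ C / r := by
  set D := 1 + 2 * ρ + 3 * ρ ^ 2 with hD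
  have hD0 : 0 < D := by positivity
  set κ := c / (2 * (1 + ρ)) with hκ
  have hκ0 : 0 < κ := by positivity
  have hpi := Real.pi_pos
  refine ⟨(2 * D / c + 2 * Real.pi) + (8 * ρ / κ ^ 2 + 4 * Real.pi / κ), by positivity, ?_⟩
  intro r A B E hr h
  have hr0 : 0 < r := by linarith
  rw [add_div]
  have p1 : 0 ≤ (2 * D / c + 2 * Real.pi) / r := by positivity
  have p2 : 0 ≤ (8 * ρ / κ ^ 2 + 4 * Real.pi / κ) / r := by positivity
  rcases le_or_gt (c / (2 * D) * r ^ 3) |A| with hA | hA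
  · have hA0 : 0 < |A| := lt_of_lt_of_le (by positivity) hA
    have := integral_quadratic_le_of_leading (B := B) (E := E) hr0 hρ (pow_pos hr0 2)
      (abs_pos.mp hA0) hS hSρ
    have h1 : r ^ 2 / |A| ≤ 2 * D / c / r := by
      rw [div_le_div_iff₀ hA0 hr0, div_mul_eq_mul_div, le_div_iff₀ hc]
      rw [div_mul_eq_mul_div, div_le_iff₀ (by positivity)] at hA
      linarith
    have h2 : 2 * Real.pi * r / r ^ 2 = 2 * Real.pi / r := by field_simp
    rw [h2] at this
    have h3 : (2 * D / c + 2 * Real.pi) / r = 2 * D / c / r + 2 * Real.pi / r := add_div _ _ _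
    linarith
  · have hν : 0 < κ * r ^ 3 := by positivity
    have := integral_quadratic_le (A := A) (B := B) (E := E) hr0 hρ hν hS hSρ (fun x hx' => ?_)
    · have e1 : 8 * ρ * r ^ 2 / (κ * r ^ 3) ^ 2 ≤ 8 * ρ / κ ^ 2 / r := by
        rw [div_div, div_le_div_iff₀ (by positivity) (by positivity)]
        have h1 : r ^ 3 ≤ r ^ 6 := pow_le_pow_right₀ hr (by norm_num)
        have : 0 ≤ 8 * ρ * κ ^ 2 := by positivity
        nlinarith [mul_le_mul_of_nonneg_left h1 this]
      have e2 : 4 * Real.pi * r / (κ * r ^ 3) ≤ 4 * Real.pi / κ / r := by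
        rw [div_div, div_le_div_iff₀ (by positivity) (by positivity)]
        have h1 : r ^ 2 ≤ r ^ 3 := pow_le_pow_right₀ hr (by norm_num)
        have : 0 ≤ 4 * Real.pi * κ := by positivity
        nlinarith [mul_le_mul_of_nonneg_left h1 this]
      have h3 : (8 * ρ / κ ^ 2 + 4 * Real.pi / κ) / r = 8 * ρ / κ ^ 2 / r + 4 * Real.pi / κ / r :=
        add_div _ _ _
      linarith
    · have hx1 : |x| ≤ ρ := abs_le.mpr (hSρ hx')
      have n1 : |B| - 2 * ρ * |A| ≤ |2 * A * x + B| := by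
        have h1 : |B| ≤ |2 * A * x + B| + |2 * A * x| := by
          calc |B| = |(2 * A * x + B) - 2 * A * x| := by ring_nf
            _ ≤ _ := abs_sub _ _
        rw [abs_mul, abs_mul, abs_of_pos (zero_lt_two' ℝ)] at h1
        nlinarith [mul_le_mul_of_nonneg_left hx1 (abs_nonneg A)]
      have n2 : |E| - ρ * |B| - ρ ^ 2 * |A| ≤ |A * x ^ 2 + B * x + E| := by
        have h1 : |E| ≤ |A * x ^ 2 + B * x + E| + |A * x ^ 2| + |B * x| := by
          calc |E| = |((A * x ^ 2 + B * x + E) - A * x ^ 2) - B * x| := by ring_nf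
            _ ≤ |(A * x ^ 2 + B * x + E) - A * x ^ 2| + |B * x| := abs_sub _ _
            _ ≤ _ := by linarith [abs_sub (A * x ^ 2 + B * x + E) (A * x ^ 2)]
        rw [abs_mul, abs_mul, abs_of_nonneg (sq_nonneg x)] at h1
        have h2 : x ^ 2 ≤ ρ ^ 2 := by rw [← sq_abs x]; exact pow_le_pow_left₀ (abs_nonneg _) hx1 2
        nlinarith [mul_le_mul_of_nonneg_left hx1 (abs_nonneg B),
          mul_le_mul_of_nonneg_left h2 (abs_nonneg A)]
      set X := |2 * A * x + B|
      set Y := |A * x ^ 2 + B * x + E|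
      have hY : 0 ≤ Y := abs_nonneg _
      have h4 : c * r ^ 3 - D * |A| ≤ (1 + ρ) * (Y + X) := by
        rw [hD]; nlinarith [mul_le_mul_of_nonneg_left n1 hρ, mul_nonneg hρ hY]
      have h5 : D * |A| ≤ c * r ^ 3 / 2 := by
        have := mul_lt_mul_of_pos_left hA hD0
        have e : D * (c / (2 * D) * r ^ 3) = c * r ^ 3 / 2 := by field_simp
        linarith
      rw [hκ, div_mul_eq_mul_div, div_le_iff₀ (by positivity)]
      linarith

/-! ### The oscillatory integral over the boundary: the second stationary phase -/

lemma hasDerivAt_conj {f : ℝ → ℂ} {f' : ℂ} {x : ℝ} (hf : HasDerivAt f f' x) :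
    HasDerivAt (fun y => (starRingEnd ℂ) (f y)) ((starRingEnd ℂ) f') x :=
  hf.star_conj

lemma hasDerivAt_coefPhase (s lam : ℝ) {a e c d x : ℝ} (hp : a * x + e ≠ 0)
    (hq : c * x + d ≠ 0) :
    HasDerivAt (fun ξ => coefPhase s lam (a * ξ + e) (c * ξ + d))
      (coefPhase s lam (a * x + e) (c * x + d) *
        (((-s * (a / (a * x + e) + c / (c * x + d)) +
          lam * (a / (a * x + e) - c / (c * x + d)) : ℝ) : ℂ) * Complex.I)) x := by
  have hlin : ∀ u v : ℝ, HasDerivAt (fun ξ : ℝ => u * ξ + v) u x := fun u v => by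
    simpa using ((hasDerivAt_id x).const_mul u).add_const v
  have hlp := (hlin a e).log hp
  have hlq := (hlin c d).log hq
  have h := ((((hlp.const_add (Real.log 2)).add hlq).const_mul (-s)).add
    ((hlp.sub hlq).const_mul lam)).ofReal_comp.mul_const Complex.I
  exact h.cexp

lemma measurable_coefPhase (s lam a e c d : ℝ) :
    Measurable fun ξ : ℝ => coefPhase s lam (a * ξ + e) (c * ξ + d) := by
  unfold coefPhase
  fun_prop

/-- The set of `x` with `ρ⁻¹ ≤ |x| ≤ ρ`. -/
def annulus (ρ : ℝ) : Set ℝ := {x | ρ⁻¹ ≤ |x| ∧ |x| ≤ ρ}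

lemma measurableSet_annulus (ρ : ℝ) : MeasurableSet (annulus ρ) :=
  (measurableSet_le measurable_const measurable_norm).inter
    (measurableSet_le measurable_norm measurable_const)

lemma annulus_subset (ρ : ℝ) : annulus ρ ⊆ Set.Icc (-ρ) ρ := fun _ hx => abs_le.mp hx.2

/-- The stationary phase bound for the leading term of the pairing. -/
lemma norm_main_integral_le {χ : ℝ → ℝ} {R₀ R K M L : ℝ} (hχ : IsCutoff χ R₀ R K)
    {b₁ b₂ : ℝ → ℂ} (h₁ : IsAmp b₁ M) (h₁' : IsAmp (deriv b₁) M) (h₂ : IsAmp b₂ M)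
    (h₂' : IsAmp (deriv b₂) M) (hL : 1 ≤ L) : ∃ C, 0 ≤ C ∧
    ∀ s lam a e c d μ : ℝ, 0 < s → 0 < μ → |a| ≤ L → |e| ≤ L → |c| ≤ L → |d| ≤ L →
      a * d - e * c = 1 →
      ‖∫ ξ : ℝ, (coefAmp χ b₁ s lam ξ 1 * coefPhase s lam ξ 1) *
        (starRingEnd ℂ) (coefAmp χ b₂ s lam (a * ξ + e) (c * ξ + d) *
          coefPhase s lam (a * ξ + e) (c * ξ + d))‖ ≤
      C / s * ((∫ x in annulus (Real.exp R), μ ^ 2 /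
        (((s + lam) * a * c * x ^ 2 + 2 * lam * e * c * x + -((s - lam) * e * d)) ^ 2 + μ ^ 2)) +
        1 / μ) := by
  have hL0 : 0 ≤ L := by linarith
  obtain ⟨C₁, hC₁, H₁⟩ := coefAmp_bounds hχ h₁ h₁' hL0
  obtain ⟨C₂, hC₂, H₂⟩ := coefAmp_bounds hχ h₂ h₂' hL0
  set ρ := Real.exp R with hρ
  have hρ0 : 0 < ρ := Real.exp_pos R
  set S := L * ρ + L with hS
  have hS0 : 0 ≤ S := by positivity
  set Cv := S ^ 2 + 2 * ρ * L * S + 2 * (ρ * S ^ 2) with hCv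
  have hCv0 : 0 ≤ Cv := by positivity
  have hpi := Real.pi_pos
  refine ⟨C₁ * C₂ * (1 + Cv * ρ + ρ * S ^ 2 * (2 * Real.pi)), by positivity, ?_⟩
  intro s lam a e c d μ hs hμ ha he hc hd hdet
  have hsq : 0 < √s := Real.sqrt_pos.mpr hs
  have H₁x := H₁ s lam 1 0 0 1 hs (by simpa using hL) (by simpa using hL0) (by norm_num)
  have H₂x := H₂ s lam a e c d hs ha hc hdet
  have hph₁ : ∀ x : ℝ, x ≠ 0 → HasDerivAt (fun ξ => coefPhase s lam ξ 1)
      (coefPhase s lam x 1 * (((lam - s) / x : ℝ) * Complex.I)) x := by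
    intro x hx
    have := hasDerivAt_coefPhase s lam (a := 1) (e := 0) (c := 0) (d := 1) (x := x) (by simpa)
      (by simp)
    simp only [one_mul, add_zero, zero_mul, zero_add, zero_div, sub_zero] at this
    refine this.congr_deriv ?_
    push_cast; ring
  have hpm₁ : Measurable fun ξ : ℝ => coefPhase s lam ξ 1 := by
    simpa using measurable_coefPhase s lam 1 0 0 1
  have hpm₂ := measurable_coefPhase s lam a e c d
  simp only [one_mul, add_zero, zero_mul, zero_add] at H₁x
  set F₁ : ℝ → ℂ := fun ξ => coefAmp χ b₁ s lam ξ 1 with hF₁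
  set F₂ : ℝ → ℂ := fun ξ => coefAmp χ b₂ s lam (a * ξ + e) (c * ξ + d) with hF₂
  set E₁ : ℝ → ℂ := fun ξ => coefPhase s lam ξ 1 with hE₁
  set E₂ : ℝ → ℂ := fun ξ => coefPhase s lam (a * ξ + e) (c * ξ + d) with hE₂
  have n₁ : ∀ x, ‖F₁ x‖ ≤ C₁ / √s := fun x => (H₁x x).2.1
  have n₂ : ∀ x, ‖F₂ x‖ ≤ C₂ / √s := fun x => (H₂x x).2.1
  have n₁' : ∀ x, ‖deriv F₁ x‖ ≤ C₁ / √s := fun x => (H₁x x).2.2.1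
  have n₂' : ∀ x, ‖deriv F₂ x‖ ≤ C₂ / √s := fun x => (H₂x x).2.2.1
  -- For the first segment q = 1, so τ = log|x| and the cutoff confines x to an annulus about 0.
  have z₁ : ∀ x, (x = 0 ∨ x ∉ annulus ρ) → F₁ x = 0 ∧ deriv F₁ x = 0 := by
    intro x hx
    refine (H₁x x).2.2.2 ?_
    rcases eq_or_ne x 0 with h0 | h0
    · left; simp [h0]
    right
    have hxp := abs_pos.mpr h0
    rw [Real.log_one, sub_zero, ← Real.log_abs]
    by_contra hcon
    push Not at hcon
    rw [abs_lt] at hcon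
    refine hx.resolve_left h0 ⟨?_, ?_⟩
    · rw [hρ, ← Real.exp_neg, ← Real.le_log_iff_exp_le hxp]; exact hcon.1.le
    · rw [hρ, ← Real.log_le_iff_le_exp hxp]; exact hcon.2.le
  have z₂ : ∀ x, (a * x + e) * (c * x + d) = 0 → F₂ x = 0 ∧ deriv F₂ x = 0 :=
    fun x hx => (H₂x x).2.2.2 (Or.inl hx)
  have d₁ : ∀ x, HasDerivAt F₁ (deriv F₁ x) x := fun x => (H₁x x).1
  have d₂ : ∀ x, HasDerivAt F₂ (deriv F₂ x) x := fun x => (H₂x x).1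
  have c₁ : Continuous F₁ := continuous_iff_continuousAt.mpr fun x => (d₁ x).continuousAt
  have c₂ : Continuous F₂ := continuous_iff_continuousAt.mpr fun x => (d₂ x).continuousAt
  -- Multiplication by this cubic clears the denominators x, ax+e and cx+d of the phase derivative.
  -- At its zeros one of the amplitudes vanishes identically nearby, so nothing is lost.
  set D : ℝ → ℝ := fun x => x * ((a * x + e) * (c * x + d)) with hD
  set D' : ℝ → ℝ := fun x => (a * x + e) * (c * x + d) +
    x * (a * (c * x + d) + (a * x + e) * c) with hD'
  have dD : ∀ x, HasDerivAt D (D' x) x := by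
    intro x
    have hlin : ∀ u v : ℝ, HasDerivAt (fun ξ : ℝ => u * ξ + v) u x := fun u v => by
      simpa using ((hasDerivAt_id x).const_mul u).add_const v
    refine ((hasDerivAt_id x).mul ((hlin a e).mul (hlin c d))).congr_deriv ?_
    simp [hD']
  set N : ℝ → ℝ := fun x => (s + lam) * a * c * x ^ 2 + 2 * lam * e * c * x +
    -((s - lam) * e * d) with hN
  set f : ℝ → ℂ := fun x => (F₁ x * (starRingEnd ℂ) (F₂ x)) * (E₁ x * (starRingEnd ℂ) (E₂ x))
    with hf
  set U : ℝ → ℂ := fun x => D x * f x with hU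
  set V : ℝ → ℂ := fun x => (D' x * (F₁ x * (starRingEnd ℂ) (F₂ x)) +
    D x * (deriv F₁ x * (starRingEnd ℂ) (F₂ x) + F₁ x * (starRingEnd ℂ) (deriv F₂ x))) *
    (E₁ x * (starRingEnd ℂ) (E₂ x)) with hV
  have hEn : ∀ x, ‖E₁ x * (starRingEnd ℂ) (E₂ x)‖ = 1 := fun x => by
    rw [norm_mul, RCLike.norm_conj, hE₁, hE₂, norm_coefPhase, norm_coefPhase, one_mul]
  have hfe : (fun ξ : ℝ => (coefAmp χ b₁ s lam ξ 1 * coefPhase s lam ξ 1) *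
        (starRingEnd ℂ) (coefAmp χ b₂ s lam (a * ξ + e) (c * ξ + d) *
          coefPhase s lam (a * ξ + e) (c * ξ + d))) = f := by
    ext ξ
    simp only [hf, hF₁, hF₂, hE₁, hE₂, map_mul]
    ring
  rw [hfe]
  have hconj : Measurable (starRingEnd ℂ : ℂ → ℂ) := Complex.continuous_conj.measurable
  have hfm : Measurable f := (c₁.measurable.mul (hconj.comp c₂.measurable)).mul
    (hpm₁.mul (hconj.comp hpm₂))
  have hDc : Continuous D := by fun_prop
  have hDc' : Continuous D' := by fun_prop
  have hVm : Measurable V :=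
    (((Complex.measurable_ofReal.comp hDc'.measurable).mul
      (c₁.measurable.mul (hconj.comp c₂.measurable))).add
      ((Complex.measurable_ofReal.comp hDc.measurable).mul
      (((measurable_deriv F₁).mul (hconj.comp c₂.measurable)).add
        (c₁.measurable.mul (hconj.comp (measurable_deriv F₂)))))).mul
      (hpm₁.mul (hconj.comp hpm₂))
  have hUd : ∀ x, HasDerivAt U (V x + Complex.I * N x * f x) x := by
    intro x
    have hP := (d₁ x).mul (hasDerivAt_conj (d₂ x))
    by_cases hD0 : D x = 0
    · have hzero : F₁ x * (starRingEnd ℂ) (F₂ x) = 0 ∧ deriv F₁ x * (starRingEnd ℂ) (F₂ x) +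
          F₁ x * (starRingEnd ℂ) (deriv F₂ x) = 0 := by
        rcases mul_eq_zero.mp hD0 with h | h
        · obtain ⟨u, v⟩ := z₁ x (Or.inl h); simp [u, v]
        · obtain ⟨u, v⟩ := z₂ x h; simp [u, v]
      have hf0 : f x = 0 := by simp only [hf]; rw [hzero.1, zero_mul]
      have hV0 : V x = 0 := by simp only [hV]; rw [hzero.1, hzero.2]; simp
      rw [hf0, hV0, mul_zero, add_zero]
      have hev : U =ᶠ[nhds x] fun _ => 0 := by
        rcases mul_eq_zero.mp hD0 with h | h
        · have := eventually_coefAmp_eq_zero hχ b₁ s lam (p := fun ξ => ξ) (q := fun _ => 1)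
            (x := x) (by fun_prop) (by fun_prop) (by simp [h]) (by simp)
          filter_upwards [this] with y hy
          simp only [hU, hf, hF₁]
          rw [hy]; simp
        · have hnz : a * x + e ≠ 0 ∨ c * x + d ≠ 0 := by
            by_contra hcon
            push Not at hcon
            have : a * (c * x + d) - c * (a * x + e) = 1 := by linear_combination hdet
            rw [hcon.1, hcon.2] at this
            simp at this
          have := eventually_coefAmp_eq_zero hχ b₂ s lam (p := fun ξ => a * ξ + e)
            (q := fun ξ => c * ξ + d) (x := x) (by fun_prop) (by fun_prop) h hnz
          filter_upwards [this] with y hy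
          simp only [hU, hf, hF₂]
          rw [hy]; simp
      exact (hasDerivAt_const x (0 : ℂ)).congr_of_eventuallyEq hev
    · have hx0 : x ≠ 0 := left_ne_zero_of_mul hD0
      have hpq := right_ne_zero_of_mul hD0
      have hp := left_ne_zero_of_mul hpq
      have hq := right_ne_zero_of_mul hpq
      have hE := (hph₁ x hx0).mul (hasDerivAt_conj (hasDerivAt_coefPhase s lam hp hq))
      have h := (dD x).ofReal_comp.mul (hP.mul hE)
      refine h.congr_deriv ?_
      -- The cubic terms are absent: after clearing denominators the phase derivative is the
      -- quadratic polynomial `N`, the linear coefficient being simplified by ad - ec = 1 only in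
      -- normalised applications; as written it is an identity in all parameters.
      have hph : D x * ((lam - s) / x - (-s * (a / (a * x + e) + c / (c * x + d)) +
          lam * (a / (a * x + e) - c / (c * x + d)))) = N x := by
        have aux : ∀ p q : ℝ, p ≠ 0 → q ≠ 0 → x * (p * q) * ((lam - s) / x -
            (-s * (a / p + c / q) + lam * (a / p - c / q))) =
            (lam - s) * p * q - x * ((lam - s) * a * q - (lam + s) * c * p) := by
          intro p q hp hq
          field_simp
          ring
        simp only [hD, hN]
        rw [aux _ _ hp hq]
        ring
      have hphC := congrArg (fun r : ℝ => (r : ℂ)) hph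
      simp only [Complex.ofReal_mul, Complex.ofReal_sub] at hphC
      rw [← hphC]
      simp only [hV, hf, hE₁, hE₂, Pi.mul_apply, map_mul, Complex.conj_I, Complex.conj_ofReal]
      ring
  have hNd : ∀ x, HasDerivAt N (2 * ((s + lam) * a * c) * x + 2 * lam * e * c) x :=
    hasDerivAt_quadratic _ _ _
  have hoff : ∀ x, x ∉ annulus ρ → f x = 0 ∧ U x = 0 ∧ V x = 0 := by
    intro x hx
    obtain ⟨u, v⟩ := z₁ x (Or.inr hx)
    refine ⟨?_, ?_, ?_⟩
    · simp [hf, u]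
    · simp [hU, hf, u]
    · simp [hV, u, v]
  have hCs : C₁ / √s * (C₂ / √s) = C₁ * C₂ / s := by
    rw [div_mul_div_comm, Real.mul_self_sqrt hs.le]
  have hprod : ∀ u v : ℂ, ‖u‖ ≤ C₁ / √s → ‖v‖ ≤ C₂ / √s →
      ‖u * (starRingEnd ℂ) v‖ ≤ C₁ * C₂ / s := by
    intro u v hu hv
    rw [norm_mul, RCLike.norm_conj, ← hCs]
    exact mul_le_mul hu hv (norm_nonneg _) (by positivity)
  have hCC : 0 ≤ C₁ * C₂ / s := by positivity
  have hfb : ∀ x, ‖f x‖ ≤ C₁ * C₂ / s := fun x => by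
    simp only [hf]
    rw [norm_mul, hEn, mul_one]
    exact hprod _ _ (n₁ x) (n₂ x)
  have hlinb : ∀ u v x : ℝ, |u| ≤ L → |v| ≤ L → |x| ≤ ρ → |u * x + v| ≤ S := by
    intro u v x hu hv hx
    refine (abs_add_le _ _).trans ?_
    rw [abs_mul]
    exact add_le_add (mul_le_mul hu hx (abs_nonneg _) hL0) hv
  have hDb : ∀ x ∈ Set.Icc (-ρ) ρ, |D x| ≤ ρ * S ^ 2 := by
    intro x hx
    have hx' : |x| ≤ ρ := abs_le.mpr hx
    simp only [hD]
    rw [abs_mul, abs_mul, sq]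
    exact mul_le_mul hx' (mul_le_mul (hlinb _ _ _ ha he hx') (hlinb _ _ _ hc hd hx')
      (abs_nonneg _) hS0) (by positivity) hρ0.le
  have hDb' : ∀ x ∈ Set.Icc (-ρ) ρ, |D' x| ≤ S ^ 2 + 2 * ρ * L * S := by
    intro x hx
    have hx' : |x| ≤ ρ := abs_le.mpr hx
    have e1 := hlinb _ _ _ ha he hx'
    have e2 := hlinb _ _ _ hc hd hx'
    simp only [hD']
    refine (abs_add_le _ _).trans (add_le_add ?_ ?_)
    · rw [abs_mul, sq]; exact mul_le_mul e1 e2 (abs_nonneg _) hS0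
    · rw [abs_mul]
      have : |a * (c * x + d) + (a * x + e) * c| ≤ L * S + S * L := by
        refine (abs_add_le _ _).trans ?_
        rw [abs_mul, abs_mul]
        exact add_le_add (mul_le_mul ha e2 (abs_nonneg _) hL0)
          (mul_le_mul e1 hc (abs_nonneg _) hS0)
      calc _ ≤ ρ * (L * S + S * L) := mul_le_mul hx' this (abs_nonneg _) hρ0.le
        _ = _ := by ring
  have main := norm_integral_le_of_phase_Icc (f := f) (U := U) (V := V) (N := N)
    (N' := fun x => 2 * ((s + lam) * a * c) * x + 2 * lam * e * c) (μ := μ) (a := -ρ) (b := ρ)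
    (Af := C₁ * C₂ / s) (Au := ρ * S ^ 2 * (C₁ * C₂ / s)) (Av := Cv * (C₁ * C₂ / s)) hμ
    (by linarith) (measurableSet_annulus ρ) (annulus_subset ρ) hUd hNd (by fun_prop) hfm.aestronglyMeasurable hVm.aestronglyMeasurable
    (fun x hx => (hoff x hx).1) 
    (fun x hx => (hoff x fun h => hx (annulus_subset ρ h)).2.1)
    (fun x hx => (hoff x fun h => hx (annulus_subset ρ h)).2.2)
    (fun x _ => hfb x)
    (fun x hx => by
      simp only [hU]
      rw [norm_mul, Complex.norm_real]
      exact mul_le_mul (hDb x hx) (hfb x) (norm_nonneg _) (by positivity))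
    (fun x hx => by
      simp only [hV]
      rw [norm_mul, hEn, mul_one, hCv, add_mul]
      refine (norm_add_le _ _).trans (add_le_add ?_ ?_)
      · rw [norm_mul, Complex.norm_real]
        exact mul_le_mul (hDb' x hx) (hprod _ _ (n₁ x) (n₂ x)) (norm_nonneg _) (by positivity)
      · rw [norm_mul, Complex.norm_real]
        have : ‖deriv F₁ x * (starRingEnd ℂ) (F₂ x) + F₁ x * (starRingEnd ℂ) (deriv F₂ x)‖ ≤
            2 * (C₁ * C₂ / s) := by
          refine (norm_add_le _ _).trans ?_
          linarith [hprod _ _ (n₁' x) (n₂ x), hprod _ _ (n₁ x) (n₂' x)]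
        calc _ ≤ ρ * S ^ 2 * (2 * (C₁ * C₂ / s)) :=
              mul_le_mul (hDb x hx) this (norm_nonneg _) (by positivity)
          _ = _ := by ring)
  refine main.trans ?_
  have hNc : Continuous N := by fun_prop
  have hR : ∀ x, N x ^ 2 + μ ^ 2 ≠ 0 := fun x => by positivity
  have q1 : ∫ x in (-ρ)..ρ, |N x| / (N x ^ 2 + μ ^ 2) ≤ ρ / μ := by
    have := intervalIntegral.integral_mono_on (by linarith : -ρ ≤ ρ)
      ((hNc.abs.div (by fun_prop) hR).intervalIntegrable _ _)
      (intervalIntegrable_const (c := 1 / (2 * μ)) (μ := volume))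
      (fun u _ => abs_div_sq_add_sq_le (N := N u) hμ)
    rw [intervalIntegral.integral_const, smul_eq_mul] at this
    refine this.trans (le_of_eq ?_)
    field_simp; ring
  have q2 : ∫ x in (-ρ)..ρ, |2 * ((s + lam) * a * c) * x + 2 * lam * e * c| /
      (N x ^ 2 + μ ^ 2) ≤ 2 * Real.pi / μ := integral_abs_deriv_quadratic_le hμ hρ0.le
  have q0 : 0 ≤ ∫ x in annulus ρ, μ ^ 2 / (N x ^ 2 + μ ^ 2) :=
    integral_nonneg fun x => by positivity
  set Q := ∫ x in annulus ρ, μ ^ 2 / (N x ^ 2 + μ ^ 2) with hQ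
  have r1 := mul_le_mul_of_nonneg_left q1 (mul_nonneg hCv0 hCC)
  have r2 := mul_le_mul_of_nonneg_left q2 (mul_nonneg (by positivity : 0 ≤ ρ * S ^ 2) hCC)
  have e3 : C₁ * C₂ * (1 + Cv * ρ + ρ * S ^ 2 * (2 * Real.pi)) / s * (Q + 1 / μ) =
      C₁ * C₂ / s * Q + Cv * (C₁ * C₂ / s) * (ρ / μ) +
      ρ * S ^ 2 * (C₁ * C₂ / s) * (2 * Real.pi / μ) +
      (C₁ * C₂ / s * (1 / μ) + C₁ * C₂ / s * (Cv * ρ + ρ * S ^ 2 * (2 * Real.pi)) * Q) := by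
    field_simp
    ring
  have p3 : 0 ≤ C₁ * C₂ / s * (1 / μ) + C₁ * C₂ / s * (Cv * ρ + ρ * S ^ 2 * (2 * Real.pi)) * Q := by
    positivity
  linarith

/-! ### The pairing of two twisted periods -/

/-- The density `((a ξ + e)² + (c ξ + d)²)⁻¹`. -/
def lineWeight (a e c d ξ : ℝ) : ℝ := ((a * ξ + e) ^ 2 + (c * ξ + d) ^ 2)⁻¹

lemma lineForm_pos {a e c d : ℝ} (hdet : a * d - e * c = 1) (ξ : ℝ) :
    0 < (a * ξ + e) ^ 2 + (c * ξ + d) ^ 2 := by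
  have h : a * (c * ξ + d) - c * (a * ξ + e) = 1 := by linear_combination hdet
  by_contra hcon
  have h1 : (a * ξ + e) ^ 2 = 0 := by nlinarith [sq_nonneg (a * ξ + e), sq_nonneg (c * ξ + d)]
  have h2 : (c * ξ + d) ^ 2 = 0 := by nlinarith [sq_nonneg (a * ξ + e), sq_nonneg (c * ξ + d)]
  rw [pow_eq_zero_iff two_ne_zero] at h1 h2
  rw [h1, h2] at h
  simp at h

/-- Completing the square with ad - ec = 1 gives n((aξ+e)²+(cξ+d)²) = 1 + (nξ+k)², where n = a²+c²
and k = ae+cd. The total mass is therefore independent of the matrix. -/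
lemma lineWeight_integral {a e c d : ℝ} (hdet : a * d - e * c = 1) :
    Integrable (lineWeight a e c d) ∧ ∫ ξ, lineWeight a e c d ξ = Real.pi := by
  set n := a ^ 2 + c ^ 2 with hn
  set k := a * e + c * d with hk
  have hn0 : 0 < n := by
    by_contra hcon
    have h1 : a ^ 2 = 0 := by nlinarith [sq_nonneg a, sq_nonneg c]
    have h2 : c ^ 2 = 0 := by nlinarith [sq_nonneg a, sq_nonneg c]
    rw [pow_eq_zero_iff two_ne_zero] at h1 h2
    rw [h1, h2] at hdet
    simp at hdet
  have e1 : lineWeight a e c d = fun ξ => n * (1 + (n * (ξ + k / n)) ^ 2)⁻¹ := by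
    ext ξ
    have hp := lineForm_pos hdet ξ
    have h2 : 1 + (n * (ξ + k / n)) ^ 2 = n * ((a * ξ + e) ^ 2 + (c * ξ + d) ^ 2) := by
      have : n * (ξ + k / n) = n * ξ + k := by field_simp
      rw [this, hn, hk]
      linear_combination (-(a * d - e * c) - 1) * hdet
    rw [lineWeight, h2]
    field_simp
  rw [e1]
  constructor
  · exact ((integrable_inv_one_add_sq.comp_mul_left' hn0.ne').comp_add_right (k / n)).const_mul n
  · rw [integral_const_mul, integral_add_right_eq_self (fun ξ => (1 + (n * ξ) ^ 2)⁻¹),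
      Measure.integral_comp_mul_left (fun ξ => (1 + ξ ^ 2)⁻¹), integral_univ_inv_one_add_sq,
      smul_eq_mul, abs_of_pos (inv_pos.mpr hn0)]
    field_simp

lemma measurable_halfPow (s : ℝ) : Measurable (halfPow s) := by
  unfold halfPow
  fun_prop

lemma stronglyMeasurable_boundaryCoef {b : ℝ → ℂ} {M : ℝ} (hb : IsAmp b M) (s lam a e c d : ℝ) :
    StronglyMeasurable fun ξ : ℝ => boundaryCoef b s lam (a * ξ + e) (c * ξ + d) := by
  unfold boundaryCoef
  refine StronglyMeasurable.integral_prod_right (f := fun ξ x : ℝ => b x *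
    Complex.exp (((lam * x : ℝ) : ℂ) * Complex.I) * halfPow s (Real.exp x /
      ((a * ξ + e) ^ 2 + Real.exp x ^ 2 * (c * ξ + d) ^ 2))) (Measurable.stronglyMeasurable ?_)
  have hbm : Measurable b := hb.smooth.continuous.measurable
  have hh := measurable_halfPow s
  unfold Function.uncurry
  fun_prop

/-- The pairing of the twisted periods of two geodesic segments. -/
def periodPairing (b : ℝ → ℂ) (s lam a e c d : ℝ) : ℂ :=
  ∫ ξ : ℝ, boundaryCoef b s lam ξ 1 *
    (starRingEnd ℂ) (boundaryCoef (fun x => (starRingEnd ℂ) (b x)) s lam (a * ξ + e) (c * ξ + d))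

lemma sqrt_weight_mul_le {u v : ℝ} (hu : 0 < u) (hv : 0 < v) :
    (√u)⁻¹ * (√v)⁻¹ ≤ u⁻¹ + v⁻¹ := by
  have h1 : ((√u)⁻¹) ^ 2 = u⁻¹ := by rw [inv_pow, Real.sq_sqrt hu.le]
  have h2 : ((√v)⁻¹) ^ 2 = v⁻¹ := by rw [inv_pow, Real.sq_sqrt hv.le]
  nlinarith [sq_nonneg ((√u)⁻¹ - (√v)⁻¹), inv_pos.mpr hu, inv_pos.mpr hv]

lemma pairWeight_integral {a e c d : ℝ} (hdet : a * d - e * c = 1) :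
    Integrable (fun ξ => (ξ ^ 2 + 1 ^ 2)⁻¹ + ((a * ξ + e) ^ 2 + (c * ξ + d) ^ 2)⁻¹) ∧
    ∫ ξ : ℝ, ((ξ ^ 2 + 1 ^ 2)⁻¹ + ((a * ξ + e) ^ 2 + (c * ξ + d) ^ 2)⁻¹) = 2 * Real.pi := by
  obtain ⟨i1, e1⟩ := lineWeight_integral (a := 1) (e := 0) (c := 0) (d := 1) (by norm_num)
  obtain ⟨i2, e2⟩ := lineWeight_integral hdet
  have e3 : (fun ξ : ℝ => (ξ ^ 2 + 1 ^ 2)⁻¹) = lineWeight 1 0 0 1 := by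
    ext ξ; simp [lineWeight]
  have i3 : Integrable fun ξ : ℝ => (ξ ^ 2 + 1 ^ 2)⁻¹ := by rw [e3]; exact i1
  have i4 : Integrable fun ξ : ℝ => ((a * ξ + e) ^ 2 + (c * ξ + d) ^ 2)⁻¹ := i2
  have e4 : ∫ ξ : ℝ, ((a * ξ + e) ^ 2 + (c * ξ + d) ^ 2)⁻¹ = Real.pi := e2
  refine ⟨i3.add i4, ?_⟩
  rw [integral_add i3 i4, e3, e1, e4]
  ring

lemma norm_pair_le {b : ℝ → ℂ} {M : ℝ} (hb : IsAmp b M) (s lam : ℝ) {a e c d : ℝ}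
    (hdet : a * d - e * c = 1) (ξ : ℝ) :
    ‖boundaryCoef b s lam ξ 1 * (starRingEnd ℂ) (boundaryCoef (fun x => (starRingEnd ℂ) (b x))
      s lam (a * ξ + e) (c * ξ + d))‖ ≤ (M * √(Real.exp 1)) ^ 2 *
      ((ξ ^ 2 + 1 ^ 2)⁻¹ + ((a * ξ + e) ^ 2 + (c * ξ + d) ^ 2)⁻¹) := by
  have hM := hb.nonneg
  have h0 : 0 < ξ ^ 2 + (1 : ℝ) ^ 2 := by positivity
  have h1 := norm_boundaryCoef_le hb s lam h0
  have h2 := norm_boundaryCoef_le hb.star s lam (lineForm_pos hdet ξ)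
  rw [norm_mul, RCLike.norm_conj]
  refine (mul_le_mul h1 h2 (norm_nonneg _) (by positivity)).trans ?_
  calc _ = (M * √(Real.exp 1)) ^ 2 * ((√(ξ ^ 2 + 1 ^ 2))⁻¹ *
        (√((a * ξ + e) ^ 2 + (c * ξ + d) ^ 2))⁻¹) := by ring
    _ ≤ _ := mul_le_mul_of_nonneg_left (sqrt_weight_mul_le h0 (lineForm_pos hdet ξ)) (by positivity)

/-- This trivial bound, uniform in s and λ, serves for spectral parameters far from t and for
bounded t. -/
lemma norm_periodPairing_le {b : ℝ → ℂ} {M : ℝ} (hb : IsAmp b M) (s lam : ℝ) {a e c d : ℝ}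
    (hdet : a * d - e * c = 1) :
    ‖periodPairing b s lam a e c d‖ ≤ (M * √(Real.exp 1)) ^ 2 * (2 * Real.pi) := by
  obtain ⟨i, h⟩ := pairWeight_integral hdet
  rw [← h, ← integral_const_mul]
  exact norm_integral_le_of_norm_le (i.const_mul _) (.of_forall (norm_pair_le hb s lam hdet))

lemma ae_linear_ne_zero {a e : ℝ} (h : a ≠ 0 ∨ e ≠ 0) : ∀ᵐ ξ : ℝ, a * ξ + e ≠ 0 := by
  rcases eq_or_ne a 0 with ha | ha
  · refine .of_forall fun ξ => ?_
    rw [ha, zero_mul, zero_add]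
    exact h.resolve_left (not_not.mpr ha)
  · refine Set.Countable.ae_notMem (s := {ξ : ℝ | a * ξ + e = 0}) ?_ volume
    refine (Set.countable_singleton (-e / a)).mono fun ξ hξ => ?_
    have hξ' : a * ξ + e = 0 := hξ
    rw [Set.mem_singleton_iff, eq_div_iff ha]
    linarith

/-- The pairing, up to the remainder of the leading term. -/
lemma norm_periodPairing_le_of_phase {b : ℝ → ℂ} {M δ L : ℝ} (hb : IsAmp b M)
    (hb' : IsAmp (deriv b) M) (hδ : 0 < δ) (hL : 1 ≤ L) : ∃ C ρ, 0 ≤ C ∧ 0 < ρ ∧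
    ∀ s lam a e c d μ : ℝ, 1 ≤ s → |lam| ≤ (1 - δ) * s → 0 < μ → |a| ≤ L → |e| ≤ L → |c| ≤ L →
      |d| ≤ L → a * d - e * c = 1 →
      ‖periodPairing b s lam a e c d‖ ≤ C / s * ((∫ x in annulus ρ, μ ^ 2 /
        (((s + lam) * a * c * x ^ 2 + 2 * lam * e * c * x + -((s - lam) * e * d)) ^ 2 + μ ^ 2)) +
        1 / μ + 1 / √s) := by
  obtain ⟨χ, K, hχ⟩ := exists_isCutoff (R₀ := 2 / δ + 1) (by positivity)
  set R := 2 / δ + 1 + 2 with hR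
  have hbs := hb.star
  have hbs' : IsAmp (deriv fun x => (starRingEnd ℂ) (b x)) M := by
    have : (deriv fun x => (starRingEnd ℂ) (b x)) = fun x => (starRingEnd ℂ) (deriv b x) := by
      ext x; exact (hasDerivAt_conj (hb.hasDerivAt x)).deriv
    rw [this]; exact hb'.star
  obtain ⟨C₀, hC₀, H₀⟩ := norm_main_integral_le hχ hb hb' hbs hbs' hL
  obtain ⟨C₁, hC₁, H₁⟩ := coef_remainder hχ hb hδ
  obtain ⟨C₂, hC₂, H₂⟩ := coef_remainder hχ hbs hδ
  have hpi := Real.pi_pos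
  refine ⟨C₀ + 2 * C₁ * C₂ * (2 * Real.pi), Real.exp R, by positivity, Real.exp_pos _, ?_⟩
  intro s lam a e c d μ hs hlam hμ ha he hc hd hdet
  have hs0 : 0 < s := by linarith
  have hsq : 0 < √s := Real.sqrt_pos.mpr hs0
  have hne1 : a ≠ 0 ∨ e ≠ 0 := by
    by_contra hcon; push Not at hcon; rw [hcon.1, hcon.2] at hdet; simp at hdet
  have hne2 : c ≠ 0 ∨ d ≠ 0 := by
    by_contra hcon; push Not at hcon; rw [hcon.1, hcon.2] at hdet; simp at hdet
  have hxne : ∀ᵐ ξ : ℝ, ξ ≠ 0 := by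
    simpa using ae_linear_ne_zero (a := 1) (e := 0) (by simp)
  obtain ⟨iw, ew⟩ := pairWeight_integral hdet
  set w : ℝ → ℝ := fun ξ => (ξ ^ 2 + 1 ^ 2)⁻¹ + ((a * ξ + e) ^ 2 + (c * ξ + d) ^ 2)⁻¹ with hw
  set A₁ : ℝ → ℂ := fun ξ => boundaryCoef b s lam ξ 1 with hA₁
  set A₂ : ℝ → ℂ := fun ξ => boundaryCoef (fun x => (starRingEnd ℂ) (b x)) s lam
    (a * ξ + e) (c * ξ + d) with hA₂
  set M₁ : ℝ → ℂ := fun ξ => coefAmp χ b s lam ξ 1 * coefPhase s lam ξ 1 with hM₁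
  set M₂ : ℝ → ℂ := fun ξ => coefAmp χ (fun x => (starRingEnd ℂ) (b x)) s lam
    (a * ξ + e) (c * ξ + d) * coefPhase s lam (a * ξ + e) (c * ξ + d) with hM₂
  have iA : Integrable fun ξ => A₁ ξ * (starRingEnd ℂ) (A₂ ξ) := by
    refine (iw.const_mul _).mono' ?_ (.of_forall (norm_pair_le hb s lam hdet))
    refine AEStronglyMeasurable.mul ?_ ?_
    · have := (stronglyMeasurable_boundaryCoef hb s lam 1 0 0 1).aestronglyMeasurable
        (μ := volume)
      simpa using this
    · exact Complex.continuous_conj.comp_aestronglyMeasurable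
        (stronglyMeasurable_boundaryCoef hbs s lam a e c d).aestronglyMeasurable
  -- The difference of products is split so that each term has one remainder, O(1/s), and one factor
  -- O(s^(-1/2)). Total size s^(-3/2) times an integrable weight accounts for the term 1/√s in the
  -- bound.
  have hdiff : ∀ᵐ ξ : ℝ, ‖A₁ ξ * (starRingEnd ℂ) (A₂ ξ) - M₁ ξ * (starRingEnd ℂ) (M₂ ξ)‖ ≤
      2 * C₁ * C₂ * (s⁻¹ * (√s)⁻¹) * w ξ := by
    filter_upwards [hxne, ae_linear_ne_zero hne1, ae_linear_ne_zero hne2] with ξ h1 h2 h3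
    obtain ⟨r1, m1, a1⟩ := H₁ s lam ξ 1 hs hlam h1 one_ne_zero
    obtain ⟨r2, m2, a2⟩ := H₂ s lam _ _ hs hlam h2 h3
    have e1 : A₁ ξ * (starRingEnd ℂ) (A₂ ξ) - M₁ ξ * (starRingEnd ℂ) (M₂ ξ) =
        (A₁ ξ - M₁ ξ) * (starRingEnd ℂ) (A₂ ξ) + M₁ ξ * (starRingEnd ℂ) (A₂ ξ - M₂ ξ) := by
      rw [map_sub]; ring
    have hsw := sqrt_weight_mul_le (by positivity : 0 < ξ ^ 2 + (1 : ℝ) ^ 2) (lineForm_pos hdet ξ)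
    rw [e1]
    refine (norm_add_le _ _).trans ?_
    rw [norm_mul, norm_mul, RCLike.norm_conj, RCLike.norm_conj]
    refine (add_le_add (mul_le_mul r1 a2 (norm_nonneg _) (by positivity))
      (mul_le_mul m1 r2 (norm_nonneg _) (by positivity))).trans ?_
    calc _ = 2 * C₁ * C₂ * (s⁻¹ * (√s)⁻¹) * ((√(ξ ^ 2 + 1 ^ 2))⁻¹ *
          (√((a * ξ + e) ^ 2 + (c * ξ + d) ^ 2))⁻¹) := by ring
      _ ≤ _ := mul_le_mul_of_nonneg_left hsw (by positivity)
  have hmain := H₀ s lam a e c d μ hs0 hμ ha he hc hd hdet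
  have hint := integral_add (f := fun ξ => A₁ ξ * (starRingEnd ℂ) (A₂ ξ) -
    M₁ ξ * (starRingEnd ℂ) (M₂ ξ)) (g := fun ξ => M₁ ξ * (starRingEnd ℂ) (M₂ ξ)) (μ := volume)
  have hMm : AEStronglyMeasurable (fun ξ => M₁ ξ * (starRingEnd ℂ) (M₂ ξ)) := by
    obtain ⟨_, _, B₁⟩ := coefAmp_bounds hχ hb hb' (L := L) (by linarith)
    obtain ⟨_, _, B₂⟩ := coefAmp_bounds hχ hbs hbs' (L := L) (by linarith)
    have c1 : Continuous fun ξ => coefAmp χ b s lam (1 * ξ + 0) (0 * ξ + 1) :=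
      continuous_iff_continuousAt.mpr fun x => (B₁ s lam 1 0 0 1 hs0 (by simpa using hL)
        (by simp; linarith) (by norm_num) x).1.continuousAt
    have c2 : Continuous fun ξ => coefAmp χ (fun x => (starRingEnd ℂ) (b x)) s lam
        (a * ξ + e) (c * ξ + d) :=
      continuous_iff_continuousAt.mpr fun x => (B₂ s lam a e c d hs0 ha hc hdet x).1.continuousAt
    have p1 := measurable_coefPhase s lam 1 0 0 1
    have p2 := measurable_coefPhase s lam a e c d
    simp only [one_mul, add_zero, zero_mul, zero_add] at c1 p1
    exact ((c1.measurable.mul p1).mul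
      (Complex.continuous_conj.measurable.comp (c2.measurable.mul p2))).aestronglyMeasurable
  have iD : Integrable fun ξ => A₁ ξ * (starRingEnd ℂ) (A₂ ξ) - M₁ ξ * (starRingEnd ℂ) (M₂ ξ) :=
    (iw.const_mul _).mono' (iA.aestronglyMeasurable.sub hMm) hdiff
  have iM : Integrable fun ξ => M₁ ξ * (starRingEnd ℂ) (M₂ ξ) := by
    refine (iA.sub iD).congr (.of_forall fun ξ => ?_)
    simp
  have hD := norm_integral_le_of_norm_le (iw.const_mul _) hdiff
  rw [integral_const_mul, ew] at hD
  have hsum := hint iD iM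
  simp only [sub_add_cancel] at hsum
  have hdef : periodPairing b s lam a e c d = ∫ ξ, A₁ ξ * (starRingEnd ℂ) (A₂ ξ) := rfl
  rw [hdef, hsum]
  refine (norm_add_le _ _).trans ((add_le_add hD hmain).trans ?_)
  have hQ0 : 0 ≤ ∫ x in annulus (Real.exp R), μ ^ 2 / (((s + lam) * a * c * x ^ 2 +
      2 * lam * e * c * x + -((s - lam) * e * d)) ^ 2 + μ ^ 2) :=
    integral_nonneg fun x => by positivity
  set Q := ∫ x in annulus (Real.exp R), μ ^ 2 / (((s + lam) * a * c * x ^ 2 +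
      2 * lam * e * c * x + -((s - lam) * e * d)) ^ 2 + μ ^ 2)
  have : (C₀ + 2 * C₁ * C₂ * (2 * Real.pi)) / s * (Q + 1 / μ + 1 / √s) =
    2 * C₁ * C₂ * (s⁻¹ * (√s)⁻¹) * (2 * Real.pi) + C₀ / s * (Q + 1 / μ) +
    (C₀ / s * (1 / √s) + 2 * C₁ * C₂ * (2 * Real.pi) / s * (Q + 1 / μ)) := by
      field_simp
      ring
  have p : 0 ≤ C₀ / s * (1 / √s) + 2 * C₁ * C₂ * (2 * Real.pi) / s * (Q + 1 / μ) := by positivity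
  linarith

/-! ### Degeneracy of the quadratic phase in terms of the coefficients -/

/-- Adding T = (K+1)/β times the second inequality to the first absorbs the negative term -Kv. -/
lemma nondegenerate_of_le {X Y u v s α β K : ℝ} (hs : 0 ≤ s) (hv : 0 ≤ v)
    (hα1 : α ≤ 1) (hβ : 0 < β) (hK : 0 ≤ K) (hX0 : 0 ≤ X) (hY0 : 0 ≤ Y)
    (hX : s * (α * u - K * v) ≤ X) (hY : s * (β * v) ≤ Y) :
    α / (1 + (K + 1) / β) * s * (u + v) ≤ X + Y := by
  set T := (K + 1) / β with hT
  have hT0 : 0 < T := by positivity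
  rw [div_mul_eq_mul_div, div_mul_eq_mul_div, div_le_iff₀ (by positivity)]
  have h1 : T * (s * (β * v)) = s * ((K + 1) * v) := by rw [hT]; field_simp
  have h2 := mul_le_mul_of_nonneg_left hY hT0.le
  rw [h1] at h2
  have h3 : α * (s * v) ≤ s * v := mul_le_of_le_one_left (mul_nonneg hs hv) hα1
  nlinarith [mul_nonneg hT0.le hX0]

/-- The upper bound on |x| lets a large constant term dominate the value; the lower bound lets a
large leading coefficient dominate the derivative. The latter is why x is kept away from 0. -/
lemma annulus_bounds {ρ x : ℝ} (hx : x ∈ annulus ρ) (A B E : ℝ) :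
    |E| - |A| * ρ ^ 2 - |B| * ρ ≤ |A * x ^ 2 + B * x + E| ∧
    2 * |A| * ρ⁻¹ - |B| ≤ |2 * A * x + B| := by
  obtain ⟨h1, h2⟩ := hx
  constructor
  · have h3 : |E| ≤ |A * x ^ 2 + B * x + E| + |A * x ^ 2| + |B * x| := by
      calc |E| = |((A * x ^ 2 + B * x + E) - A * x ^ 2) - B * x| := by ring_nf
        _ ≤ |(A * x ^ 2 + B * x + E) - A * x ^ 2| + |B * x| := abs_sub _ _
        _ ≤ _ := by linarith [abs_sub (A * x ^ 2 + B * x + E) (A * x ^ 2)]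
    rw [abs_mul, abs_mul, abs_of_nonneg (sq_nonneg x)] at h3
    have h4 : x ^ 2 ≤ ρ ^ 2 := by rw [← sq_abs x]; exact pow_le_pow_left₀ (abs_nonneg _) h2 2
    linarith [mul_le_mul_of_nonneg_left h2 (abs_nonneg B),
      mul_le_mul_of_nonneg_left h4 (abs_nonneg A)]
  · have h3 : |2 * A * x| ≤ |2 * A * x + B| + |B| := by
      calc |2 * A * x| = |(2 * A * x + B) - B| := by ring_nf
        _ ≤ _ := abs_sub _ _
    rw [abs_mul, abs_mul, abs_of_pos (zero_lt_two' ℝ)] at h3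
    linarith [mul_le_mul_of_nonneg_left h1 (abs_nonneg A)]

lemma inv_sqrt_one_add_le {y : ℝ} (hy : 1 ≤ y) : (√y)⁻¹ ≤ 2 * (√(1 + y))⁻¹ := by
  have h1 : 0 < √y := Real.sqrt_pos.mpr (by linarith)
  have h2 : 0 < √(1 + y) := Real.sqrt_pos.mpr (by linarith)
  have h3 : √(1 + y) ≤ 2 * √y := by
    rw [Real.sqrt_le_left (by positivity), mul_pow, Real.sq_sqrt (by linarith)]; linarith
  rw [← div_eq_mul_inv, inv_eq_one_div, div_le_div_iff₀ h1 h2]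
  linarith

/-- With |N| + |N'| of order at least sm, the choice μ = √(sm) makes the integral and 1/μ both
O((sm)^(-1/2)). When sm < 1 the claim is trivial and μ = 1 suffices; m ≤ m₁ absorbs the term 1/√s.
-/
lemma phase_nondegenerate {ρ c m₁ : ℝ} (hρ : 0 < ρ) (hc : 0 < c) (hm₁ : 0 ≤ m₁) : ∃ C, 0 ≤ C ∧
    ∀ s m A B E : ℝ, 1 ≤ s → 0 ≤ m → m ≤ m₁ →
      (∀ x ∈ annulus ρ, c * s * m ≤ |A * x ^ 2 + B * x + E| + |2 * A * x + B|) →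
      ∃ μ, 0 < μ ∧ (∫ x in annulus ρ, μ ^ 2 / ((A * x ^ 2 + B * x + E) ^ 2 + μ ^ 2)) +
        1 / μ + 1 / √s ≤ C * (√(1 + s * m))⁻¹ := by
  have hpi := Real.pi_pos
  refine ⟨(8 * ρ / c ^ 2 + 4 * Real.pi / c + 1) * 2 + 2 * (2 * ρ + 1) + √(1 + m₁),
    by positivity, ?_⟩
  intro s m A B E hs hm hm1 h
  have hs0 : 0 < s := by linarith
  have hy0 : 0 ≤ s * m := by positivity
  have hw : 0 < √(1 + s * m) := Real.sqrt_pos.mpr (by linarith)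
  have h3 : 1 / √s ≤ √(1 + m₁) * (√(1 + s * m))⁻¹ := by
    rw [← div_eq_mul_inv, div_le_div_iff₀ (Real.sqrt_pos.mpr hs0) hw, one_mul,
      ← Real.sqrt_mul (by linarith)]
    exact Real.sqrt_le_sqrt (by nlinarith)
  rcases le_or_gt 1 (s * m) with h1 | h1
  · have hy : 0 < s * m := by linarith
    have hμ : 0 < √(s * m) := Real.sqrt_pos.mpr hy
    refine ⟨√(s * m), hμ, ?_⟩
    have hQ := integral_quadratic_le (A := A) (B := B) (E := E) (μ := √(s * m)) (ρ := ρ)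
      (ν := c * s * m) hμ hρ.le (by rw [mul_assoc]; positivity) (measurableSet_annulus ρ)
      (annulus_subset ρ) h
    have h4 := inv_sqrt_one_add_le h1
    have hμ1 : 1 ≤ √(s * m) := Real.one_le_sqrt.mpr h1
    have e1 : 8 * ρ * √(s * m) ^ 2 / (c * s * m) ^ 2 + 4 * Real.pi * √(s * m) / (c * s * m) ≤
        (8 * ρ / c ^ 2 + 4 * Real.pi / c) * (√(s * m))⁻¹ := by
      have e2 : c * s * m = c * √(s * m) ^ 2 := by rw [Real.sq_sqrt hy0, mul_assoc]
      rw [e2]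
      generalize √(s * m) = μ at hμ hμ1 ⊢
      rw [add_mul]
      refine add_le_add ?_ (le_of_eq ?_)
      · rw [← div_eq_mul_inv, div_div, div_le_div_iff₀ (by positivity) (by positivity)]
        have : μ ^ 3 ≤ μ ^ 4 := pow_le_pow_right₀ hμ1 (by norm_num)
        have h5 : 0 ≤ 8 * ρ * c ^ 2 := by positivity
        nlinarith [mul_le_mul_of_nonneg_left this h5]
      · field_simp
    have e3 : 1 / √(s * m) = (√(s * m))⁻¹ := one_div _
    have e4 : (8 * ρ / c ^ 2 + 4 * Real.pi / c + 1) * (√(s * m))⁻¹ ≤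
        (8 * ρ / c ^ 2 + 4 * Real.pi / c + 1) * (2 * (√(1 + s * m))⁻¹) :=
      mul_le_mul_of_nonneg_left h4 (by positivity)
    have e5 : 0 ≤ 2 * (2 * ρ + 1) * (√(1 + s * m))⁻¹ := by positivity
    rw [e3]
    linarith
  · refine ⟨1, one_pos, ?_⟩
    have hQ : ∫ x in annulus ρ, (1 : ℝ) ^ 2 / ((A * x ^ 2 + B * x + E) ^ 2 + 1 ^ 2) ≤ 2 * ρ := by
      refine (setIntegral_le_interval hρ.le (measurableSet_annulus ρ) (annulus_subset ρ)
        (v := fun _ => 1) (continuous_const.div (by fun_prop) fun x => by positivity)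
        intervalIntegrable_const (fun _ => zero_le_one) fun x _ => ?_).trans ?_
      · change (1 : ℝ) ^ 2 / ((A * x ^ 2 + B * x + E) ^ 2 + 1 ^ 2) ≤ 1
        rw [div_le_one (by positivity)]; nlinarith [sq_nonneg (A * x ^ 2 + B * x + E)]
      · simp; linarith
    have h4 : 1 ≤ 2 * (√(1 + s * m))⁻¹ := by
      rw [← div_eq_mul_inv, le_div_iff₀ hw, one_mul, Real.sqrt_le_left (by norm_num)]
      linarith
    have e1 : (2 * ρ + 1) * 1 ≤ (2 * ρ + 1) * (2 * (√(1 + s * m))⁻¹) :=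
      mul_le_mul_of_nonneg_left h4 (by positivity)
    have e5 : 0 ≤ (8 * ρ / c ^ 2 + 4 * Real.pi / c + 1) * 2 * (√(1 + s * m))⁻¹ := by positivity
    rw [div_one]
    linarith

/-- The choice μ = s^(1/3) balances the regularisation term 1/μ with the sublevel integral when N
may have a double zero. -/
lemma phase_degenerate {ρ c : ℝ} (hρ : 0 < ρ) (hc : 0 < c) : ∃ C, 0 ≤ C ∧
    ∀ s A B E : ℝ, 1 ≤ s → c * s ≤ |A| + |B| + |E| →
      ∃ μ, 0 < μ ∧ (∫ x in annulus ρ, μ ^ 2 / ((A * x ^ 2 + B * x + E) ^ 2 + μ ^ 2)) +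
        1 / μ + 1 / √s ≤ C * s ^ (-(1 / 3) : ℝ) := by
  obtain ⟨C, hC, H⟩ := integral_quadratic_degenerate hρ.le hc (measurableSet_annulus ρ)
    (annulus_subset ρ)
  refine ⟨C + 1 + 1, by positivity, ?_⟩
  intro s A B E hs h
  have hs0 : 0 < s := by linarith
  set r := s ^ (1 / 3 : ℝ) with hr
  have hr0 : 0 < r := Real.rpow_pos_of_pos hs0 _
  have hr1 : 1 ≤ r := Real.one_le_rpow hs (by norm_num)
  have hr3 : r ^ 3 = s := by
    rw [hr, ← Real.rpow_natCast, ← Real.rpow_mul hs0.le]; norm_num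
  have hinv : s ^ (-(1 / 3) : ℝ) = r⁻¹ := by rw [hr, Real.rpow_neg hs0.le]
  refine ⟨r, hr0, ?_⟩
  have hQ := H r A B E hr1 (by rw [hr3]; exact h)
  have h2 : 1 / √s ≤ r⁻¹ := by
    rw [one_div]
    refine inv_anti₀ hr0 (Real.le_sqrt_of_sq_le ?_)
    rw [← hr3]
    exact pow_le_pow_right₀ hr1 (by norm_num)
  rw [hinv, add_mul, add_mul, one_mul, ← div_eq_mul_inv]
  rw [one_div] at h2 ⊢
  rw [one_div]
  linarith

lemma abs_phase_coefs {s lam a e c d : ℝ} (h0 : 0 < lam) (h1 : lam ≤ s) :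
    |(s + lam) * a * c| = (s + lam) * (|a| * |c|) ∧ |2 * lam * e * c| = 2 * lam * (|e| * |c|) ∧
    |-((s - lam) * e * d)| = (s - lam) * (|e| * |d|) := by
  refine ⟨?_, ?_, ?_⟩
  · rw [abs_mul, abs_mul, abs_of_pos (by linarith : 0 < s + lam), mul_assoc]
  · rw [abs_mul, abs_mul, abs_of_pos (by linarith : 0 < 2 * lam), mul_assoc]
  · rw [abs_neg, abs_mul, abs_mul, abs_of_nonneg (by linarith : 0 ≤ s - lam), mul_assoc]

/-- The identities c = (ac)d - (ec)c and e = (ed)a - (ec)e, consequences of ad - ec = 1, show that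
ac, ec and ed cannot all be small unless e and c are. For λ/s in [δ, 1-δ] each of these products
enters N with a factor of order s. -/
lemma phase_far {s lam a e c d δ L c₀ : ℝ} (hδ : 0 < δ) (hL : 1 ≤ L) (hs : 0 < s)
    (hlam : δ * s ≤ lam) (hlam' : lam ≤ (1 - δ) * s) (ha : |a| ≤ L) (he : |e| ≤ L) (hc : |c| ≤ L)
    (hd : |d| ≤ L) (hdet : a * d - e * c = 1) (hm : c₀ ≤ |e| + |c|) :
    δ * (c₀ / (2 * L)) * s ≤
      |(s + lam) * a * c| + |2 * lam * e * c| + |-((s - lam) * e * d)| := by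
  have hlam0 : 0 < lam := lt_of_lt_of_le (by positivity) hlam
  have hL0 : 0 < L := by linarith
  have hδs : 0 < δ * s := by positivity
  obtain ⟨eA, eB, eE⟩ := abs_phase_coefs (a := a) (e := e) (c := c) (d := d) hlam0
    (by linarith : lam ≤ s)
  rw [eA, eB, eE]
  have pa := abs_nonneg a
  have pe := abs_nonneg e
  have pc := abs_nonneg c
  have pd := abs_nonneg d
  have k1 : |c| ≤ L * (|a| * |c| + |e| * |c|) := by
    have h1 : |c| ≤ |a * c * d| + |e * c * c| := by
      calc |c| = |a * c * d - e * c * c| := by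
            congr 1; linear_combination (-c) * hdet
        _ ≤ _ := abs_sub _ _
    rw [abs_mul, abs_mul, abs_mul, abs_mul] at h1
    linarith [mul_le_mul_of_nonneg_left hd (mul_nonneg pa pc),
      mul_le_mul_of_nonneg_left hc (mul_nonneg pe pc)]
  have k2 : |e| ≤ L * (|e| * |d| + |e| * |c|) := by
    have h1 : |e| ≤ |e * d * a| + |e * c * e| := by
      calc |e| = |e * d * a - e * c * e| := by
            congr 1; linear_combination (-e) * hdet
        _ ≤ _ := abs_sub _ _
    rw [abs_mul, abs_mul, abs_mul, abs_mul] at h1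
    linarith [mul_le_mul_of_nonneg_left ha (mul_nonneg pe pd),
      mul_le_mul_of_nonneg_left he (mul_nonneg pe pc)]
  have q1 := mul_nonneg pa pc
  have q2 := mul_nonneg pe pd
  have q3 := mul_nonneg pe pc
  generalize |a| * |c| = X at *
  generalize |e| * |d| = Y at *
  generalize |e| * |c| = Z at *
  have k3 : c₀ / (2 * L) ≤ X + Z + Y := by
    rw [div_le_iff₀ (by positivity)]
    linarith [mul_nonneg hL0.le q1, mul_nonneg hL0.le q2]
  have k4 := mul_le_mul_of_nonneg_left k3 hδs.le
  have j1 : δ * s * X ≤ (s + lam) * X := mul_le_mul_of_nonneg_right (by linarith) q1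
  have j2 : δ * s * Z ≤ 2 * lam * Z := mul_le_mul_of_nonneg_right (by linarith) q3
  have j3 : δ * s * Y ≤ (s - lam) * Y := mul_le_mul_of_nonneg_right (by linarith) q2
  linarith

/-- When e and c are small, |ad| ≥ 1/2, so |a| and |d| are bounded below. Up to multiples of s|c|
the value of N is then at least of order s|e|, and its derivative on the annulus is of order at
least s|c|; the bound c₀ ≤ 1/(4Lρ) keeps the cross term 2λec below half of the leading part of the
derivative. -/
lemma phase_near {s lam a e c d δ L c₀ ρ x : ℝ} (hδ : 0 < δ) (hL : 1 ≤ L) (hs : 0 < s)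
    (hρ : 0 < ρ) (hlam : δ * s ≤ lam) (hlam' : lam ≤ (1 - δ) * s) (ha : |a| ≤ L) (hd : |d| ≤ L)
    (hdet : a * d - e * c = 1) (hm : |e| + |c| ≤ c₀) (h2 : c₀ ≤ 1 / 2)
    (h4 : c₀ ≤ 1 / (4 * L * ρ)) (hx : x ∈ annulus ρ) :
    δ / (2 * L) / (1 + (2 * L * ρ ^ 2 + 2 * ρ + 1) / (1 / (2 * L * ρ))) * s * (|e| + |c|) ≤
      |(s + lam) * a * c * x ^ 2 + 2 * lam * e * c * x + -((s - lam) * e * d)| +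
      |2 * ((s + lam) * a * c) * x + 2 * lam * e * c| := by
  have hlam0 : 0 < lam := lt_of_lt_of_le (by positivity) hlam
  have hL0 : 0 < L := by linarith
  have hlams : lam ≤ s := by linarith [mul_pos hδ hs]
  have hδ1 : δ ≤ 1 := by
    by_contra hcon
    nlinarith
  have hsl : 0 ≤ s - lam := by linarith
  have pa := abs_nonneg a
  have pe := abs_nonneg e
  have pc := abs_nonneg c
  have pd := abs_nonneg d
  have hec : |e| * |c| ≤ 1 / 2 := by nlinarith
  have had : 1 / 2 ≤ |a| * |d| := by
    have h1 : |a * d - e * c| ≤ |a * d| + |e * c| := abs_sub _ _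
    rw [hdet, abs_one, abs_mul, abs_mul] at h1
    linarith
  have hda : 1 / (2 * L) ≤ |a| := by
    rw [div_le_iff₀ (by positivity)]
    linarith [mul_le_mul_of_nonneg_left hd pa]
  have hdd : 1 / (2 * L) ≤ |d| := by
    rw [div_le_iff₀ (by positivity)]
    linarith [mul_le_mul_of_nonneg_right ha pd]
  obtain ⟨eA, eB, eE⟩ := abs_phase_coefs (a := a) (e := e) (c := c) (d := d) hlam0 hlams
  obtain ⟨n1, n2⟩ := annulus_bounds hx ((s + lam) * a * c) (2 * lam * e * c)
    (-((s - lam) * e * d))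
  rw [eA, eB, eE] at n1
  rw [eA, eB] at n2
  have hL1 : 0 < 1 / (2 * L) := by positivity
  refine nondegenerate_of_le hs.le pc ?_ (by positivity) (by positivity) (abs_nonneg _)
    (abs_nonneg _) (le_trans ?_ n1) (le_trans ?_ n2)
  · rw [div_le_one (by positivity)]; linarith
  · have t1 : δ * s * (1 / (2 * L)) * |e| ≤ (s - lam) * |d| * |e| :=
      mul_le_mul_of_nonneg_right (mul_le_mul (by linarith) hdd hL1.le hsl) pe
    have t2 : (s + lam) * |a| * (|c| * ρ ^ 2) ≤ (2 * s) * L * (|c| * ρ ^ 2) :=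
      mul_le_mul_of_nonneg_right (mul_le_mul (by linarith) ha pa (by linarith)) (by positivity)
    have t3 : lam * |e| * (|c| * ρ) ≤ s * 1 * (|c| * ρ) :=
      mul_le_mul_of_nonneg_right (mul_le_mul hlams (by linarith) pe hs.le) (by positivity)
    have e1 : s * (δ / (2 * L) * |e| - (2 * L * ρ ^ 2 + 2 * ρ) * |c|) =
      δ * s * (1 / (2 * L)) * |e| - (2 * s) * L * (|c| * ρ ^ 2) - 2 * (s * 1 * (|c| * ρ)) := by
      ring
    linarith
  · have t1 : s * (1 / (2 * L)) * (2 * |c| * ρ⁻¹) ≤ (s + lam) * |a| * (2 * |c| * ρ⁻¹) :=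
      mul_le_mul_of_nonneg_right (mul_le_mul (by linarith) hda hL1.le (by linarith))
        (by positivity)
    have t2 : lam * |e| * (2 * |c|) ≤ s * (1 / (4 * L * ρ)) * (2 * |c|) :=
      mul_le_mul_of_nonneg_right (mul_le_mul hlams (by linarith) pe hs.le) (by positivity)
    have e1 : s * (1 / (2 * L * ρ) * |c|) = s * (1 / (2 * L)) * (2 * |c| * ρ⁻¹) -
        s * (1 / (4 * L * ρ)) * (2 * |c|) := by
      field_simp
      ring
    linarith

/-- The bound for the pairing with frequencies in the open range. -/
lemma norm_periodPairing_le_oriented {b : ℝ → ℂ} {M δ L : ℝ} (hb : IsAmp b M)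
    (hb' : IsAmp (deriv b) M) (hδ : 0 < δ) (hL : 1 ≤ L) : ∃ C c₀, 0 ≤ C ∧ 0 < c₀ ∧ c₀ ≤ 1 / 2 ∧
    ∀ s lam a e c d : ℝ, 1 ≤ s → δ * s ≤ lam → lam ≤ (1 - δ) * s → |a| ≤ L → |e| ≤ L → |c| ≤ L →
      |d| ≤ L → a * d - e * c = 1 →
      (|e| + |c| ≤ c₀ →
        ‖periodPairing b s lam a e c d‖ ≤ C * s⁻¹ * (√(1 + s * (|e| + |c|)))⁻¹) ∧
      (c₀ ≤ |e| + |c| →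
        ‖periodPairing b s lam a e c d‖ ≤ C * s⁻¹ * s ^ (-(1 / 3) : ℝ)) := by
  obtain ⟨C, ρ, hC, hρ, H⟩ := norm_periodPairing_le_of_phase hb hb' hδ hL
  have hL0 : 0 < L := by linarith
  obtain ⟨c₀, hc₀p, h2, h4⟩ : ∃ c₀ : ℝ, 0 < c₀ ∧ c₀ ≤ 1 / 2 ∧ c₀ ≤ 1 / (4 * L * ρ) :=
    ⟨min (1 / 2) (1 / (4 * L * ρ)), by positivity, min_le_left _ _, min_le_right _ _⟩
  obtain ⟨C₁, hC₁, H₁⟩ := phase_nondegenerate hρ (by positivity : 0 < δ / (2 * L) /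
    (1 + (2 * L * ρ ^ 2 + 2 * ρ + 1) / (1 / (2 * L * ρ)))) hc₀p.le
  obtain ⟨C₂, hC₂, H₂⟩ := phase_degenerate hρ (by positivity : 0 < δ * (c₀ / (2 * L)))
  refine ⟨C * C₁ + C * C₂, c₀, by positivity, hc₀p, h2, ?_⟩
  intro s lam a e c d hs hlam hlam' ha he hc hd hdet
  have hs0 : 0 < s := by linarith
  have hlam0 : 0 < lam := lt_of_lt_of_le (by positivity) hlam
  have habs : |lam| ≤ (1 - δ) * s := by rw [abs_of_pos hlam0]; exact hlam'
  constructor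
  · intro hm
    obtain ⟨μ, hμ, hQ⟩ := H₁ s (|e| + |c|) ((s + lam) * a * c) (2 * lam * e * c)
      (-((s - lam) * e * d)) hs (by positivity) hm
      (fun x hx => phase_near hδ hL hs0 hρ hlam hlam' ha hd hdet hm h2 h4 hx)
    refine (H s lam a e c d μ hs habs hμ ha he hc hd hdet).trans ?_
    calc _ ≤ C / s * (C₁ * (√(1 + s * (|e| + |c|)))⁻¹) :=
          mul_le_mul_of_nonneg_left hQ (by positivity)
      _ = C * C₁ * s⁻¹ * (√(1 + s * (|e| + |c|)))⁻¹ := by ring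
      _ ≤ _ := by
          have : 0 ≤ C * C₂ := by positivity
          gcongr
          linarith
  · intro hm
    obtain ⟨μ, hμ, hQ⟩ := H₂ s ((s + lam) * a * c) (2 * lam * e * c)
      (-((s - lam) * e * d)) hs (phase_far hδ hL hs0 hlam hlam' ha he hc hd hdet hm)
    refine (H s lam a e c d μ hs habs hμ ha he hc hd hdet).trans ?_
    calc _ ≤ C / s * (C₂ * s ^ (-(1 / 3) : ℝ)) :=
          mul_le_mul_of_nonneg_left hQ (by positivity)
      _ = C * C₂ * s⁻¹ * s ^ (-(1 / 3) : ℝ) := by ring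
      _ ≤ _ := by
          have : 0 ≤ C * C₁ := by positivity
          gcongr
          linarith

/-- The bound for the pairing at frequency zero. -/
lemma norm_periodPairing_le_unoriented {b : ℝ → ℂ} {M L : ℝ} (hb : IsAmp b M)
    (hb' : IsAmp (deriv b) M) (hL : 1 ≤ L) : ∃ C, 0 ≤ C ∧
    ∀ s a e c d : ℝ, 1 ≤ s → |a| ≤ L → |e| ≤ L → |c| ≤ L → |d| ≤ L → a * d - e * c = 1 →
      ‖periodPairing b s 0 a e c d‖ ≤
        C * s⁻¹ * (√(1 + s * (|e| * |d| + |a| * |c|)))⁻¹ := by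
  obtain ⟨C, ρ, hC, hρ, H⟩ := norm_periodPairing_le_of_phase hb hb' one_half_pos hL
  have hL0 : 0 < L := by linarith
  obtain ⟨C₁, hC₁, H₁⟩ := phase_nondegenerate hρ
    (by positivity : 0 < 1 / (1 + (ρ ^ 2 + 1) / (2 * ρ⁻¹)))
    (by positivity : 0 ≤ L * L + L * L)
  refine ⟨C * C₁, by positivity, ?_⟩
  intro s a e c d hs ha he hc hd hdet
  have hs0 : 0 < s := by linarith
  have pa := abs_nonneg a
  have pe := abs_nonneg e
  have pc := abs_nonneg c
  have pd := abs_nonneg d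
  -- At λ = 0 the linear coefficient vanishes: N = s(ac x² - ed) and N' = 2s ac x. On the annulus
  -- this is nondegenerate at scale s(|ed|+|ac|) for every matrix, so no separate degenerate case
  -- arises.
  obtain ⟨μ, hμ, hQ⟩ := H₁ s (|e| * |d| + |a| * |c|) ((s + 0) * a * c) (2 * 0 * e * c)
    (-((s - 0) * e * d)) hs (by positivity)
    (add_le_add (mul_le_mul he hd pd hL0.le) (mul_le_mul ha hc pc hL0.le)) (fun x hx => by
      obtain ⟨n1, n2⟩ := annulus_bounds hx ((s + 0) * a * c) (2 * 0 * e * c)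
        (-((s - 0) * e * d))
      have eA : |(s + 0) * a * c| = s * (|a| * |c|) := by
        rw [abs_mul, abs_mul, add_zero, abs_of_pos hs0, mul_assoc]
      have eB : |2 * 0 * e * c| = 0 := by simp
      have eE : |-((s - 0) * e * d)| = s * (|e| * |d|) := by
        rw [abs_neg, abs_mul, abs_mul, sub_zero, abs_of_pos hs0, mul_assoc]
      rw [eA, eB, eE] at n1
      rw [eA, eB] at n2
      refine nondegenerate_of_le hs0.le (mul_nonneg pa pc) le_rfl (by positivity) (by positivity)
          (abs_nonneg _) (abs_nonneg _) (le_trans (le_of_eq ?_) n1) (le_trans (le_of_eq ?_) n2)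
      · ring
      · ring)
  refine (H s 0 a e c d μ hs (by rw [abs_zero]; linarith) hμ ha he hc hd hdet).trans ?_
  calc _ ≤ C / s * (C₁ * (√(1 + s * (|e| * |d| + |a| * |c|)))⁻¹) :=
        mul_le_mul_of_nonneg_left hQ (by positivity)
    _ = _ := by ring

/-! ### Matrix entries, Poisson kernels and distances in the group -/

lemma coe_smul_vert (g : SL(2, ℝ)) (y : ℝ) : ((g • vert y : ℍ) : ℂ) =
    ((g.1 0 0 : ℂ) * (Real.exp y * Complex.I) + g.1 0 1) /
      ((g.1 1 0 : ℂ) * (Real.exp y * Complex.I) + g.1 1 1) := by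
  have h : ((vert y : ℍ) : ℂ) = Real.exp y * Complex.I := by
    apply Complex.ext <;> simp [vert, Complex.exp_ofReal_re]
  rw [UpperHalfPlane.coe_specialLinearGroup_apply, h]
  simp

lemma vert_denom_pos (g : SL(2, ℝ)) (y : ℝ) :
    0 < g.1 1 1 ^ 2 + Real.exp y ^ 2 * g.1 1 0 ^ 2 := by
  have hdet : g.1 0 0 * g.1 1 1 - g.1 0 1 * g.1 1 0 = 1 := by
    rw [← Matrix.det_fin_two]; exact g.2
  have hY := Real.exp_pos y
  by_contra hcon
  have h1 : g.1 1 1 ^ 2 = 0 := by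
    nlinarith [sq_nonneg (g.1 1 1), mul_nonneg (sq_nonneg (Real.exp y)) (sq_nonneg (g.1 1 0))]
  have h2 : Real.exp y ^ 2 * g.1 1 0 ^ 2 = 0 := by
    nlinarith [sq_nonneg (g.1 1 1), mul_nonneg (sq_nonneg (Real.exp y)) (sq_nonneg (g.1 1 0))]
  have h3 : g.1 1 0 ^ 2 = 0 := (mul_eq_zero.mp h2).resolve_left (by positivity)
  rw [pow_eq_zero_iff two_ne_zero] at h1 h3
  rw [h1, h3] at hdet
  simp at hdet

lemma smul_vert_re_im (g : SL(2, ℝ)) (y : ℝ) :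
    (g • vert y : ℍ).re = (g.1 0 1 * g.1 1 1 + Real.exp y ^ 2 * (g.1 0 0 * g.1 1 0)) /
        (g.1 1 1 ^ 2 + Real.exp y ^ 2 * g.1 1 0 ^ 2) ∧
    (g • vert y : ℍ).im = Real.exp y / (g.1 1 1 ^ 2 + Real.exp y ^ 2 * g.1 1 0 ^ 2) := by
  have hdet : g.1 0 0 * g.1 1 1 - g.1 0 1 * g.1 1 0 = 1 := by
    rw [← Matrix.det_fin_two]; exact g.2
  have hp := vert_denom_pos g y
  have hc := coe_smul_vert g y
  generalize hA : g.1 0 0 = A at *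
  generalize hB : g.1 0 1 = B at *
  generalize hC : g.1 1 0 = C at *
  generalize hD : g.1 1 1 = D at *
  generalize Real.exp y = Y at *
  have hden : Complex.normSq ((C : ℂ) * (Y * Complex.I) + D) = D ^ 2 + Y ^ 2 * C ^ 2 := by
    rw [Complex.normSq_apply]; simp; ring
  constructor
  · rw [← UpperHalfPlane.coe_re, hc, Complex.div_re, hden]
    simp
    field_simp
  · rw [← UpperHalfPlane.coe_im, hc, Complex.div_im, hden]
    simp
    field_simp
    linear_combination Y * hdet

/-- This is where the linear forms of the twisted periods originate: they are the numerator and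
denominator of g⁻¹ξ. -/
lemma poisson_smul_vert (g : SL(2, ℝ)) (y ξ : ℝ) : poisson (g • vert y) ξ =
    Real.exp y / ((g.1 1 1 * ξ + -g.1 0 1) ^ 2 +
      Real.exp y ^ 2 * (-g.1 1 0 * ξ + g.1 0 0) ^ 2) := by
  have hdet : g.1 0 0 * g.1 1 1 - g.1 0 1 * g.1 1 0 = 1 := by
    rw [← Matrix.det_fin_two]; exact g.2
  have hp := vert_denom_pos g y
  obtain ⟨h1, h2⟩ := smul_vert_re_im g y
  have hpos := poisson_denom_pos (g • vert y) ξ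
  have hY := Real.exp_pos y
  rw [poisson]
  rw [h1, h2] at hpos ⊢
  generalize g.1 0 0 = A at *
  generalize g.1 0 1 = B at *
  generalize g.1 1 0 = C at *
  generalize g.1 1 1 = D at *
  generalize Real.exp y = Y at *
  have e : (D * ξ + -B) ^ 2 + Y ^ 2 * (-C * ξ + A) ^ 2 =
      ((ξ - (B * D + Y ^ 2 * (A * C)) / (D ^ 2 + Y ^ 2 * C ^ 2)) ^ 2 +
        (Y / (D ^ 2 + Y ^ 2 * C ^ 2)) ^ 2) * (D ^ 2 + Y ^ 2 * C ^ 2) := by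
    field_simp
    linear_combination (Y ^ 2 * (A * D - B * C + 1)) * hdet
  rw [e, div_div, mul_comm]

/-- All four entries occur squared with positive coefficients, so an upper bound on the distance
bounds every entry. -/
lemma cosh_dist_vert_smul (g : SL(2, ℝ)) (x y : ℝ) :
    Real.cosh (dist (vert x) (g • vert y)) = (g.1 0 1 ^ 2 + Real.exp y ^ 2 * g.1 0 0 ^ 2 +
      Real.exp x ^ 2 * (g.1 1 1 ^ 2 + Real.exp y ^ 2 * g.1 1 0 ^ 2)) /
      (2 * Real.exp x * Real.exp y) := by
  have hdet : g.1 0 0 * g.1 1 1 - g.1 0 1 * g.1 1 0 = 1 := by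
    rw [← Matrix.det_fin_two]; exact g.2
  have hp := vert_denom_pos g y
  obtain ⟨h1, h2⟩ := smul_vert_re_im g y
  have hX := Real.exp_pos x
  have hY := Real.exp_pos y
  have hv1 : (vert x).re = 0 := rfl
  have hv2 : (vert x).im = Real.exp x := rfl
  rw [UpperHalfPlane.cosh_dist, Complex.dist_eq, ← Complex.normSq_eq_norm_sq, Complex.normSq_apply]
  simp only [Complex.sub_re, Complex.sub_im, UpperHalfPlane.coe_re, UpperHalfPlane.coe_im]
  rw [hv1, hv2, h1, h2]
  generalize g.1 0 0 = A at *
  generalize g.1 0 1 = B at *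
  generalize g.1 1 0 = C at *
  generalize g.1 1 1 = D at *
  generalize Real.exp y = Y at *
  generalize Real.exp x = X at *
  field_simp
  linear_combination (-Y ^ 2 * (A * D - B * C + 1)) * hdet

lemma dist_geod (g₁ g₂ : SL(2, ℝ)) (x y : ℝ) :
    dist (geod g₁ x) (geod g₂ y) = dist (vert x) ((g₁⁻¹ * g₂) • vert y) := by
  rw [geod, geod, ← dist_smul g₁⁻¹, inv_smul_smul, mul_smul]

/-- The entries of `g₁⁻¹ g₂` are bounded when the segments are close. -/
lemma exists_entry_bound : ∃ L : ℝ, 1 ≤ L ∧ ∀ g₁ g₂ : SL(2, ℝ), segDist g₁ g₂ ≤ 1 →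
    ∀ i j, |(g₁⁻¹ * g₂).1 i j| ≤ L := by
  have he1 := Real.one_le_exp (zero_le_one' ℝ)
  have hc1 := Real.one_le_cosh 2
  set L := 2 * Real.exp 1 ^ 2 * Real.cosh 2 with hL
  have hL1 : 1 ≤ L := by
    have : 1 ≤ Real.exp 1 ^ 2 := one_le_pow₀ he1
    nlinarith
  refine ⟨L, hL1, ?_⟩
  intro g₁ g₂ h
  set g := g₁⁻¹ * g₂ with hg
  -- The infimum is at most 1, so some pair of points has distance below 2; attainment of the
  -- infimum is not needed.
  obtain ⟨r, ⟨x, hx, y, hy, rfl⟩, hr⟩ := exists_lt_of_csInf_lt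
    (s := {r | ∃ x ∈ Set.Icc (0 : ℝ) 1, ∃ y ∈ Set.Icc (0 : ℝ) 1,
      r = dist (geod g₁ x) (geod g₂ y)})
    ⟨_, 0, by simp, 0, by simp, rfl⟩ (lt_of_le_of_lt h one_lt_two)
  have hcosh : Real.cosh (dist (geod g₁ x) (geod g₂ y)) ≤ Real.cosh 2 := by
    rw [Real.cosh_le_cosh, abs_of_nonneg dist_nonneg, abs_two]; exact hr.le
  rw [dist_geod, ← hg, cosh_dist_vert_smul] at hcosh
  have hX1 := Real.one_le_exp hx.1
  have hY1 := Real.one_le_exp hy.1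
  have hX2 := Real.exp_le_exp.mpr hx.2
  have hY2 := Real.exp_le_exp.mpr hy.2
  rw [div_le_iff₀ (by positivity)] at hcosh
  have hXY : Real.cosh 2 * (2 * Real.exp x * Real.exp y) ≤ L := by
    have : Real.exp x * Real.exp y ≤ Real.exp 1 ^ 2 := by
      rw [sq]; exact mul_le_mul hX2 hY2 (Real.exp_pos _).le (Real.exp_pos _).le
    rw [hL]
    nlinarith
  generalize Real.exp x = X at *
  generalize Real.exp y = Y at *
  have hX3 : 1 ≤ X ^ 2 := one_le_pow₀ hX1
  have hY3 : 1 ≤ Y ^ 2 := one_le_pow₀ hY1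
  have hXY3 : 1 ≤ X ^ 2 * Y ^ 2 := one_le_mul_of_one_le_of_one_le hX3 hY3
  have key : ∀ (z T : ℝ), 1 ≤ T → T * z ^ 2 ≤ L → |z| ≤ L := by
    intro z T hT hz
    have h1 : z ^ 2 ≤ L := by nlinarith [sq_nonneg z]
    refine abs_le_of_sq_le_sq ?_ (by linarith)
    nlinarith
  have q1 : 0 ≤ g.1 0 1 ^ 2 := sq_nonneg _
  have q2 : 0 ≤ Y ^ 2 * g.1 0 0 ^ 2 := by positivity
  have q3 : 0 ≤ X ^ 2 * g.1 1 1 ^ 2 := by positivity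
  have q4 : 0 ≤ X ^ 2 * Y ^ 2 * g.1 1 0 ^ 2 := by positivity
  intro i j
  fin_cases i <;> fin_cases j
  · exact key _ (Y ^ 2) hY3 (by simp only [Fin.zero_eta]; linarith)
  · exact key _ 1 le_rfl (by simp only [Fin.zero_eta, Fin.mk_one]; linarith)
  · exact key _ (X ^ 2 * Y ^ 2) hXY3 (by simp only [Fin.zero_eta, Fin.mk_one]; linarith)
  · exact key _ (X ^ 2) hX3 (by simp only [Fin.mk_one]; linarith)

lemma curveLength_nonneg (γ : ℝ → SL(2, ℝ)) : 0 ≤ curveLength γ :=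
  intervalIntegral.integral_nonneg zero_le_one fun _ _ => Real.sqrt_nonneg _

lemma distG_nonneg (g h : SL(2, ℝ)) : 0 ≤ distG g h := by
  refine Real.sInf_nonneg ?_
  rintro _ ⟨γ, -, -, -, rfl⟩
  exact curveLength_nonneg γ

lemma distG_le {g h : SL(2, ℝ)} {γ : ℝ → SL(2, ℝ)} (h1 : ∀ i j, ContDiff ℝ 1 fun s => (γ s).1 i j)
    (h2 : γ 0 = g) (h3 : (γ 1).1 = h.1 ∨ (γ 1).1 = -h.1) : distG g h ≤ curveLength γ := by
  refine csInf_le ⟨0, ?_⟩ ⟨γ, h1, h2, h3, rfl⟩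
  rintro _ ⟨γ, -, -, -, rfl⟩
  exact curveLength_nonneg γ

lemma nDist_nonneg (S : Set SL(2, ℝ)) (g₁ g₂ : SL(2, ℝ)) : 0 ≤ nDist S g₁ g₂ := by
  refine Real.sInf_nonneg ?_
  rintro _ ⟨a, -, rfl⟩
  exact distG_nonneg _ _

lemma nDist_le {S : Set SL(2, ℝ)} {g₁ g₂ a : SL(2, ℝ)} (ha : a ∈ S) :
    nDist S g₁ g₂ ≤ distG (g₁⁻¹ * g₂) a := by
  refine csInf_le ⟨0, ?_⟩ ⟨a, ha, rfl⟩
  rintro _ ⟨a, -, rfl⟩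
  exact distG_nonneg _ _

/-- A curve from `g` to the subgroup `A`, of length `O(|g₀₁| + |g₁₀|)`. -/
lemma exists_curve_to_A {L : ℝ} (hL : 1 ≤ L) (g : SL(2, ℝ)) (hg : ∀ i j, |g.1 i j| ≤ L)
    (hD : 1 / (2 * L) ≤ |g.1 1 1|) : ∃ (γ : ℝ → SL(2, ℝ)) (y : ℝ),
      (∀ i j, ContDiff ℝ 1 fun s => (γ s).1 i j) ∧ γ 0 = g ∧
      ((γ 1).1 = (aElt y).1 ∨ (γ 1).1 = -(aElt y).1) ∧
      ∀ s ∈ Set.Icc (0 : ℝ) 1, lieNorm ((γ s)⁻¹.1 * velocity γ s) ≤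
        10 * L ^ 3 * (|g.1 0 1| + |g.1 1 0|) := by
  have hdet : g.1 0 0 * g.1 1 1 - g.1 0 1 * g.1 1 0 = 1 := by
    rw [← Matrix.det_fin_two]; exact g.2
  have hA := hg 0 0
  have hB := hg 0 1
  have hC := hg 1 0
  have hDL := hg 1 1
  have hgm : g.1 = !![g.1 0 0, g.1 0 1; g.1 1 0, g.1 1 1] := Matrix.eta_fin_two _
  generalize hA' : g.1 0 0 = A at *
  generalize hB' : g.1 0 1 = B at *
  generalize hC' : g.1 1 0 = C at *
  generalize hD' : g.1 1 1 = D at *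
  have hDp : 0 < |D| := lt_of_lt_of_le (by positivity) hD
  have hD0 : D ≠ 0 := abs_pos.mp hDp
  -- The path shrinks the off-diagonal entries linearly, keeps D fixed, and adjusts the upper left
  -- entry to keep determinant one. This requires D bounded away from 0.
  have hγdet : ∀ s : ℝ, Matrix.det !![(1 + (1 - s) ^ 2 * (B * C)) / D, (1 - s) * B;
      (1 - s) * C, D] = 1 := by
    intro s
    rw [Matrix.det_fin_two_of]
    field_simp
    ring
  set γ : ℝ → SL(2, ℝ) := fun s => ⟨_, hγdet s⟩ with hγ
  have d00 : ∀ s : ℝ, HasDerivAt (fun s => (1 + (1 - s) ^ 2 * (B * C)) / D)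
      (-2 * (1 - s) * (B * C) / D) s := by
    intro s
    have h := ((((hasDerivAt_id s).const_sub 1).fun_pow 2).mul_const (B * C)).const_add 1
      |>.div_const D
    refine h.congr_deriv ?_
    simp
  have dlin : ∀ u s : ℝ, HasDerivAt (fun s : ℝ => (1 - s) * u) (-u) s := by
    intro u s
    simpa using ((hasDerivAt_id s).const_sub 1).mul_const u
  have hvel : ∀ s, velocity γ s = !![-2 * (1 - s) * (B * C) / D, -B; -C, 0] := by
    intro s
    ext i j
    fin_cases i <;> fin_cases j
    · exact (d00 s).deriv
    · exact (dlin B s).deriv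
    · exact (dlin C s).deriv
    · simp [velocity, hγ]
  have hinv : ∀ s, (γ s)⁻¹.1 = !![D, -((1 - s) * B); -((1 - s) * C),
      (1 + (1 - s) ^ 2 * (B * C)) / D] := by
    intro s
    rw [Matrix.SpecialLinearGroup.SL2_inv_expl]
    simp [hγ]
    rfl
  -- The endpoint is diag(1/D, D), which is a(y) up to sign when e^(-y/2) = |D|; the sign is
  -- invisible in PSL₂.
  refine ⟨γ, -2 * Real.log D, ?_, ?_, ?_, ?_⟩
  · intro i j
    fin_cases i <;> fin_cases j <;> simp [hγ] <;> fun_prop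
  · apply Subtype.ext
    rw [hgm]
    have : (1 + (1 - (0 : ℝ)) ^ 2 * (B * C)) / D = A := by
      rw [div_eq_iff hD0]; linear_combination -hdet
    simp only [hγ]
    rw [this]
    simp
  · have e1 : Real.exp (-2 * Real.log D / 2) = |D|⁻¹ := by
      rw [← Real.exp_log_eq_abs hD0, ← Real.exp_neg]; congr 1; ring
    have e2 : Real.exp (-(-2 * Real.log D / 2)) = |D| := by
      rw [← Real.exp_log_eq_abs hD0]; congr 1; ring
    have e3 : (γ 1).1 = !![1 / D, 0; 0, D] := by simp [hγ]
    have e4 : (aElt (-2 * Real.log D)).1 = !![|D|⁻¹, 0; 0, |D|] := by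
      simp only [aElt]; rw [e1, e2]
    rw [e3, e4]
    rcases abs_cases D with ⟨h, _⟩ | ⟨h, _⟩
    · left; rw [h, one_div]
    · right; rw [h]; ext i j; fin_cases i <;> fin_cases j <;> simp [one_div]
  · intro s hs
    have hmul : (γ s)⁻¹.1 * velocity γ s =
        !![-((1 - s) * (B * C)), -(D * B); 2 * (1 - s) ^ 2 * (B * C) * C / D -
          (1 + (1 - s) ^ 2 * (B * C)) / D * C, (1 - s) * (B * C)] := by
      rw [hinv, hvel, Matrix.mul_fin_two]
      ext i j
      fin_cases i <;> fin_cases j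
      · simp; field_simp; ring
      · simp
      · simp; field_simp; ring
      · simp; ring
    have hle : ∀ X Y Z : ℝ, √(X ^ 2 + Y ^ 2 + Z ^ 2) ≤ |X| + |Y| + |Z| := by
      intro X Y Z
      rw [Real.sqrt_le_left (by positivity), ← sq_abs X, ← sq_abs Y, ← sq_abs Z]
      nlinarith [mul_nonneg (abs_nonneg X) (abs_nonneg Y), mul_nonneg (abs_nonneg X) (abs_nonneg Z),
        mul_nonneg (abs_nonneg Y) (abs_nonneg Z)]
    rw [hmul]
    refine (hle _ _ _).trans ?_
    simp only [Matrix.of_apply, Matrix.cons_val', Matrix.cons_val_zero, Matrix.cons_val_one,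
      Matrix.cons_val_fin_one]
    have hL0 : 0 < L := by linarith
    have hDi : |D|⁻¹ ≤ 2 * L := by
      rw [inv_le_comm₀ hDp (by positivity), ← one_div]; exact hD
    have hs0 : 0 ≤ 1 - s := by linarith [hs.2]
    have hs1 : 1 - s ≤ 1 := by linarith [hs.1]
    have hs2 : (1 - s) ^ 2 ≤ 1 := pow_le_one₀ hs0 hs1
    have pB := abs_nonneg B
    have pC := abs_nonneg C
    have x1 : |-((1 - s) * (B * C))| ≤ L * |B| := by
      rw [abs_neg, abs_mul, abs_mul, abs_of_nonneg hs0]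
      calc (1 - s) * (|B| * |C|) ≤ 1 * (|B| * L) :=
            mul_le_mul hs1 (mul_le_mul_of_nonneg_left hC pB) (by positivity) zero_le_one
        _ = L * |B| := by ring
    have x2 : |-(D * B)| ≤ L * |B| := by
      rw [abs_neg, abs_mul]; exact mul_le_mul_of_nonneg_right hDL pB
    have x3 : |2 * (1 - s) ^ 2 * (B * C) * C / D - (1 + (1 - s) ^ 2 * (B * C)) / D * C| ≤
        4 * L ^ 3 * |C| := by
      have e : 2 * (1 - s) ^ 2 * (B * C) * C / D - (1 + (1 - s) ^ 2 * (B * C)) / D * C =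
          ((1 - s) ^ 2 * (B * C) - 1) * C * D⁻¹ := by field_simp; ring
      rw [e, abs_mul, abs_mul, abs_inv]
      have y1 : |(1 - s) ^ 2 * (B * C) - 1| ≤ 2 * L ^ 2 := by
        refine (abs_sub _ _).trans ?_
        rw [abs_one, abs_mul, abs_mul, abs_of_nonneg (sq_nonneg (1 - s))]
        have : (1 - s) ^ 2 * (|B| * |C|) ≤ 1 * (L * L) :=
          mul_le_mul hs2 (mul_le_mul hB hC pC hL0.le) (by positivity) zero_le_one
        nlinarith
      calc _ ≤ 2 * L ^ 2 * |C| * (2 * L) :=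
            mul_le_mul (mul_le_mul_of_nonneg_right y1 pC) hDi (by positivity) (by positivity)
        _ = _ := by ring
    have hL3 : L ≤ L ^ 3 := le_self_pow₀ hL (by norm_num)
    have z1 := mul_le_mul_of_nonneg_right hL3 pB
    have z2 : 0 ≤ L ^ 3 * |B| := by positivity
    have z3 : 0 ≤ L ^ 3 * |C| := by positivity
    linarith

lemma curveLength_le {γ : ℝ → SL(2, ℝ)} {K : ℝ}
    (h : ∀ s ∈ Set.Icc (0 : ℝ) 1, lieNorm ((γ s)⁻¹.1 * velocity γ s) ≤ K) :
    curveLength γ ≤ K := by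
  have := intervalIntegral.norm_integral_le_of_norm_le_const (a := (0 : ℝ)) (b := 1) (C := K)
    (f := fun s => lieNorm ((γ s)⁻¹.1 * velocity γ s)) (fun s hs => by
      rw [Set.uIoc_of_le zero_le_one] at hs
      rw [lieNorm, Real.norm_of_nonneg (Real.sqrt_nonneg _)]
      exact h s ⟨hs.1.le, hs.2⟩)
  rw [sub_zero, abs_one, mul_one] at this
  exact (le_abs_self _).trans this

/-- Small off-diagonal entries force |AD| ≥ 1/2, and the bound on A then keeps D away from 0. -/
lemma nOr_le {L : ℝ} (hL : 1 ≤ L) {g₁ g₂ : SL(2, ℝ)} (hg : ∀ i j, |(g₁⁻¹ * g₂).1 i j| ≤ L)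
    (h : |(g₁⁻¹ * g₂).1 0 1| + |(g₁⁻¹ * g₂).1 1 0| ≤ 1 / 2) :
    nOr g₁ g₂ ≤ 10 * L ^ 3 * (|(g₁⁻¹ * g₂).1 0 1| + |(g₁⁻¹ * g₂).1 1 0|) := by
  set g := g₁⁻¹ * g₂ with hgd
  have hdet : g.1 0 0 * g.1 1 1 - g.1 0 1 * g.1 1 0 = 1 := by
    rw [← Matrix.det_fin_two]; exact g.2
  have h1 : |g.1 0 0 * g.1 1 1 - g.1 0 1 * g.1 1 0| ≤ |g.1 0 0 * g.1 1 1| + |g.1 0 1 * g.1 1 0| :=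
    abs_sub _ _
  rw [hdet, abs_one, abs_mul, abs_mul] at h1
  have hD : 1 / (2 * L) ≤ |g.1 1 1| := by
    rw [div_le_iff₀ (by positivity)]
    nlinarith [mul_le_mul_of_nonneg_right (hg 0 0) (abs_nonneg (g.1 1 1)), abs_nonneg (g.1 0 1),
      abs_nonneg (g.1 1 0)]
  obtain ⟨γ, y, c1, c2, c3, c4⟩ := exists_curve_to_A hL g hg hD
  exact (nDist_le (a := aElt y) (Set.mem_range_self y)).trans ((distG_le c1 c2 c3).trans (curveLength_le c4))

lemma velocity_mul {γ : ℝ → SL(2, ℝ)} (h : SL(2, ℝ))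
    (hγ : ∀ i j, ContDiff ℝ 1 fun s => (γ s).1 i j) (s : ℝ) :
    velocity (fun s => h * γ s) s = h.1 * velocity γ s := by
  have hd : ∀ i j, DifferentiableAt ℝ (fun s => (γ s).1 i j) s := fun i j =>
    ((hγ i j).differentiable one_ne_zero) s
  ext i j
  have e : (fun u => (h * γ u).1 i j) =
      fun u => h.1 i 0 * (γ u).1 0 j + h.1 i 1 * (γ u).1 1 j := by
    ext u
    simp [Matrix.mul_apply, Fin.sum_univ_two]
  simp only [velocity, Matrix.of_apply, Matrix.mul_apply, Fin.sum_univ_two]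
  rw [e]
  exact (((hd 0 j).hasDerivAt.const_mul _).add ((hd 1 j).hasDerivAt.const_mul _)).deriv

/-- Since AD - BC = 1, either |AD| ≥ 1/2 or |BC| ≥ 1/2. In the first case the matrix is joined to A
directly; in the second, w⁻¹g has C and B on the diagonal up to sign, and left-invariance carries
its path to A over to a path from g to wA. -/
lemma nUn_le {L : ℝ} (hL : 1 ≤ L) {g₁ g₂ : SL(2, ℝ)} (hg : ∀ i j, |(g₁⁻¹ * g₂).1 i j| ≤ L) :
    nUn g₁ g₂ ≤ 20 * L ^ 4 * (|(g₁⁻¹ * g₂).1 0 1| * |(g₁⁻¹ * g₂).1 0 0| +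
      |(g₁⁻¹ * g₂).1 1 1| * |(g₁⁻¹ * g₂).1 1 0|) := by
  set g := g₁⁻¹ * g₂ with hgd
  have hdet : g.1 0 0 * g.1 1 1 - g.1 0 1 * g.1 1 0 = 1 := by
    rw [← Matrix.det_fin_two]; exact g.2
  have h1 : |g.1 0 0 * g.1 1 1 - g.1 0 1 * g.1 1 0| ≤ |g.1 0 0 * g.1 1 1| + |g.1 0 1 * g.1 1 0| :=
    abs_sub _ _
  rw [hdet, abs_one, abs_mul, abs_mul] at h1
  have hL0 : 0 < L := by linarith
  have key : ∀ u v : ℝ, |u| ≤ L → 1 / 2 ≤ |u| * |v| → 1 / (2 * L) ≤ |v| := by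
    intro u v hu huv
    rw [div_le_iff₀ (by positivity)]
    linarith [mul_le_mul_of_nonneg_right hu (abs_nonneg v)]
  have step : ∀ u v : ℝ, 1 / (2 * L) ≤ |u| → |v| ≤ 2 * L * (|v| * |u|) := by
    intro u v hu
    rw [div_le_iff₀ (by positivity)] at hu
    nlinarith [mul_le_mul_of_nonneg_left hu (abs_nonneg v)]
  rcases le_or_gt (1 / 2) (|g.1 0 0| * |g.1 1 1|) with hc | hc
  · have hD := key _ _ (hg 0 0) hc
    have hA := key _ _ (hg 1 1) (by rw [mul_comm]; exact hc)
    obtain ⟨γ, y, c1, c2, c3, c4⟩ := exists_curve_to_A hL g hg hD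
    refine (nDist_le (Or.inl ⟨y, rfl⟩)).trans ((distG_le c1 c2 c3).trans
      ((curveLength_le c4).trans ?_))
    have s1 := step _ (g.1 0 1) hA
    have s2 := step _ (g.1 1 0) hD
    rw [mul_comm |g.1 1 1|]
    calc _ ≤ 10 * L ^ 3 * (2 * L * (|g.1 0 1| * |g.1 0 0|) + 2 * L * (|g.1 1 0| * |g.1 1 1|)) :=
          mul_le_mul_of_nonneg_left (add_le_add s1 s2) (by positivity)
      _ = _ := by ring
  · have hB := key _ _ (hg 1 0) (by rw [mul_comm]; linarith : 1 / 2 ≤ |g.1 1 0| * |g.1 0 1|)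
    have hC := key _ _ (hg 0 1) (by linarith : 1 / 2 ≤ |g.1 0 1| * |g.1 1 0|)
    set g' := wElt⁻¹ * g with hg'
    have hwi : wElt⁻¹.1 = !![0, -1; 1, 0] := by
      rw [Matrix.SpecialLinearGroup.SL2_inv_expl]
      ext i j; fin_cases i <;> fin_cases j <;> simp [wElt]
    have hgw : g'.1 = !![0, -1; 1, 0] * g.1 := by rw [hg', Matrix.SpecialLinearGroup.coe_mul, hwi]
    have e00 : g'.1 0 0 = -g.1 1 0 := by
      simp [hgw, Matrix.mul_apply, Fin.sum_univ_two]
    have e01 : g'.1 0 1 = -g.1 1 1 := by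
      simp [hgw, Matrix.mul_apply, Fin.sum_univ_two]
    have e10 : g'.1 1 0 = g.1 0 0 := by
      simp [hgw, Matrix.mul_apply, Fin.sum_univ_two]
    have e11 : g'.1 1 1 = g.1 0 1 := by
      simp [hgw, Matrix.mul_apply, Fin.sum_univ_two]
    have hgb : ∀ i j, |g'.1 i j| ≤ L := by
      intro i j
      fin_cases i <;> fin_cases j <;> simp only [Fin.zero_eta, Fin.mk_one]
      · rw [e00, abs_neg]; exact hg _ _
      · rw [e01, abs_neg]; exact hg _ _
      · rw [e10]; exact hg _ _
      · rw [e11]; exact hg _ _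
    obtain ⟨γ, y, c1, c2, c3, c4⟩ := exists_curve_to_A hL g' hgb (by rw [e11]; exact hB)
    refine (nDist_le (Or.inr ⟨aElt y, ⟨y, rfl⟩, rfl⟩)).trans ((distG_le (γ := fun s => wElt * γ s)
      ?_ ?_ ?_).trans ((curveLength_le (K := 10 * L ^ 3 * (|g'.1 0 1| + |g'.1 1 0|))
        fun s hs => ?_).trans ?_))
    · intro i j
      have : (fun s => (wElt * γ s).1 i j) =
          fun s => wElt.1 i 0 * (γ s).1 0 j + wElt.1 i 1 * (γ s).1 1 j := by
        ext u; simp [Matrix.mul_apply, Fin.sum_univ_two]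
      rw [this]
      exact (contDiff_const.mul (c1 0 j)).add (contDiff_const.mul (c1 1 j))
    · change wElt * γ 0 = g
      rw [c2, hg', mul_inv_cancel_left]
    · rcases c3 with c3 | c3
      · left; simp [c3]
      · right; simp [c3]
    · rw [velocity_mul wElt c1, mul_inv_rev]
      have : ((γ s)⁻¹ * wElt⁻¹).1 * (wElt.1 * velocity γ s) = (γ s)⁻¹.1 * velocity γ s := by
        have hw : wElt⁻¹.1 * wElt.1 = 1 := by
          rw [← Matrix.SpecialLinearGroup.coe_mul, inv_mul_cancel,
            Matrix.SpecialLinearGroup.coe_one]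
        rw [Matrix.SpecialLinearGroup.coe_mul, Matrix.mul_assoc, ← Matrix.mul_assoc wElt⁻¹.1, hw,
          Matrix.one_mul]
      rw [this]
      exact c4 s hs
    · rw [e01, e10, abs_neg]
      have s1 := step _ (g.1 0 0) hB
      have s2 := step _ (g.1 1 1) hC
      rw [mul_comm |g.1 0 1|]
      calc _ ≤ 10 * L ^ 3 * (2 * L * (|g.1 1 1| * |g.1 1 0|) + 2 * L * (|g.1 0 0| * |g.1 0 1|)) :=
            mul_le_mul_of_nonneg_left (add_le_add s2 s1) (by positivity)
        _ = _ := by ring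

/-! ### Unfolding the kernel integral -/

lemma stronglyMeasurable_bFactor : StronglyMeasurable bFactor := by
  unfold bFactor
  refine StronglyMeasurable.integral_prod_right (f := fun s r : ℝ => onePow s ((1 + r ^ 2)⁻¹))
    (Measurable.stronglyMeasurable ?_)
  unfold Function.uncurry onePow
  fun_prop

/-- The spectral weight. -/
def specWeight (H : ℝ → ℝ) (s : ℝ) : ℂ := ((H s * s ^ 2 : ℝ) : ℂ) * (bFactor s * bFactor (-s))

lemma measurable_specWeight {H : ℝ → ℝ} (hc : Continuous H) : Measurable (specWeight H) := by
  have h := stronglyMeasurable_bFactor.measurable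
  have h2 : Measurable fun s => bFactor (-s) := h.comp measurable_neg
  have hH := hc.measurable
  unfold specWeight
  fun_prop

lemma integrable_specWeight {H : ℝ → ℝ} {K : ℝ} (hc : Continuous H)
    (hK : ∀ s, |H s| ≤ K * ((1 + s ^ 2) ^ 2)⁻¹) : Integrable (specWeight H) := by
  refine integrable_of_abs_le_inv (K := K * (Real.pi * Real.pi))
    (measurable_specWeight hc).aestronglyMeasurable fun s => ?_
  have hpi := Real.pi_pos
  rw [specWeight, norm_mul, norm_mul, Complex.norm_real, Real.norm_eq_abs, abs_mul,
    abs_of_nonneg (sq_nonneg s)]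
  have h1 := abs_mul_sq_le hK s
  have h2 := mul_le_mul (norm_bFactor_le s) (norm_bFactor_le (-s)) (norm_nonneg _) hpi.le
  have h3 := mul_le_mul h1 h2 (by positivity) (le_trans (by positivity) h1)
  linarith

lemma halfPow_neg (s p : ℝ) : halfPow (-s) p = (starRingEnd ℂ) (halfPow s p) := by
  rw [halfPow, halfPow, map_mul, Complex.conj_ofReal, ← Complex.exp_conj, map_mul,
    Complex.conj_ofReal, Complex.conj_I]
  congr 2
  push_cast
  ring

/-- The unfolded integrand of `kernelIntegral`. -/
def unfolded (b : ℝ → ℂ) (H : ℝ → ℝ) (lam a e c d : ℝ) (x y : ℝ × ℝ) : ℂ :=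
  (b x.1 * b x.2 * Complex.exp (Complex.I * lam * (x.1 - x.2))) * (specWeight H y.1 *
    (halfPow y.1 (Real.exp x.1 / (y.2 ^ 2 + Real.exp x.1 ^ 2 * 1 ^ 2)) *
      halfPow (-y.1) (Real.exp x.2 / ((a * y.2 + e) ^ 2 + Real.exp x.2 ^ 2 * (c * y.2 + d) ^ 2))))

lemma measurable_unfolded {b : ℝ → ℂ} {M : ℝ} (hb : IsAmp b M) {H : ℝ → ℝ} (hc : Continuous H)
    (lam a e c d : ℝ) : Measurable fun z : (ℝ × ℝ) × (ℝ × ℝ) => unfolded b H lam a e c d z.1 z.2 := by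
  have hbm : Measurable b := hb.smooth.continuous.measurable
  have hw := measurable_specWeight hc
  unfold unfolded halfPow
  fun_prop

/-- The majorant is a product of a function of x and a function of y, which makes all interchanges
of integration legitimate at once. -/
lemma norm_unfolded_le {b : ℝ → ℂ} {M : ℝ} (hb : IsAmp b M) (H : ℝ → ℝ) (lam : ℝ) {a e c d : ℝ}
    (hdet : a * d - e * c = 1) (x y : ℝ × ℝ) : ‖unfolded b H lam a e c d x y‖ ≤
      ((Set.Icc (0 : ℝ) 1).indicator (fun _ => M) x.1 *
        (Set.Icc (0 : ℝ) 1).indicator (fun _ => M) x.2) *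
      (‖specWeight H y.1‖ * (Real.exp 1 *
        ((y.2 ^ 2 + 1 ^ 2)⁻¹ + ((a * y.2 + e) ^ 2 + (c * y.2 + d) ^ 2)⁻¹))) := by
  have hM := hb.nonneg
  by_cases h1 : x.1 ∈ Set.Icc (0 : ℝ) 1
  swap
  · rw [unfolded, hb.supp _ h1, Set.indicator_of_notMem h1]; simp
  by_cases h2 : x.2 ∈ Set.Icc (0 : ℝ) 1
  swap
  · rw [unfolded, hb.supp _ h2, Set.indicator_of_notMem h2]; simp
  rw [Set.indicator_of_mem h1, Set.indicator_of_mem h2, unfolded, norm_mul, norm_mul, norm_mul,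
    norm_mul, norm_mul, norm_halfPow, norm_halfPow]
  have he : ‖Complex.exp (Complex.I * lam * (x.1 - x.2))‖ = 1 := by
    have : Complex.I * lam * (x.1 - x.2) = ((lam * (x.1 - x.2) : ℝ) : ℂ) * Complex.I := by
      push_cast; ring
    rw [this, Complex.norm_exp_ofReal_mul_I]
  rw [he, mul_one]
  have hp0 : 0 < y.2 ^ 2 + (1 : ℝ) ^ 2 := by positivity
  have hp1 := lineForm_pos hdet y.2
  have key : ∀ u v X : ℝ, X ∈ Set.Icc (0 : ℝ) 1 → 0 < u ^ 2 + v ^ 2 →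
      √(Real.exp X / (u ^ 2 + Real.exp X ^ 2 * v ^ 2)) ≤
        √(Real.exp 1) * (√(u ^ 2 + v ^ 2))⁻¹ := by
    intro u v X hX h
    rw [← Real.sqrt_inv, ← Real.sqrt_mul (Real.exp_pos 1).le]
    refine Real.sqrt_le_sqrt ?_
    have h1 : 1 ≤ Real.exp X := Real.one_le_exp hX.1
    have h2 : Real.exp X ≤ Real.exp 1 := Real.exp_le_exp.mpr hX.2
    rw [← div_eq_mul_inv]
    refine div_le_div₀ (Real.exp_pos 1).le h2 h ?_
    nlinarith [sq_nonneg v, sq_nonneg (Real.exp X - 1)]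
  refine mul_le_mul (mul_le_mul (hb.bound _) (hb.bound _) (norm_nonneg _) hM) ?_ (by positivity)
    (by positivity)
  refine mul_le_mul_of_nonneg_left ?_ (norm_nonneg _)
  refine (mul_le_mul (key _ _ _ h1 hp0) (key _ _ _ h2 hp1) (Real.sqrt_nonneg _)
    (by positivity)).trans ?_
  have := sqrt_weight_mul_le hp0 hp1
  calc _ = √(Real.exp 1) ^ 2 * ((√(y.2 ^ 2 + 1 ^ 2))⁻¹ *
        (√((a * y.2 + e) ^ 2 + (c * y.2 + d) ^ 2))⁻¹) := by ring
    _ ≤ _ := by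
      rw [Real.sq_sqrt (Real.exp_pos 1).le]
      exact mul_le_mul_of_nonneg_left this (Real.exp_pos 1).le

lemma integral_unfolded {b : ℝ → ℂ} {M : ℝ} (hb : IsAmp b M) {H : ℝ → ℝ} {K : ℝ}
    (hc : Continuous H) (hK : ∀ s, |H s| ≤ K * ((1 + s ^ 2) ^ 2)⁻¹) (lam : ℝ) {a e c d : ℝ}
    (hdet : a * d - e * c = 1) :
    ∫ x₁ : ℝ, ∫ x₂ : ℝ, ∫ s in Set.Ioi (0 : ℝ), ∫ ξ : ℝ,
        unfolded b H lam a e c d (x₁, x₂) (s, ξ) =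
      ∫ s in Set.Ioi (0 : ℝ), specWeight H s * periodPairing b s lam a e c d := by
  set ν : Measure (ℝ × ℝ) := (volume.restrict (Set.Ioi (0 : ℝ))).prod volume with hν
  set wX : ℝ × ℝ → ℝ := fun x => (Set.Icc (0 : ℝ) 1).indicator (fun _ => M) x.1 *
        (Set.Icc (0 : ℝ) 1).indicator (fun _ => M) x.2 with hwX
  set wY : ℝ × ℝ → ℝ := fun y => ‖specWeight H y.1‖ * (Real.exp 1 *
        ((y.2 ^ 2 + 1 ^ 2)⁻¹ + ((a * y.2 + e) ^ 2 + (c * y.2 + d) ^ 2)⁻¹)) with hwY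
  have hind : Integrable ((Set.Icc (0 : ℝ) 1).indicator fun _ => M) :=
    (integrable_indicator_iff measurableSet_Icc).mpr (integrableOn_const (by simp))
  have iX : Integrable wX (volume.prod volume) := hind.mul_prod hind
  have iY : Integrable wY ν := (integrable_specWeight hc hK).norm.integrableOn.mul_prod
    ((pairWeight_integral hdet).1.const_mul _)
  have hm := measurable_unfolded hb hc lam a e c d
  have hbd := norm_unfolded_le hb H lam hdet
  have iΘ : Integrable (fun z : (ℝ × ℝ) × (ℝ × ℝ) => unfolded b H lam a e c d z.1 z.2)
      ((volume.prod volume).prod ν) :=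
    (iX.mul_prod iY).mono' hm.aestronglyMeasurable (.of_forall fun z => hbd z.1 z.2)
  have iΘx : ∀ x, Integrable (fun y => unfolded b H lam a e c d x y) ν := fun x =>
    (iY.const_mul (wX x)).mono' (hm.comp measurable_prodMk_left).aestronglyMeasurable
      (.of_forall fun y => hbd x y)
  have e1 : ∀ x₁ x₂ : ℝ, ∫ s in Set.Ioi (0 : ℝ), ∫ ξ : ℝ,
      unfolded b H lam a e c d (x₁, x₂) (s, ξ) = ∫ y, unfolded b H lam a e c d (x₁, x₂) y ∂ν :=
    fun x₁ x₂ => (integral_prod _ (iΘx (x₁, x₂))).symm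
  simp only [e1]
  rw [← integral_prod (f := fun x => ∫ y, unfolded b H lam a e c d x y ∂ν) iΘ.integral_prod_left,
    integral_integral_swap iΘ]
  -- The two arc-length integrals separate. The second carries the opposite frequency and spectral
  -- parameter, so it is the conjugate of a twisted period with amplitude conj b.
  have e2 : ∀ y : ℝ × ℝ, ∫ x, unfolded b H lam a e c d x y ∂(volume.prod volume) =
      specWeight H y.1 * (boundaryCoef b y.1 lam y.2 1 *
        (starRingEnd ℂ) (boundaryCoef (fun x => (starRingEnd ℂ) (b x)) y.1 lam
          (a * y.2 + e) (c * y.2 + d))) := by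
    intro y
    rw [boundaryCoef, boundaryCoef, ← integral_conj, ← integral_prod_mul, ← integral_const_mul]
    congr 1; ext x
    rw [unfolded, halfPow_neg]
    simp only [map_mul, Complex.conj_conj, ← Complex.exp_conj, Complex.conj_I, Complex.conj_ofReal]
    have : Complex.exp (Complex.I * lam * (x.1 - x.2)) =
        Complex.exp (((lam * x.1 : ℝ) : ℂ) * Complex.I) *
        Complex.exp (((lam * x.2 : ℝ) : ℂ) * -Complex.I) := by
      rw [← Complex.exp_add]; congr 1; push_cast; ring
    rw [this]
    ring
  have iΘy := iΘ.integral_prod_right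
  simp only [e2] at iΘy ⊢
  rw [integral_prod _ iΘy]
  simp only [integral_const_mul]
  rfl

lemma vert_injective : Function.Injective vert := by
  intro x y h
  have : (vert x).im = (vert y).im := by rw [h]
  exact Real.exp_injective this

/-- The spectral expansion holds for distinct points only; for given x₁ at most one x₂ is excluded,
a null set. -/
lemma kernelIntegral_eq {b : ℝ → ℂ} {M : ℝ} (hb : IsAmp b M) {κ H : ℝ → ℝ} {K : ℝ}
    (hker : IsKernelOf κ H) (hc : Continuous H) (heven : ∀ s, H (-s) = H s)
    (hK : ∀ s, |H s| ≤ K * ((1 + s ^ 2) ^ 2)⁻¹) (lam : ℝ) (g₁ g₂ : SL(2, ℝ)) :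
    kernelIntegral b κ lam g₁ g₂ = ((2 * Real.pi ^ 3)⁻¹ : ℝ) * ∫ s in Set.Ioi (0 : ℝ),
      specWeight H s * periodPairing b s lam ((g₁⁻¹ * g₂).1 1 1) (-(g₁⁻¹ * g₂).1 0 1)
        (-(g₁⁻¹ * g₂).1 1 0) ((g₁⁻¹ * g₂).1 0 0) := by
  set g := g₁⁻¹ * g₂ with hg
  have hdet : g.1 1 1 * g.1 0 0 - -g.1 0 1 * -g.1 1 0 = 1 := by
    have : g.1 0 0 * g.1 1 1 - g.1 0 1 * g.1 1 0 = 1 := by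
      rw [← Matrix.det_fin_two]; exact g.2
    linarith
  rw [← integral_unfolded hb hc hK lam hdet, ← integral_const_mul]
  simp only [← integral_const_mul (((2 * Real.pi ^ 3)⁻¹ : ℝ) : ℂ)]
  rw [kernelIntegral]
  congr 1; ext x₁
  refine integral_congr_ae ?_
  have hae : ∀ᵐ x₂ : ℝ, vert x₁ ≠ g • vert x₂ := by
    refine Set.Countable.ae_notMem (s := {x₂ : ℝ | vert x₁ = g • vert x₂}) ?_ volume
    refine Set.Subsingleton.countable fun u hu v hv => ?_
    have h1 : g • vert u = g • vert v := by
      have hu' : vert x₁ = g • vert u := hu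
      have hv' : vert x₁ = g • vert v := hv
      rw [← hu', hv']
    exact vert_injective (smul_left_cancel g h1)
  filter_upwards [hae] with x₂ hx₂
  rw [dist_geod, ← hg, kernel_formula hker hc heven hK hx₂, mul_left_comm, ← integral_const_mul,
    ← integral_const_mul]
  congr 1; ext s
  rw [boundaryPairing, ← integral_const_mul, ← integral_const_mul, ← integral_const_mul]
  congr 1; ext ξ
  have hP : poisson (vert x₁) ξ = Real.exp x₁ / (ξ ^ 2 + Real.exp x₁ ^ 2 * 1 ^ 2) := by
    have := poisson_smul_vert 1 x₁ ξ
    simpa using this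
  rw [hP, poisson_smul_vert, unfolded, specWeight]

/-! ### Localisation of the spectral parameter and the final bounds -/

lemma schwartz_bound (h : 𝓢(ℝ, ℝ)) : ∃ K, 0 ≤ K ∧ ∀ x, |h x| ≤ K * ((1 + x ^ 2) ^ 2)⁻¹ := by
  obtain ⟨C₀, hC₀, h0⟩ := h.decay 0 0
  obtain ⟨C₄, hC₄, h4⟩ := h.decay 4 0
  refine ⟨2 * (C₀ + C₄), by positivity, fun x => ?_⟩
  have e0 := h0 x
  have e4 := h4 x
  simp only [norm_iteratedFDeriv_zero, Real.norm_eq_abs, pow_zero, one_mul] at e0 e4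
  have hx4 : |x| ^ 4 = x ^ 4 := by rw [← abs_pow, abs_of_nonneg (by positivity)]
  rw [hx4] at e4
  rw [← div_eq_mul_inv, le_div_iff₀ (by positivity)]
  have h1 : (1 + x ^ 2) ^ 2 ≤ 2 * (1 + x ^ 4) := by nlinarith [sq_nonneg (x ^ 2 - 1)]
  have h2 := mul_le_mul_of_nonneg_left h1 (abs_nonneg (h x))
  linarith

lemma hShift_even (h : ℝ → ℝ) (t s : ℝ) : hShift h t (-s) = hShift h t s := by
  simp only [hShift, neg_neg]
  ring

lemma continuous_hShift_sq (h : 𝓢(ℝ, ℝ)) (t : ℝ) : Continuous fun s => hShift h t s ^ 2 := by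
  have := h.continuous
  unfold hShift
  fun_prop

/-- The constant depends on t; this bound is used only to justify the spectral expansion. The factor
1 + t² comes from 1 + (u+t)² ≤ 2(1+u²)(1+t²). -/
lemma hShift_sq_bound (h : 𝓢(ℝ, ℝ)) (t : ℝ) :
    ∃ K, ∀ s, |hShift h t s ^ 2| ≤ K * ((1 + s ^ 2) ^ 2)⁻¹ := by
  obtain ⟨K, hK, hb⟩ := schwartz_bound h
  have hT : 0 < 2 * (1 + t ^ 2) := by positivity
  have key : ∀ u s : ℝ, s ^ 2 = (u + t) ^ 2 ∨ s ^ 2 = (u - t) ^ 2 →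
      |h u| ≤ K * ((2 * (1 + t ^ 2)) * (1 + s ^ 2)⁻¹) := by
    intro u s hs
    refine (hb u).trans (mul_le_mul_of_nonneg_left ?_ hK)
    have h1 : ((1 + u ^ 2) ^ 2)⁻¹ ≤ (1 + u ^ 2)⁻¹ := by
      refine inv_anti₀ (by positivity) ?_
      nlinarith [sq_nonneg u]
    refine h1.trans ?_
    rw [← div_eq_mul_inv, le_div_iff₀ (by positivity), ← div_eq_inv_mul,
      div_le_iff₀ (by positivity)]
    rcases hs with hs | hs
    · rw [hs]; nlinarith [sq_nonneg (u - t), sq_nonneg (u * t)]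
    · rw [hs]; nlinarith [sq_nonneg (u + t), sq_nonneg (u * t)]
  refine ⟨(2 * K * (2 * (1 + t ^ 2))) ^ 2, fun s => ?_⟩
  have h1 := key (s - t) s (Or.inl (by ring))
  have h2 := key (-s - t) s (Or.inl (by ring))
  have h3 : |hShift h t s| ≤ 2 * K * (2 * (1 + t ^ 2)) * (1 + s ^ 2)⁻¹ := by
    refine (abs_add_le _ _).trans ?_
    linarith
  rw [abs_pow, ← inv_pow, ← mul_pow]
  exact pow_le_pow_left₀ (abs_nonneg _) h3 2

/-- For s, t > 0 the point -s - t is farther from 0 than s - t, so the reflected bump obeys the same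
bound, with a constant independent of t. -/
lemma hShift_sq_le (h : 𝓢(ℝ, ℝ)) : ∃ K, 0 ≤ K ∧ ∀ t s : ℝ, 0 < t → 0 < s →
    |hShift h t s ^ 2| ≤ K * ((1 + (s - t) ^ 2) ^ 2)⁻¹ := by
  obtain ⟨K, hK, hb⟩ := schwartz_bound h
  refine ⟨(2 * K) ^ 2, by positivity, fun t s ht hs => ?_⟩
  have h1 := hb (s - t)
  have h2 : |h (-s - t)| ≤ K * ((1 + (s - t) ^ 2) ^ 2)⁻¹ := by
    refine (hb _).trans (mul_le_mul_of_nonneg_left (inv_anti₀ (by positivity) ?_) hK)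
    refine pow_le_pow_left₀ (by positivity) ?_ 2
    nlinarith [mul_pos ht hs]
  have hi : ((1 + (s - t) ^ 2) ^ 2)⁻¹ ≤ 1 :=
    inv_le_one_of_one_le₀ (one_le_pow₀ (by nlinarith [sq_nonneg (s - t)]))
  have h3 : |hShift h t s| ≤ 2 * K * ((1 + (s - t) ^ 2) ^ 2)⁻¹ := by
    refine (abs_add_le _ _).trans ?_
    linarith
  have hi0 : 0 ≤ ((1 + (s - t) ^ 2) ^ 2)⁻¹ := by positivity
  rw [abs_pow]
  calc |hShift h t s| ^ 2 ≤ (2 * K * ((1 + (s - t) ^ 2) ^ 2)⁻¹) ^ 2 :=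
        pow_le_pow_left₀ (abs_nonneg _) h3 2
    _ = (2 * K) ^ 2 * (((1 + (s - t) ^ 2) ^ 2)⁻¹ * ((1 + (s - t) ^ 2) ^ 2)⁻¹) := by ring
    _ ≤ _ := mul_le_mul_of_nonneg_left (mul_le_of_le_one_left hi0 hi) (by positivity)

lemma norm_specWeight_le {H : ℝ → ℝ} {s : ℝ} (hs : 0 < s) :
    ‖specWeight H s‖ ≤ 4 * Real.pi ^ 2 * (|H s| * s) := by
  obtain ⟨h1, h2⟩ := norm_bFactor_le_inv_sqrt hs
  have hpi := Real.pi_pos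
  have hsq : 0 < √s := Real.sqrt_pos.mpr hs
  have h3 := mul_le_mul h1 h2 (norm_nonneg _) (by positivity)
  rw [specWeight, norm_mul, norm_mul, Complex.norm_real, Real.norm_eq_abs, abs_mul,
    abs_of_nonneg (sq_nonneg s)]
  have e : 2 * Real.pi / √s * (2 * Real.pi / √s) = 4 * Real.pi ^ 2 / s := by
    rw [div_mul_div_comm, Real.mul_self_sqrt hs.le]; ring
  rw [e] at h3
  calc _ ≤ |H s| * s ^ 2 * (4 * Real.pi ^ 2 / s) := mul_le_mul_of_nonneg_left h3 (by positivity)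
    _ = _ := by field_simp

/-- The passage from bounds for the pairing to bounds for the integral of the kernel. -/
lemma norm_kernelIntegral_le {b : ℝ → ℂ} {M : ℝ} (hb : IsAmp b M) (h : 𝓢(ℝ, ℝ)) {ε : ℝ}
    (hε : 0 < ε) : ∃ C, 0 ≤ C ∧ ∀ (κ : ℝ → ℝ) (t lam : ℝ) (g₁ g₂ : SL(2, ℝ)), 0 < t →
      IsKernelOf κ (fun s => hShift h t s ^ 2) →
      ‖kernelIntegral b κ lam g₁ g₂‖ ≤ C * (1 + t) ∧
      ∀ E, 0 ≤ E → (∀ s, 0 < s → |s - t| ≤ ε * t →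
        ‖periodPairing b s lam ((g₁⁻¹ * g₂).1 1 1) (-(g₁⁻¹ * g₂).1 0 1)
          (-(g₁⁻¹ * g₂).1 1 0) ((g₁⁻¹ * g₂).1 0 0)‖ ≤ s⁻¹ * E) →
        ‖kernelIntegral b κ lam g₁ g₂‖ ≤ C * (E + t⁻¹) := by
  obtain ⟨K, hK0, hK⟩ := hShift_sq_le h
  have hpi := Real.pi_pos
  set P := (M * √(Real.exp 1)) ^ 2 * (2 * Real.pi) with hP
  have hP0 : 0 ≤ P := by positivity
  set c := (2 * Real.pi ^ 3)⁻¹ * (4 * Real.pi ^ 2) * K with hc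
  have hc0 : 0 ≤ c := by positivity
  refine ⟨c * (1 + P * (1 + (1 + ε⁻¹) * ε⁻¹)) * Real.pi, by positivity, ?_⟩
  intro κ t lam g₁ g₂ ht hker
  set g := g₁⁻¹ * g₂ with hg
  have hdet : g.1 1 1 * g.1 0 0 - -g.1 0 1 * -g.1 1 0 = 1 := by
    have : g.1 0 0 * g.1 1 1 - g.1 0 1 * g.1 1 0 = 1 := by
      rw [← Matrix.det_fin_two]; exact g.2
    linarith
  obtain ⟨K', hK'⟩ := hShift_sq_bound h t
  have heq := kernelIntegral_eq hb hker (continuous_hShift_sq h t)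
    (fun s => by rw [hShift_even]) hK' lam g₁ g₂
  rw [← hg] at heq
  have hPP : ∀ s, ‖periodPairing b s lam (g.1 1 1) (-g.1 0 1) (-g.1 1 0) (g.1 0 0)‖ ≤ P :=
    fun s => norm_periodPairing_le hb s lam hdet
  -- Of the two available factors (1+(s-t)²)⁻¹, one pays for the s-integral and contributes π; the
  -- other remains to weight the pairing.
  have gen : ∀ A, 0 ≤ A → (∀ s, 0 < s → (1 + (s - t) ^ 2)⁻¹ * (s *
      ‖periodPairing b s lam (g.1 1 1) (-g.1 0 1) (-g.1 1 0) (g.1 0 0)‖) ≤ A) →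
      ‖kernelIntegral b κ lam g₁ g₂‖ ≤ c * A * Real.pi := by
    intro A hA hs
    have ii : Integrable fun s : ℝ => (1 + (s - t) ^ 2)⁻¹ :=
      integrable_inv_one_add_sq.comp_sub_right t
    have iv : ∫ s : ℝ, (1 + (s - t) ^ 2)⁻¹ = Real.pi := by
      rw [integral_sub_right_eq_self (fun s : ℝ => (1 + s ^ 2)⁻¹), integral_univ_inv_one_add_sq]
    have hb1 : ‖∫ s in Set.Ioi (0 : ℝ), specWeight (fun s => hShift h t s ^ 2) s *
        periodPairing b s lam (g.1 1 1) (-g.1 0 1) (-g.1 1 0) (g.1 0 0)‖ ≤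
        ∫ s in Set.Ioi (0 : ℝ), (4 * Real.pi ^ 2 * K * A) * (1 + (s - t) ^ 2)⁻¹ := by
      refine norm_integral_le_of_norm_le (ii.integrableOn.const_mul _)
        ((ae_restrict_iff' measurableSet_Ioi).mpr (.of_forall fun s hs' => ?_))
      have hs0 : 0 < s := hs'
      rw [norm_mul]
      have w1 := norm_specWeight_le (H := fun s => hShift h t s ^ 2) hs0
      have w2 := hK t s ht hs0
      have w3 := hs s hs0
      set p := ‖periodPairing b s lam (g.1 1 1) (-g.1 0 1) (-g.1 1 0) (g.1 0 0)‖
      have hp : 0 ≤ p := norm_nonneg _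
      have hv : 0 ≤ (1 + (s - t) ^ 2)⁻¹ := by positivity
      calc _ ≤ 4 * Real.pi ^ 2 * (|hShift h t s ^ 2| * s) * p := mul_le_mul_of_nonneg_right w1 hp
        _ ≤ 4 * Real.pi ^ 2 * (K * ((1 + (s - t) ^ 2) ^ 2)⁻¹ * s) * p := by gcongr
        _ = 4 * Real.pi ^ 2 * K * (1 + (s - t) ^ 2)⁻¹ * ((1 + (s - t) ^ 2)⁻¹ * (s * p)) := by
            rw [← inv_pow]; ring
        _ ≤ 4 * Real.pi ^ 2 * K * (1 + (s - t) ^ 2)⁻¹ * A :=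
            mul_le_mul_of_nonneg_left w3 (by positivity)
        _ = _ := by ring
    have hb2 : ∫ s in Set.Ioi (0 : ℝ), (4 * Real.pi ^ 2 * K * A) * (1 + (s - t) ^ 2)⁻¹ ≤
        4 * Real.pi ^ 2 * K * A * Real.pi := by
      rw [integral_const_mul]
      refine mul_le_mul_of_nonneg_left ?_ (by positivity)
      rw [← iv]
      exact setIntegral_le_integral ii (.of_forall fun s => by positivity)
    rw [heq, norm_mul, Complex.norm_real, Real.norm_of_nonneg (by positivity)]
    calc _ ≤ (2 * Real.pi ^ 3)⁻¹ * (4 * Real.pi ^ 2 * K * A * Real.pi) :=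
          mul_le_mul_of_nonneg_left (hb1.trans hb2) (by positivity)
      _ = _ := by rw [hc]; ring
  have hweight : ∀ s : ℝ, (1 + (s - t) ^ 2)⁻¹ ≤ 1 := fun s =>
    inv_le_one_of_one_le₀ (by nlinarith [sq_nonneg (s - t)])
  have hw1 : ∀ s : ℝ, (1 + (s - t) ^ 2)⁻¹ * |s - t| ≤ 1 := fun s => by
    rw [← div_eq_inv_mul, div_le_one (by positivity), ← sq_abs (s - t)]
    nlinarith [sq_nonneg (|s - t| - 1), abs_nonneg (s - t)]
  have hw2 : ∀ s : ℝ, (1 + (s - t) ^ 2)⁻¹ * |s - t| ^ 2 ≤ 1 := fun s => by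
    rw [← div_eq_inv_mul, div_le_one (by positivity), sq_abs]
    linarith
  have hε' : 0 < ε⁻¹ := inv_pos.mpr hε
  constructor
  · refine (gen (P * (1 + t)) (by positivity) fun s hs => ?_).trans ?_
    · have h1 : s ≤ |s - t| + t := by linarith [le_abs_self (s - t)]
      have hv : 0 ≤ (1 + (s - t) ^ 2)⁻¹ := by positivity
      calc _ ≤ (1 + (s - t) ^ 2)⁻¹ * ((|s - t| + t) * P) := by
            refine mul_le_mul_of_nonneg_left ?_ hv
            exact mul_le_mul h1 (hPP s) (norm_nonneg _) (by positivity)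
        _ = P * ((1 + (s - t) ^ 2)⁻¹ * |s - t| + (1 + (s - t) ^ 2)⁻¹ * t) := by ring
        _ ≤ P * (1 + 1 * t) := by
            refine mul_le_mul_of_nonneg_left (add_le_add (hw1 s) ?_) hP0
            exact mul_le_mul_of_nonneg_right (hweight s) ht.le
        _ = _ := by ring
    · have : 0 ≤ 1 + P * ((1 + ε⁻¹) * ε⁻¹) := by positivity
      have h2 : P ≤ 1 + P * (1 + (1 + ε⁻¹) * ε⁻¹) := by linarith
      calc c * (P * (1 + t)) * Real.pi = c * P * Real.pi * (1 + t) := by ring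
        _ ≤ c * (1 + P * (1 + (1 + ε⁻¹) * ε⁻¹)) * Real.pi * (1 + t) := by gcongr
  · intro E hE hwin
    refine (gen ((1 + P * (1 + (1 + ε⁻¹) * ε⁻¹)) * (E + t⁻¹)) (by positivity)
      fun s hs => ?_).trans (le_of_eq (by ring))
    have hv : 0 ≤ (1 + (s - t) ^ 2)⁻¹ := by positivity
    have hti : 0 ≤ t⁻¹ := by positivity
    rcases le_or_gt |s - t| (ε * t) with h1 | h1
    · have h2 := mul_le_mul_of_nonneg_left (hwin s hs h1) hs.le
      rw [← mul_assoc, mul_inv_cancel₀ hs.ne', one_mul] at h2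
      calc _ ≤ 1 * E := mul_le_mul (hweight s) h2 (by positivity) zero_le_one
        _ ≤ 1 * (E + t⁻¹) := by linarith
        _ ≤ _ := by
            refine mul_le_mul_of_nonneg_right ?_ (by positivity)
            have : 0 ≤ P * (1 + (1 + ε⁻¹) * ε⁻¹) := by positivity
            linarith
    -- Outside the window both s and t are bounded by multiples of |s-t|, so the remaining weight
    -- absorbs st. With the trivial bound for the pairing this leaves O(1/t).
    · set u := |s - t| with hu
      have hu0 : 0 ≤ u := abs_nonneg _
      have h2 : t ≤ ε⁻¹ * u := by
        rw [← div_eq_inv_mul, le_div_iff₀ hε]; linarith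
      have h3 : s ≤ (1 + ε⁻¹) * u := by linarith [le_abs_self (s - t)]
      have h4 : s * t ≤ (1 + ε⁻¹) * u * (ε⁻¹ * u) :=
        mul_le_mul h3 h2 ht.le (by positivity)
      calc _ ≤ (1 + (s - t) ^ 2)⁻¹ * (s * P) := by
            refine mul_le_mul_of_nonneg_left (mul_le_mul_of_nonneg_left (hPP s) hs.le) hv
        _ = (1 + (s - t) ^ 2)⁻¹ * (s * t) * (P * t⁻¹) := by field_simp
        _ ≤ (1 + (s - t) ^ 2)⁻¹ * ((1 + ε⁻¹) * u * (ε⁻¹ * u)) * (P * t⁻¹) := by gcongr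
        _ = ((1 + (s - t) ^ 2)⁻¹ * u ^ 2) * (P * ((1 + ε⁻¹) * ε⁻¹) * t⁻¹) := by ring
        _ ≤ 1 * (P * ((1 + ε⁻¹) * ε⁻¹) * t⁻¹) :=
            mul_le_mul_of_nonneg_right (hw2 s) (by positivity)
        _ ≤ (1 + P * (1 + (1 + ε⁻¹) * ε⁻¹)) * (E + t⁻¹) := by
            rw [one_mul]
            refine mul_le_mul ?_ (by linarith) hti (by positivity)
            linarith

lemma exists_isAmp {b : ℝ → ℂ} (hb : ContDiff ℝ ∞ b) (hsupp : tsupport b ⊆ Set.Icc 0 1) :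
    ∃ M, IsAmp b M ∧ IsAmp (deriv b) M := by
  have hz : ∀ x, x ∉ Set.Icc (0 : ℝ) 1 → b x = 0 := fun x hx =>
    image_eq_zero_of_notMem_tsupport fun h => hx (hsupp h)
  have hcs : HasCompactSupport b := HasCompactSupport.intro isCompact_Icc hz
  have hd : ContDiff ℝ ∞ (deriv b) := ((contDiff_infty_iff_deriv (𝕜 := ℝ)).mp hb).2
  have hdd : ContDiff ℝ ∞ (deriv (deriv b)) := ((contDiff_infty_iff_deriv (𝕜 := ℝ)).mp hd).2
  obtain ⟨M₀, h0⟩ := hcs.exists_bound_of_continuous hb.continuous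
  obtain ⟨M₁, h1⟩ := hcs.deriv.exists_bound_of_continuous hd.continuous
  obtain ⟨M₂, h2⟩ := hcs.deriv.deriv.exists_bound_of_continuous hdd.continuous
  have m0 : M₀ ≤ max M₀ (max M₁ M₂) := le_max_left _ _
  have m1 : M₁ ≤ max M₀ (max M₁ M₂) := (le_max_left _ _).trans (le_max_right _ _)
  have m2 : M₂ ≤ max M₀ (max M₁ M₂) := (le_max_right _ _).trans (le_max_right _ _)
  have hA : IsAmp b (max M₀ (max M₁ M₂)) :=
    ⟨hb, hz, fun x => (h0 x).trans m0, fun x => (h1 x).trans m1⟩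
  exact ⟨_, hA, hd, fun x hx => hA.deriv_supp hx, fun x => (h1 x).trans m1,
    fun x => (h2 x).trans m2⟩

lemma inv_sqrt_le_inv_sqrt {x y c : ℝ} (hx : 0 < x) (hy : 0 < y) (h : y ≤ c * x) :
    (√x)⁻¹ ≤ √c * (√y)⁻¹ := by
  have hc : 0 ≤ c := by
    by_contra hc
    nlinarith
  rw [← div_eq_mul_inv, le_div_iff₀ (Real.sqrt_pos.mpr hy), inv_mul_le_iff₀ (Real.sqrt_pos.mpr hx),
    mul_comm (√x), ← Real.sqrt_mul hc]
  exact Real.sqrt_le_sqrt h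

lemma inv_sqrt_eq_rpow {x : ℝ} (hx : 0 ≤ x) : (√x)⁻¹ = x ^ (-(1 / 2) : ℝ) := by
  rw [Real.sqrt_eq_rpow, Real.rpow_neg hx]

/-- From n ≤ Km the bound in m passes to one in n. The error 1/t is absorbed because n is bounded,
so that 1 + tn = O(t²). -/
lemma inv_sqrt_add_inv_le {t m n K B c : ℝ} (ht : 1 ≤ t) (hc : 0 ≤ c) (hm : 0 ≤ m) (hmB : m ≤ B)
    (hn : 0 ≤ n) (hK : 1 ≤ K) (hnm : n ≤ K * m) :
    c * (√(1 + t * m))⁻¹ + t⁻¹ ≤ (c * √K + √(1 + K * B)) * (1 + t * n) ^ (-(1 / 2) : ℝ) := by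
  have ht0 : 0 < t := by linarith
  have hy : 0 < 1 + t * n := by positivity
  have hx : 0 < 1 + t * m := by positivity
  have hB : 0 ≤ B := hm.trans hmB
  rw [← inv_sqrt_eq_rpow hy.le]
  have h1 : (√(1 + t * m))⁻¹ ≤ √K * (√(1 + t * n))⁻¹ := by
    refine inv_sqrt_le_inv_sqrt hx hy ?_
    nlinarith [mul_le_mul_of_nonneg_left hnm ht0.le]
  have h2 : (√(t ^ 2))⁻¹ ≤ √(1 + K * B) * (√(1 + t * n))⁻¹ := by
    refine inv_sqrt_le_inv_sqrt (by positivity) hy ?_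
    have h3 : n ≤ K * B := hnm.trans (mul_le_mul_of_nonneg_left hmB (by linarith))
    have h4 : t ≤ t ^ 2 := by nlinarith
    have h5 : t * n ≤ t ^ 2 * (K * B) := mul_le_mul h4 h3 hn (by positivity)
    nlinarith
  rw [Real.sqrt_sq ht0.le] at h2
  nlinarith [mul_le_mul_of_nonneg_left h1 hc]

/-- The two regimes agree in order at n = t^(-1/3), where tn = t^(2/3). Such a comparison is needed
because the argument splits according to the matrix entries, while the theorem splits according to
n. -/
lemma rpow_neg_third_le_inv_sqrt {t n : ℝ} (ht : 1 ≤ t) (hn : 0 ≤ n)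
    (h : n ≤ t ^ (-(1 / 3) : ℝ)) :
    t ^ (-(1 / 3) : ℝ) ≤ √2 * (1 + t * n) ^ (-(1 / 2) : ℝ) := by
  have ht0 : 0 < t := by linarith
  have hy : 0 < 1 + t * n := by positivity
  have e1 : t ^ (-(1 / 3) : ℝ) = (√(t ^ (2 / 3 : ℝ)))⁻¹ := by
    rw [inv_sqrt_eq_rpow (by positivity), ← Real.rpow_mul ht0.le]; norm_num
  have e2 : t * t ^ (-(1 / 3) : ℝ) = t ^ (2 / 3 : ℝ) := by
    rw [← Real.rpow_one_add' ht0.le (by norm_num)]; norm_num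
  rw [← inv_sqrt_eq_rpow hy.le, e1]
  refine inv_sqrt_le_inv_sqrt (by positivity) hy ?_
  have h1 : 1 ≤ t ^ (2 / 3 : ℝ) := Real.one_le_rpow ht (by norm_num)
  nlinarith [mul_le_mul_of_nonneg_left h ht0.le]

lemma inv_sqrt_le_rpow_neg_third {t n : ℝ} (ht : 0 < t) (h : t ^ (-(1 / 3) : ℝ) ≤ n) :
    (1 + t * n) ^ (-(1 / 2) : ℝ) ≤ t ^ (-(1 / 3) : ℝ) := by
  have e2 : t * t ^ (-(1 / 3) : ℝ) = t ^ (2 / 3 : ℝ) := by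
    rw [← Real.rpow_one_add' ht.le (by norm_num)]; norm_num
  calc (1 + t * n) ^ (-(1 / 2) : ℝ) ≤ (t ^ (2 / 3 : ℝ)) ^ (-(1 / 2) : ℝ) := by
        refine Real.rpow_le_rpow_of_nonpos (by positivity) ?_ (by norm_num)
        nlinarith [mul_le_mul_of_nonneg_left h ht.le]
    _ = t ^ (-(1 / 3) : ℝ) := by rw [← Real.rpow_mul ht.le]; norm_num

lemma one_le_sqrt_mul_rpow {x c : ℝ} (hx : 0 < x) (h : x ≤ c) : 1 ≤ √c * x ^ (-(1 / 2) : ℝ) := by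
  rw [← inv_sqrt_eq_rpow hx.le]
  simpa using inv_sqrt_le_inv_sqrt one_pos hx (by simpa using h)

set_option maxHeartbeats 800000 in
lemma norm_kernelIntegral_le_oriented {b : ℝ → ℂ} {M : ℝ} (hb : IsAmp b M)
    (hb' : IsAmp (deriv b) M) (h : 𝓢(ℝ, ℝ)) {δ : ℝ} (hδ : 0 < δ) : ∃ C, 0 < C ∧
    ∀ (κ : ℝ → ℝ) (t lam : ℝ) (g₁ g₂ : SL(2, ℝ)), 0 < t →
      IsKernelOf κ (fun s => hShift h t s ^ 2) → lam / t ∈ Set.Icc δ (1 - δ) →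
      segDist g₁ g₂ ≤ 1 →
      (nOr g₁ g₂ ≤ t ^ (-(1 / 3) : ℝ) →
        ‖kernelIntegral b κ lam g₁ g₂‖ ≤ C * (1 + t * nOr g₁ g₂) ^ (-(1 / 2) : ℝ)) ∧
      (t ^ (-(1 / 3) : ℝ) ≤ nOr g₁ g₂ →
        ‖kernelIntegral b κ lam g₁ g₂‖ ≤ C * t ^ (-(1 / 3) : ℝ)) := by
  obtain ⟨L, hL, hent⟩ := exists_entry_bound
  -- Halving δ leaves room for s to vary around t: in the window |s-t| ≤ δt/4 the ratio λ/s stays in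
  -- [δ/2, 1-δ/2].
  obtain ⟨C₁, c₀, hC₁, -, hc₀, H₁⟩ := norm_periodPairing_le_oriented hb hb' (half_pos hδ) hL
  obtain ⟨C₂, hC₂, H₂⟩ := norm_kernelIntegral_le hb h (by positivity : 0 < δ / 4)
  set K := 10 * L ^ 3 with hK
  have hK1 : 1 ≤ K := by nlinarith [one_le_pow₀ hL (n := 3)]
  set A := C₂ * (C₁ * √2 * √K + √(1 + K * (1 / 2))) with hA
  have hA0 : 0 ≤ A := by positivity
  set B := C₂ * (C₁ * 2 + 1) with hB
  have hB0 : 0 ≤ B := by positivity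
  refine ⟨1 + A + √2 * B + 6 * C₂ * √3, by positivity, ?_⟩
  intro κ t lam g₁ g₂ ht hκ hlam hd
  obtain ⟨htriv, hmain⟩ := H₂ κ t lam g₁ g₂ ht hκ
  have hg := hent g₁ g₂ hd
  have hn : 0 ≤ nOr g₁ g₂ := nDist_nonneg _ _ _
  have hy : 0 < 1 + t * nOr g₁ g₂ := by positivity
  have hyp : 0 ≤ (1 + t * nOr g₁ g₂) ^ (-(1 / 2) : ℝ) := by positivity
  have htp : 0 ≤ t ^ (-(1 / 3) : ℝ) := by positivity
  have hs3 : 1 ≤ √3 := by rw [Real.one_le_sqrt]; norm_num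
  have hs2 : 1 ≤ √2 := by rw [Real.one_le_sqrt]; norm_num
  have hs2B : B ≤ √2 * B := by nlinarith
  have hC3 : 0 ≤ 6 * C₂ * √3 := by positivity
  have hdet : (g₁⁻¹ * g₂).1 1 1 * (g₁⁻¹ * g₂).1 0 0 -
      -(g₁⁻¹ * g₂).1 0 1 * -(g₁⁻¹ * g₂).1 1 0 = 1 := by
    have := (g₁⁻¹ * g₂).2
    rw [Matrix.det_fin_two] at this
    linarith
  have hnle := nOr_le hL hg
  set n := nOr g₁ g₂
  set g := g₁⁻¹ * g₂
  obtain ⟨hl1, hl2⟩ := hlam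
  rw [le_div_iff₀ ht] at hl1
  rw [div_le_iff₀ ht] at hl2
  -- For t ≤ 2 both right-hand sides are bounded below, so the trivial bound suffices; for t > 2 the
  -- window lies in s ≥ 1.
  rcases le_or_gt t 2 with h2 | h2
  · have h3 : ‖kernelIntegral b κ lam g₁ g₂‖ ≤ 3 * C₂ := htriv.trans (by nlinarith)
    have e2 : t * t ^ (-(1 / 3) : ℝ) = t ^ (2 / 3 : ℝ) := by
      rw [← Real.rpow_one_add' ht.le (by norm_num)]; norm_num
    have h4 : t ^ (2 / 3 : ℝ) ≤ 2 := by
      calc t ^ (2 / 3 : ℝ) ≤ 2 ^ (2 / 3 : ℝ) := Real.rpow_le_rpow ht.le h2 (by norm_num)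
        _ ≤ 2 ^ (1 : ℝ) := Real.rpow_le_rpow_of_exponent_le (by norm_num) (by norm_num)
        _ = 2 := Real.rpow_one 2
    constructor
    · intro hn3
      have h5 : 1 ≤ √3 * (1 + t * n) ^ (-(1 / 2) : ℝ) :=
        one_le_sqrt_mul_rpow hy (by nlinarith [mul_le_mul_of_nonneg_left hn3 ht.le])
      calc _ ≤ 3 * C₂ * 1 := by linarith
        _ ≤ 3 * C₂ * (√3 * (1 + t * n) ^ (-(1 / 2) : ℝ)) := by gcongr
        _ ≤ 6 * C₂ * √3 * (1 + t * n) ^ (-(1 / 2) : ℝ) := by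
            rw [← mul_assoc]; gcongr; norm_num
        _ ≤ _ := by gcongr; linarith [mul_nonneg (Real.sqrt_nonneg 2) hB0]
    · intro _
      have h5 : 1 ≤ 2 * t ^ (-(1 / 3) : ℝ) := by
        have : (2 : ℝ)⁻¹ ≤ t ^ (-(1 / 3) : ℝ) := by
          calc (2 : ℝ)⁻¹ = 2 ^ (-1 : ℝ) := (Real.rpow_neg_one 2).symm
            _ ≤ 2 ^ (-(1 / 3) : ℝ) :=
              Real.rpow_le_rpow_of_exponent_le (by norm_num) (by norm_num)
            _ ≤ _ := Real.rpow_le_rpow_of_nonpos ht h2 (by norm_num)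
        linarith
      calc _ ≤ 3 * C₂ * 1 := by linarith
        _ ≤ 3 * C₂ * (2 * t ^ (-(1 / 3) : ℝ)) := by gcongr
        _ = 6 * C₂ * 1 * t ^ (-(1 / 3) : ℝ) := by ring
        _ ≤ 6 * C₂ * √3 * t ^ (-(1 / 3) : ℝ) := by gcongr
        _ ≤ _ := by gcongr; linarith [mul_nonneg (Real.sqrt_nonneg 2) hB0]
  · have hδ1 : δ ≤ 1 / 2 := by nlinarith
    have hwin : ∀ s, |s - t| ≤ δ / 4 * t → t / 2 ≤ s ∧ 1 ≤ s ∧ δ / 2 * s ≤ lam ∧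
        lam ≤ (1 - δ / 2) * s := by
      intro s hs
      obtain ⟨hs1, hs2⟩ := abs_le.mp hs
      have q1 : δ / 4 * t ≤ t / 8 := by nlinarith
      have q2 : (1 - δ) * t ≤ (1 - δ / 2) * ((1 - δ / 4) * t) := by
        nlinarith [mul_pos hδ ht, mul_pos (mul_pos hδ hδ) ht]
      have q3 : (1 - δ / 2) * ((1 - δ / 4) * t) ≤ (1 - δ / 2) * s :=
        mul_le_mul_of_nonneg_left (by linarith) (by linarith)
      refine ⟨by linarith, by linarith, ?_, by linarith⟩
      have : δ / 2 * s ≤ δ / 2 * (2 * t) := mul_le_mul_of_nonneg_left (by linarith) (by linarith)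
      linarith
    set m := |g.1 0 1| + |g.1 1 0| with hm
    have hm0 : 0 ≤ m := by positivity
    -- Small m yields the decay (1+tn)^(-1/2), which is weakened if n happens to exceed t^(-1/3).
    -- Large m yields t^(-1/3), which implies the stated bound even if n is at most t^(-1/3).
    rcases le_total m c₀ with hmc | hmc
    · have hI : ‖kernelIntegral b κ lam g₁ g₂‖ ≤ A * (1 + t * n) ^ (-(1 / 2) : ℝ) := by
        refine (hmain (C₁ * √2 * (√(1 + t * m))⁻¹) (by positivity) fun s hs0 hs => ?_).trans ?_
        · obtain ⟨w1, w2, w3, w4⟩ := hwin s hs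
          have q := (H₁ s lam _ _ _ _ w2 w3 w4 (hg 1 1) (by rw [abs_neg]; exact hg 0 1)
            (by rw [abs_neg]; exact hg 1 0) (hg 0 0) hdet).1 (by simpa only [abs_neg] using hmc)
          rw [abs_neg, abs_neg, ← hm] at q
          refine q.trans ?_
          rw [mul_comm C₁, mul_assoc, mul_assoc C₁]
          gcongr
          exact inv_sqrt_le_inv_sqrt (by positivity) (by positivity)
            (by linarith [mul_le_mul_of_nonneg_right w1 hm0])
        · rw [hA, mul_assoc C₂]
          refine mul_le_mul_of_nonneg_left ?_ hC₂
          exact inv_sqrt_add_inv_le (t := t) (by linarith) (mul_nonneg hC₁ (Real.sqrt_nonneg 2)) hm0 (hmc.trans hc₀) hn hK1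
            (hnle (hmc.trans hc₀))
      have hle : A ≤ 1 + A + √2 * B + 6 * C₂ * √3 := by
        linarith [mul_nonneg (Real.sqrt_nonneg 2) hB0]
      refine ⟨fun _ => hI.trans (mul_le_mul_of_nonneg_right hle hyp), fun hn3 => ?_⟩
      exact hI.trans (mul_le_mul hle (inv_sqrt_le_rpow_neg_third ht hn3) hyp (by linarith))
    · have hI : ‖kernelIntegral b κ lam g₁ g₂‖ ≤ B * t ^ (-(1 / 3) : ℝ) := by
        refine (hmain (C₁ * (2 * t ^ (-(1 / 3) : ℝ))) (by positivity) fun s hs0 hs => ?_).trans ?_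
        · obtain ⟨w1, w2, w3, w4⟩ := hwin s hs
          have q := (H₁ s lam _ _ _ _ w2 w3 w4 (hg 1 1) (by rw [abs_neg]; exact hg 0 1)
            (by rw [abs_neg]; exact hg 1 0) (hg 0 0) hdet).2 (by simpa only [abs_neg] using hmc)
          refine q.trans ?_
          rw [mul_comm C₁, mul_assoc]
          gcongr
          calc s ^ (-(1 / 3) : ℝ) ≤ (2⁻¹ * t) ^ (-(1 / 3) : ℝ) :=
                Real.rpow_le_rpow_of_nonpos (by positivity) (by linarith) (by norm_num)
            _ = (2 : ℝ)⁻¹ ^ (-(1 / 3) : ℝ) * t ^ (-(1 / 3) : ℝ) :=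
                Real.mul_rpow (by norm_num) ht.le
            _ ≤ _ := by
                gcongr
                rw [Real.inv_rpow (by norm_num), ← Real.rpow_neg (by norm_num)]
                calc (2 : ℝ) ^ (-(-(1 / 3)) : ℝ) ≤ 2 ^ (1 : ℝ) :=
                      Real.rpow_le_rpow_of_exponent_le (by norm_num) (by norm_num)
                  _ = 2 := Real.rpow_one 2
        · have : t⁻¹ ≤ t ^ (-(1 / 3) : ℝ) := by
            rw [← Real.rpow_neg_one]
            exact Real.rpow_le_rpow_of_exponent_le (by linarith) (by norm_num)
          rw [hB, mul_assoc]
          gcongr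
          linarith
      have hle : √2 * B ≤ 1 + A + √2 * B + 6 * C₂ * √3 := by linarith
      refine ⟨fun hn3 => hI.trans ?_, fun _ =>
        hI.trans (mul_le_mul_of_nonneg_right (hs2B.trans hle) htp)⟩
      calc B * t ^ (-(1 / 3) : ℝ) ≤ B * (√2 * (1 + t * n) ^ (-(1 / 2) : ℝ)) := by
            gcongr
            exact rpow_neg_third_le_inv_sqrt (by linarith) hn hn3
        _ = √2 * B * (1 + t * n) ^ (-(1 / 2) : ℝ) := by ring
        _ ≤ _ := mul_le_mul_of_nonneg_right hle hyp

lemma norm_kernelIntegral_le_unoriented {b : ℝ → ℂ} {M : ℝ} (hb : IsAmp b M)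
    (hb' : IsAmp (deriv b) M) (h : 𝓢(ℝ, ℝ)) : ∃ C, 0 < C ∧
    ∀ (κ : ℝ → ℝ) (t : ℝ) (g₁ g₂ : SL(2, ℝ)), 0 < t →
      IsKernelOf κ (fun s => hShift h t s ^ 2) → segDist g₁ g₂ ≤ 1 →
      ‖kernelIntegral b κ 0 g₁ g₂‖ ≤ C * (1 + t * nUn g₁ g₂) ^ (-(1 / 2) : ℝ) := by
  obtain ⟨L, hL, hent⟩ := exists_entry_bound
  obtain ⟨C₁, hC₁, H₁⟩ := norm_periodPairing_le_unoriented hb hb' hL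
  obtain ⟨C₂, hC₂, H₂⟩ := norm_kernelIntegral_le hb h one_half_pos
  set K := 20 * L ^ 4 with hK
  have hK1 : 1 ≤ K := by nlinarith [one_le_pow₀ hL (n := 4)]
  set D := 2 * L ^ 2 with hD
  set A := C₂ * (C₁ * √2 * √K + √(1 + K * D)) with hA
  have hA0 : 0 ≤ A := by positivity
  refine ⟨1 + A + 3 * C₂ * √(1 + 2 * (K * D)), by positivity, ?_⟩
  intro κ t g₁ g₂ ht hκ hd
  obtain ⟨htriv, hmain⟩ := H₂ κ t 0 g₁ g₂ ht hκ
  have hg := hent g₁ g₂ hd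
  have hn : 0 ≤ nUn g₁ g₂ := nDist_nonneg _ _ _
  have hy : 0 < 1 + t * nUn g₁ g₂ := by positivity
  have hyp : 0 ≤ (1 + t * nUn g₁ g₂) ^ (-(1 / 2) : ℝ) := by positivity
  have hdet : (g₁⁻¹ * g₂).1 1 1 * (g₁⁻¹ * g₂).1 0 0 -
      -(g₁⁻¹ * g₂).1 0 1 * -(g₁⁻¹ * g₂).1 1 0 = 1 := by
    have := (g₁⁻¹ * g₂).2
    rw [Matrix.det_fin_two] at this
    linarith
  have hnle := nUn_le hL hg
  set n := nUn g₁ g₂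
  set g := g₁⁻¹ * g₂
  set m := |g.1 0 1| * |g.1 0 0| + |g.1 1 1| * |g.1 1 0| with hm
  have hm0 : 0 ≤ m := by positivity
  have hmD : m ≤ D := by
    have q : ∀ i j k l, |g.1 i j| * |g.1 k l| ≤ L * L := fun i j k l =>
      mul_le_mul (hg i j) (hg k l) (abs_nonneg _) (by linarith)
    have q1 := q 0 1 0 0
    have q2 := q 1 1 1 0
    nlinarith
  have hnD : n ≤ K * D := hnle.trans (mul_le_mul_of_nonneg_left hmD (by linarith))
  have hKD : 0 ≤ K * D := hn.trans hnD
  rcases le_or_gt t 2 with h2 | h2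
  · have h3 : ‖kernelIntegral b κ 0 g₁ g₂‖ ≤ 3 * C₂ := htriv.trans (by nlinarith)
    have h5 : 1 ≤ √(1 + 2 * (K * D)) * (1 + t * n) ^ (-(1 / 2) : ℝ) :=
      -- Closeness of the segments bounds n by KD, so 1 + tn is bounded for t ≤ 2.
      one_le_sqrt_mul_rpow hy (by linarith [mul_le_mul h2 hnD hn zero_le_two])
    calc _ ≤ 3 * C₂ * 1 := by linarith
      _ ≤ 3 * C₂ * (√(1 + 2 * (K * D)) * (1 + t * n) ^ (-(1 / 2) : ℝ)) := by gcongr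
      _ = 3 * C₂ * √(1 + 2 * (K * D)) * (1 + t * n) ^ (-(1 / 2) : ℝ) := by ring
      _ ≤ _ := by gcongr; linarith
  · have hI : ‖kernelIntegral b κ 0 g₁ g₂‖ ≤ A * (1 + t * n) ^ (-(1 / 2) : ℝ) := by
      refine (hmain (C₁ * √2 * (√(1 + t * m))⁻¹) (by positivity) fun s hs0 hs => ?_).trans ?_
      · have w1 : t / 2 ≤ s := by linarith [(abs_le.mp hs).1]
        have q := H₁ s _ _ _ _ (by linarith) (hg 1 1) (by rw [abs_neg]; exact hg 0 1)
          (by rw [abs_neg]; exact hg 1 0) (hg 0 0) hdet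
        rw [abs_neg, abs_neg, ← hm] at q
        refine q.trans ?_
        rw [mul_comm C₁, mul_assoc, mul_assoc C₁]
        gcongr
        exact inv_sqrt_le_inv_sqrt (by positivity) (by positivity)
            (by linarith [mul_le_mul_of_nonneg_right w1 hm0])
      · rw [hA, mul_assoc C₂]
        refine mul_le_mul_of_nonneg_left ?_ hC₂
        exact inv_sqrt_add_inv_le (t := t) (by linarith) (mul_nonneg hC₁ (Real.sqrt_nonneg 2)) hm0 hmD hn hK1 hnle
    refine hI.trans (mul_le_mul_of_nonneg_right ?_ hyp)
    have : 0 ≤ 3 * C₂ * √(1 + 2 * (K * D)) := by positivity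
    linarith

end GeodesicPeriod

end

theorem mainTheorem7
    (b : ℝ → ℂ) (hb : ContDiff ℝ ∞ b) (hbsupp : tsupport b ⊆ Set.Icc 0 1)
    (h : 𝓢(ℝ, ℝ)) (hPW : HasCompactSupport (𝓕 (fun x : ℝ => (h x : ℂ))))
    (hnonneg : ∀ x, 0 ≤ h x) (heven : ∀ x, h (-x) = h x)
    (hone : ∀ x ∈ Set.Icc (-1 : ℝ) 1, 1 ≤ h x)
    (k : ℝ → ℝ → ℝ)
    (hk : ∀ t, 0 < t → GeodesicPeriod.IsKernelOf (k t)
      (fun s => GeodesicPeriod.hShift h t s ^ 2)) :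
    (∀ δ : ℝ, 0 < δ → δ < 1 / 2 → ∃ C : ℝ, 0 < C ∧
      ∀ (t lam : ℝ) (g₁ g₂ : Matrix.SpecialLinearGroup (Fin 2) ℝ), 0 < t →
        lam / t ∈ Set.Icc δ (1 - δ) → GeodesicPeriod.segDist g₁ g₂ ≤ 1 →
        (GeodesicPeriod.nOr g₁ g₂ ≤ t ^ (-(1 / 3) : ℝ) →
          ‖GeodesicPeriod.kernelIntegral b (k t) lam g₁ g₂‖ ≤
            C * (1 + t * GeodesicPeriod.nOr g₁ g₂) ^ (-(1 / 2) : ℝ)) ∧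
        (t ^ (-(1 / 3) : ℝ) ≤ GeodesicPeriod.nOr g₁ g₂ →
          ‖GeodesicPeriod.kernelIntegral b (k t) lam g₁ g₂‖ ≤ C * t ^ (-(1 / 3) : ℝ))) ∧
    (∃ C : ℝ, 0 < C ∧
      ∀ (t : ℝ) (g₁ g₂ : Matrix.SpecialLinearGroup (Fin 2) ℝ), 0 < t →
        GeodesicPeriod.segDist g₁ g₂ ≤ 1 →
        ‖GeodesicPeriod.kernelIntegral b (k t) 0 g₁ g₂‖ ≤
          C * (1 + t * GeodesicPeriod.nUn g₁ g₂) ^ (-(1 / 2) : ℝ)) := by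
  obtain ⟨M, hA, hA'⟩ := GeodesicPeriod.exists_isAmp hb hbsupp
  refine ⟨fun δ hδ _ => ?_, ?_⟩
  · obtain ⟨C, hC, H⟩ := GeodesicPeriod.norm_kernelIntegral_le_oriented hA hA' h hδ
    exact ⟨C, hC, fun t lam g₁ g₂ ht hl hd => H (k t) t lam g₁ g₂ ht (hk t ht) hl hd⟩
  · obtain ⟨C, hC, H⟩ := GeodesicPeriod.norm_kernelIntegral_le_unoriented hA hA' h
    exact ⟨C, hC, fun t g₁ g₂ ht hd => H (k t) t g₁ g₂ ht (hk t ht) hd⟩
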